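/- Let $p$ be an odd prime, $L/K$ a separable field extension of degree $2p$, $\widetilde L/K$ its normal closure and $G=\mathrm{Gal}(\widetilde L/K)$. A Hopf Galois structure on $L/K$ is a pair $(H,\mu)$, where $H$ is a finite cocommutative $K$-Hopf algebra and $\mu:H\to\mathrm{End}_K(L)$ is a $K$-linear map making $L$ a left $H$-module algebra such that $L\otimes_K H\to \mathrm{End}_K(L)$, $x\otimes h\mapsto (y\mapsto x\,\mu(h)(y))$, is bijective; two structures are identified if there is an isomorphism of $K$-Hopf algebras compatible with the actions. It is of type $N$, for a finite group $N$, if $\widetilde L\otimes_K H\cong \widetilde L[N]$ as $\widetilde L$-Hopf algebras, and of dihedral type if it is of type $D_{2p}$, the dihedral group of order $2p$. Let $C_n$ denote the cyclic group of order $n$. The following are equivalent: (a) $L/K$ has a Hopf Galois structure of dihedral type; (b) $G$ is isomorphic to a semidirect product (for some action) of one of the forms (i) $(C_p\times C_p)\rtimes C_m$ with $m$ even, $m\mid p-1$; (ii) $(C_p\times C_p)\rtimes (C_2\times C_m)$ with $m$ even, $m\mid p-1$; (iii) $C_{2p}\rtimes C_m$ with $m\mid p-1$; (iv) $C_p\rtimes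 C_m$ with $m$ even, $m\mid p-1$; (c) $G$ is isomorphic to one of the groups in (i)–(iv) with the following action: in (i), a generator of $C_m$ acts by $(x,y)\mapsto(y^k,x^k)$ for some $k$ of multiplicative order $m$ modulo $p$; in (ii), the generator of $C_2$ acts by $(x,y)\mapsto(y,x)$ and a generator of $C_m$ acts by $(x,y)\mapsto(x^k,y^k)$ for some $k$ of multiplicative order $m$ modulo $p$; in (iii) and (iv), $C_m$ acts faithfully. If these conditions hold, then the number of Hopf Galois structures of dihedral type on $L/K$ is exactly $2$. -/

import Mathlib

open scoped TensorProduct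

universe u v w

/-- A Hopf Galois structure on the field extension `L / K`: a finite cocommutative `K`-Hopf algebra
`H` (not assumed commutative) with a `K`-linear action `μ : H → End_K(L)` that makes `L` a left
`H`-module algebra and for which `L ⊗ H → End_K(L)`, `x ⊗ h ↦ (y ↦ x * μ(h)(y))`, is bijective.
As `H` is finite dimensional over `K`, taking it in the universe of `K` loses nothing up to
isomorphism. -/
structure HopfGaloisStructure (K : Type u) (L : Type v) [Field K] [Field L] [Algebra K L] where
  /-- the underlying Hopf algebra -/
  H : Type u
  [ring : Ring H]
  [hopf : HopfAlgebra K H]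
  [finite : Module.Finite K H]
  [cocomm : Coalgebra.IsCocomm K H]
  /-- the action; being an algebra homomorphism it makes `L` a left `H`-module -/
  μ : H →ₐ[K] Module.End K L
  /-- `h • 1 = ε(h)` -/
  act_one : ∀ h : H, μ h 1 = algebraMap K L (Coalgebra.counit h)
  /-- `h • (x * y) = ∑ (h₁ • x) * (h₂ • y)` -/
  act_mul : ∀ (h : H) (x y : L), μ h (x * y) =
    LinearMap.mul' K L
      (TensorProduct.map (μ.toLinearMap.flip x) (μ.toLinearMap.flip y) (Coalgebra.comul h))
  /-- the induced map `L ⊗ H → End_K(L)` is bijective -/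
  bijective : Function.Bijective
    (LinearMap.mul' K (Module.End K L) ∘ₗ
      TensorProduct.map (Algebra.lmul K L).toLinearMap μ.toLinearMap)

namespace HopfGaloisStructure

attribute [instance] ring hopf finite cocomm

variable {K : Type u} {L : Type v} [Field K] [Field L] [Algebra K L]

/-- Two Hopf Galois structures are isomorphic if there is an isomorphism of `K`-Hopf algebras
compatible with the actions on `L`. (An isomorphism of bialgebras between Hopf algebras commutes
with the antipodes.) -/
def Iso (S T : HopfGaloisStructure K L) : Prop :=
  ∃ e : S.H ≃ₐc[K] T.H, ∀ h : S.H, T.μ (e h) = S.μ h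

theorem Iso.refl (S : HopfGaloisStructure K L) : Iso S S :=
  ⟨BialgEquiv.refl K S.H, fun _ => rfl⟩

theorem Iso.symm {S T : HopfGaloisStructure K L} (h : Iso S T) : Iso T S := by
  obtain ⟨e, he⟩ := h
  refine ⟨e.symm, fun x => ?_⟩
  rw [← he (e.symm x)]
  congr 1
  exact e.toEquiv.apply_symm_apply x

theorem Iso.trans {S T U : HopfGaloisStructure K L} (h : Iso S T) (k : Iso T U) : Iso S U := by
  obtain ⟨e, he⟩ := h
  obtain ⟨f, hf⟩ := k
  exact ⟨e.trans f, fun x => (hf (e x)).trans (he x)⟩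

/-- `S` is of type `N`, where `M` is a normal closure of `L / K`: the Hopf algebra of `S` becomes
the group algebra of `N` after base change from `K` to `M`. -/
def IsOfType (M : Type w) [Field M] [Algebra K M] (N : Type) [Group N]
    (S : HopfGaloisStructure K L) : Prop :=
  Nonempty ((M ⊗[K] S.H) ≃ₐc[M] MonoidAlgebra M N)

variable (K L) in
/-- Isomorphism, as an equivalence relation on the Hopf Galois structures of type `N`. -/
def isoSetoid (M : Type w) [Field M] [Algebra K M] (N : Type) [Group N] :
    Setoid {S : HopfGaloisStructure K L // S.IsOfType M N} where
  r S T := Iso S.1 T.1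
  iseqv := ⟨fun S => Iso.refl S.1, fun h => h.symm, fun h k => h.trans k⟩

variable (K L) in
/-- The number of Hopf Galois structures of type `N` on `L / K`, up to isomorphism. (It is `0`
if there are infinitely many.) -/
noncomputable def numberOfType (M : Type w) [Field M] [Algebra K M] (N : Type) [Group N] : ℕ :=
  Nat.card (Quotient (isoSetoid K L M N))

end HopfGaloisStructure

/-- The cyclic group of order `n`, written multiplicatively. -/
abbrev Cyc (n : ℕ) : Type := Multiplicative (ZMod n)

/-- The standard generator of the cyclic group of order `n`. -/
abbrev Cyc.gen (n : ℕ) : Cyc n := Multiplicative.ofAdd 1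

/-- `G` is a semidirect product `N ⋊ Q`, for some action of `Q` on `N`. -/
def IsSemidirect (N Q G : Type*) [Group N] [Group Q] [Group G] : Prop :=
  ∃ φ : Q →* MulAut N, Nonempty (G ≃* N ⋊[φ] Q)

/-- `G` is a semidirect product of one of the four shapes, for some action. -/
def IsOfListedShape (p : ℕ) (G : Type*) [Group G] : Prop :=
  (∃ m : ℕ, Even m ∧ m ∣ p - 1 ∧ IsSemidirect (Cyc p × Cyc p) (Cyc m) G) ∨
  (∃ m : ℕ, Even m ∧ m ∣ p - 1 ∧ IsSemidirect (Cyc p × Cyc p) (Cyc 2 × Cyc m) G) ∨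
  (∃ m : ℕ, m ∣ p - 1 ∧ IsSemidirect (Cyc (2 * p)) (Cyc m) G) ∨
  (∃ m : ℕ, Even m ∧ m ∣ p - 1 ∧ IsSemidirect (Cyc p) (Cyc m) G)

/-- `G` is one of the four kinds of semidirect product, with the action specified:
* on `C_p × C_p` the generator of `C_m` swaps the factors and raises to a power `k` of
  multiplicative order `m` modulo `p`;
* on `C_p × C_p` the generator of `C_2` swaps the factors and the generator of `C_m` raises to
  a power `k` of multiplicative order `m` modulo `p`;
* `C_m` acts faithfully on `C_{2p}`;
* `C_m` acts faithfully on `C_p`. -/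
def IsOfListedShapeExplicit (p : ℕ) (G : Type*) [Group G] : Prop :=
  (∃ m k : ℕ, Even m ∧ m ∣ p - 1 ∧ orderOf (k : ZMod p) = m ∧
    ∃ φ : Cyc m →* MulAut (Cyc p × Cyc p),
      (∀ x y : Cyc p, φ (Cyc.gen m) (x, y) = (y ^ k, x ^ k)) ∧
      Nonempty (G ≃* (Cyc p × Cyc p) ⋊[φ] Cyc m)) ∨
  (∃ m k : ℕ, Even m ∧ m ∣ p - 1 ∧ orderOf (k : ZMod p) = m ∧
    ∃ φ : Cyc 2 × Cyc m →* MulAut (Cyc p × Cyc p),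
      (∀ x y : Cyc p, φ (Cyc.gen 2, 1) (x, y) = (y, x)) ∧
      (∀ x y : Cyc p, φ (1, Cyc.gen m) (x, y) = (x ^ k, y ^ k)) ∧
      Nonempty (G ≃* (Cyc p × Cyc p) ⋊[φ] (Cyc 2 × Cyc m))) ∨
  (∃ m : ℕ, m ∣ p - 1 ∧ ∃ φ : Cyc m →* MulAut (Cyc (2 * p)),
    Function.Injective φ ∧ Nonempty (G ≃* Cyc (2 * p) ⋊[φ] Cyc m)) ∨
  (∃ m : ℕ, Even m ∧ m ∣ p - 1 ∧ ∃ φ : Cyc m →* MulAut (Cyc p),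
    Function.Injective φ ∧ Nonempty (G ≃* Cyc p ⋊[φ] Cyc m))

/-! Let X be the set of the 2p embeddings of L into its normal closure M. By descent in the manner
of Greither and Pareigis, Hopf Galois structures on L/K correspond to the regular subgroups N of
Perm X normalized by the Galois group G, and the type is the isomorphism class of N (`iso_iff`,
`isOfType_iff`, `exists_permGroup_eq`). In one direction the group-like elements of M ⊗ H permute
the embeddings. In the other, the endomorphisms of L that are Galois-equivariant combinations of
permutations in N form an algebra whose comultiplication, counit and antipode are recovered from its
action. What remains is a question about a transitive group G of degree 2p.

It is governed by the condition `NormalizesFree`: G normalizes a group of order p generated by a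
permutation r without fixed points. As p is odd, the rotations of a dihedral group are
characteristic, so a regular dihedral N normalized by G yields such an r. Conversely, r splits X
into two p-cycles, which become two affine lines over F_p on which G acts by maps (i, x) ↦ (i + j, k
x + b_i), with one slope k for both lines. The group of all these maps normalizes two regular
dihedral groups, whose rotations translate by multiples of (1, 1) and of (1, -1). There are no
others. Indeed G contains a free translation; it acts on the rotations of N by an automorphism of
order dividing p of a group of order p, hence trivially, so these rotations are translations too. An
element of G exchanging the lines then forces their vector to be proportional to (1, ±1). Hence the
count 2 (`NormalizesFree.ncard_regularDihedral`).

The same coordinates give (c). They can be chosen so that the translation by (1, 1) lies in G. Then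
the translations in G form either the diagonal or all of F_p², and the linear parts (j, k) form a
subgroup of C_2 × F_pˣ that either contains the exchange of slope 1 or is cyclic, generated by an
element exchanging the lines. The combinations give the four shapes (`explicit_of_le_affineGroup`).

For the converse, little of (b) is used: G is an extension of an abelian group of exponent dividing
p - 1 by an abelian group Q of exponent dividing p. Then Q contains a free element, in whose
coordinates G is affine with a slope for each line. The exponent p - 1 makes the product of the two
slopes of an exchange a square, so the exchange has an eigenvector among the translation vectors,
and commutativity modulo Q makes the rest of G scale it (`NormalizesFree.of_hasAbelianLayers`). -/

open Equiv

/-! ### Affine permutations of two lines over F_p -/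

section Affine

variable {p : ℕ} [Fact p.Prime]

theorem ZMod.two_cases (i : ZMod 2) : i = 0 ∨ i = 1 := by
  revert i; decide

theorem ZMod.two_add_add_cancel (i j : ZMod 2) : i + j + j = i := by
  rw [add_assoc, CharTwo.add_self_eq_zero, add_zero]

theorem ZMod.two_eq_of_ne {i j : ZMod 2} (h : i ≠ j) : i = j + 1 := by
  revert i j; decide

/-- The permutation `(i, x) ↦ (i + j, k x + b i)` of two disjoint copies of the affine line
over `ZMod p`. -/
def affPerm (j : ZMod 2) (k : (ZMod p)ˣ) (b : ZMod 2 → ZMod p) : Perm (ZMod 2 × ZMod p) where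
  toFun y := (y.1 + j, k * y.2 + b y.1)
  invFun y := (y.1 + j, (↑k⁻¹ : ZMod p) * (y.2 - b (y.1 + j)))
  left_inv y := by
    simp only [ZMod.two_add_add_cancel, add_sub_cancel_right, Units.inv_mul_cancel_left]
  right_inv y := by
    simp only [ZMod.two_add_add_cancel, sub_add_cancel, Units.mul_inv_cancel_left]

/-- The permutation `(i, x) ↦ (i, x + t i)`. -/
def transPerm (t : ZMod 2 → ZMod p) : Perm (ZMod 2 × ZMod p) := affPerm 0 1 t

@[simp] theorem affPerm_apply (j : ZMod 2) (k : (ZMod p)ˣ) (b : ZMod 2 → ZMod p)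
    (y : ZMod 2 × ZMod p) : affPerm j k b y = (y.1 + j, k * y.2 + b y.1) := rfl

@[simp] theorem transPerm_apply (t : ZMod 2 → ZMod p) (y : ZMod 2 × ZMod p) :
    transPerm t y = (y.1, y.2 + t y.1) := by simp [transPerm]

theorem affPerm_mul (j j' : ZMod 2) (k k' : (ZMod p)ˣ) (b b' : ZMod 2 → ZMod p) :
    affPerm j k b * affPerm j' k' b' =
      affPerm (j + j') (k * k') (fun i => k * b' i + b (i + j')) := by
  ext y <;> simp <;> ring

theorem affPerm_inj {j j' : ZMod 2} {k k' : (ZMod p)ˣ} {b b' : ZMod 2 → ZMod p}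
    (h : affPerm j k b = affPerm j' k' b') : j = j' ∧ k = k' ∧ b = b' := by
  have hb : b = b' := by
    ext i
    have := congrArg Prod.snd (DFunLike.congr_fun h (i, 0))
    simpa using this
  have hj := congrArg Prod.fst (DFunLike.congr_fun h (0, 1))
  have hk := congrArg Prod.snd (DFunLike.congr_fun h (0, 1))
  subst hb
  refine ⟨by simpa using hj, Units.ext (by simpa using hk), rfl⟩

theorem transPerm_inj {t t' : ZMod 2 → ZMod p} (h : transPerm t = transPerm t') : t = t' :=
  (affPerm_inj h).2.2

theorem transPerm_mul (t t' : ZMod 2 → ZMod p) :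
    transPerm t * transPerm t' = transPerm (t + t') := by
  ext y <;> simp; ring

theorem transPerm_zero : transPerm (0 : ZMod 2 → ZMod p) = 1 := by ext y <;> simp

theorem transPerm_pow (t : ZMod 2 → ZMod p) (n : ℕ) :
    transPerm t ^ n = transPerm (n • t) := by
  induction n with
  | zero => simp [transPerm_zero]
  | succ n ih => rw [pow_succ, ih, transPerm_mul, succ_nsmul]

theorem transPerm_inv (t : ZMod 2 → ZMod p) : (transPerm t)⁻¹ = transPerm (-t) := by
  rw [inv_eq_iff_mul_eq_one, transPerm_mul, add_neg_cancel, transPerm_zero]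

theorem affPerm_mul_transPerm (j : ZMod 2) (k : (ZMod p)ˣ) (b t : ZMod 2 → ZMod p) :
    affPerm j k b * transPerm t = transPerm (fun i => (k : ZMod p) * t (i + j)) * affPerm j k b := by
  ext y <;> simp [ZMod.two_add_add_cancel]; ring

theorem affPerm_conj_transPerm (j : ZMod 2) (k : (ZMod p)ˣ) (b t : ZMod 2 → ZMod p) :
    affPerm j k b * transPerm t * (affPerm j k b)⁻¹ = transPerm (fun i => (k : ZMod p) * t (i + j)) := by
  rw [affPerm_mul_transPerm, mul_inv_cancel_right]

theorem transPerm_pow_prime (t : ZMod 2 → ZMod p) : transPerm t ^ p = 1 := by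
  rw [transPerm_pow]
  have : p • t = 0 := by ext i; simp
  rw [this, transPerm_zero]

/-- A permutation that carries one fixed point free translation to another translation is affine
on each line. -/
theorem semilinear_apply {g : Perm (ZMod 2 × ZMod p)} {t t' : ZMod 2 → ZMod p}
    (ht : ∀ i, t i ≠ 0) (h : g * transPerm t = transPerm t' * g) :
    ∃ j, ∀ i x, g (i, x) = (i + j, t' (i + j) / t i * x + (g (i, 0)).2) := by
  have h1 : ∀ i x, g (i, x + t i) = ((g (i, x)).1, (g (i, x)).2 + t' (g (i, x)).1) := by
    intro i x
    have := DFunLike.congr_fun h (i, x)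
    simpa using this
  -- Since `t i` is nonzero, its multiples reach every point of the line i.
  have h2 : ∀ i (n : ℕ), g (i, n * t i) = ((g (i, 0)).1, (g (i, 0)).2 + n * t' (g (i, 0)).1) := by
    intro i n
    induction n with
    | zero => simp
    | succ n ih =>
      have := h1 i (n * t i)
      rw [ih] at this
      push_cast
      rw [add_mul, one_mul, this]
      ext <;> simp; ring
  have h3 : ∀ i x, g (i, x) = ((g (i, 0)).1, (g (i, 0)).2 + x / t i * t' (g (i, 0)).1) := by
    intro i x
    have := h2 i (x / t i).val
    rwa [ZMod.natCast_zmod_val, div_mul_cancel₀ _ (ht i)] at this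
  -- Each line is mapped into a single line; the two images differ because g is surjective.
  have h4 : (g (1, 0)).1 = (g (0, 0)).1 + 1 := by
    refine ZMod.two_eq_of_ne fun hc => ?_
    obtain ⟨⟨i, x⟩, hy⟩ := g.surjective ((g (0, 0)).1 + 1, 0)
    rw [h3] at hy
    have hi : (g (i, 0)).1 = (g (0, 0)).1 + 1 := congrArg Prod.fst hy
    have : (g (i, 0)).1 = (g (0, 0)).1 := by
      rcases ZMod.two_cases i with rfl | rfl
      · rfl
      · exact hc
    rw [this] at hi
    exact absurd hi (by generalize (g (0, 0)).1 = c; revert c; decide)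
  refine ⟨(g (0, 0)).1, fun i x => ?_⟩
  have h5 : (g (i, 0)).1 = i + (g (0, 0)).1 := by
    rcases ZMod.two_cases i with rfl | rfl
    · rw [zero_add]
    · rw [h4, add_comm]
  rw [h3 i x, h5]
  ext <;> simp; ring


variable (p) in
/-- The affine permutations with the same slope on both lines. -/
def affineGroup : Subgroup (Perm (ZMod 2 × ZMod p)) where
  carrier := {g | ∃ j k b, g = affPerm j k b}
  mul_mem' := by
    rintro _ _ ⟨j, k, b, rfl⟩ ⟨j', k', b', rfl⟩
    exact ⟨_, _, _, affPerm_mul ..⟩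
  one_mem' := ⟨0, 1, 0, transPerm_zero.symm⟩
  inv_mem' := by
    rintro _ ⟨j, k, b, rfl⟩
    refine ⟨j, k⁻¹, fun i => - ((k⁻¹ : (ZMod p)ˣ) * b (i + j)), ?_⟩
    rw [inv_eq_iff_mul_eq_one, affPerm_mul, CharTwo.add_self_eq_zero, mul_inv_cancel,
      ← transPerm_zero, transPerm]
    congr 1
    ext i
    simp only [mul_neg, Units.mul_inv_cancel_left, neg_add_cancel, Pi.zero_apply]

theorem affPerm_mem (j : ZMod 2) (k : (ZMod p)ˣ) (b : ZMod 2 → ZMod p) :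
    affPerm j k b ∈ affineGroup p := ⟨j, k, b, rfl⟩

variable (p) in
/-- The linear part `(j, k)` of the affine permutation `(i, x) ↦ (i + j, k x + b i)`. -/
noncomputable def linPart : affineGroup p →* Multiplicative (ZMod 2) × (ZMod p)ˣ where
  -- By `affPerm_inj` the chosen j and k are the only possible ones.
  toFun g := (.ofAdd g.2.choose, g.2.choose_spec.choose)
  map_one' := by
    have h := (1 : affineGroup p).2.choose_spec.choose_spec.choose_spec
    have h' := affPerm_inj (h.symm.trans (show _ = transPerm 0 by simp [transPerm_zero]))
    ext
    · exact congrArg Multiplicative.ofAdd h'.1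
    · exact congrArg Units.val h'.2.1
  map_mul' g g' := by
    have h := (g * g').2.choose_spec.choose_spec.choose_spec
    have h1 := g.2.choose_spec.choose_spec.choose_spec
    have h2 := g'.2.choose_spec.choose_spec.choose_spec
    have h3 := congrArg₂ (fun a b : Perm (ZMod 2 × ZMod p) => a * b) h1 h2
    have h' := affPerm_inj (h.symm.trans (h3.trans (affPerm_mul ..)))
    ext
    · exact congrArg Multiplicative.ofAdd h'.1
    · exact congrArg Units.val h'.2.1

theorem linPart_affPerm (j : ZMod 2) (k : (ZMod p)ˣ) (b : ZMod 2 → ZMod p) :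
    linPart p ⟨_, affPerm_mem j k b⟩ = (.ofAdd j, k) := by
  have h := affPerm_inj (affPerm_mem j k b).choose_spec.choose_spec.choose_spec
  ext
  · exact congrArg Multiplicative.ofAdd h.1.symm
  · exact congrArg Units.val h.2.1.symm

theorem exists_eq_affPerm (g : affineGroup p) :
    ∃ b, (g : Perm _) = affPerm (linPart p g).1.toAdd (linPart p g).2 b := by
  obtain ⟨_, j, k, b, rfl⟩ := g
  exact ⟨b, by rw [linPart_affPerm]; rfl⟩

/-- For odd p the group C_2 × F_pˣ has exponent dividing p - 1. Hence elements of order p have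
trivial linear part, and `g ^ p` keeps the linear part of g. -/
theorem linPart_pow_prime (hp2 : p ≠ 2) (a : Multiplicative (ZMod 2) × (ZMod p)ˣ) :
    a ^ p = a := by
  obtain ⟨j, k⟩ := a
  have hodd : Odd p := (Fact.out : p.Prime).odd_of_ne_two hp2
  ext
  · change p • j.toAdd = j.toAdd
    rw [nsmul_eq_mul, ZMod.natCast_eq_one_iff_odd.2 hodd, one_mul]
  · simp [ZMod.pow_card]

theorem exists_transPerm_of_linPart_pow (hp2 : p ≠ 2) {g : Perm (ZMod 2 × ZMod p)}
    (hg : g ∈ affineGroup p) (h : g ^ p = 1) : ∃ t, g = transPerm t := by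
  have h1 : linPart p ⟨g, hg⟩ = 1 := by
    rw [← linPart_pow_prime hp2 (linPart p ⟨g, hg⟩), ← map_pow]
    have : (⟨g, hg⟩ : affineGroup p) ^ p = 1 := Subtype.ext h
    rw [this, map_one]
  obtain ⟨b, hb⟩ := exists_eq_affPerm ⟨g, hg⟩
  rw [h1] at hb
  exact ⟨b, hb⟩

/-- A permutation group normalizing the translation by `1` on both lines is affine. -/
theorem mem_affineGroup_of_conj {g : Perm (ZMod 2 × ZMod p)} {k : ℕ}
    (h : g * transPerm 1 * g⁻¹ = transPerm 1 ^ k) : g ∈ affineGroup p := by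
  rw [transPerm_pow, mul_inv_eq_iff_eq_mul] at h
  obtain ⟨j, hj⟩ := semilinear_apply (by simp) h
  -- With slope 0 the permutation g would be constant on each line.
  have hk : (k : ZMod p) ≠ 0 := by
    intro hk
    have h1 := hj 0 1
    have h2 := hj 0 0
    simp only [Pi.smul_apply, Pi.one_apply, nsmul_eq_mul, hk, zero_mul, zero_div] at h1 h2
    exact zero_ne_one (congrArg Prod.snd (g.injective (h2.trans h1.symm)))
  refine ⟨j, Units.mk0 _ hk, fun i => (g (i, 0)).2, ?_⟩
  ext1 y
  rw [← Prod.mk.eta (p := y), hj]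
  simp

/-- By Cauchy's theorem a transitive G contains an element of order p, and this is a translation. If
it is trivial on one line, it is multiplied by its conjugate under an element exchanging the lines,
which is trivial on the other line only. -/
theorem exists_transPerm_mem (hp2 : p ≠ 2) {G : Subgroup (Perm (ZMod 2 × ZMod p))}
    (hG : G ≤ affineGroup p) (htr : ∀ y y', ∃ g ∈ G, g y = y') :
    ∃ t : ZMod 2 → ZMod p, (∀ i, t i ≠ 0) ∧ transPerm t ∈ G := by
  have : MulAction.IsPretransitive G (ZMod 2 × ZMod p) :=
    ⟨fun y y' => by obtain ⟨g, hg, h⟩ := htr y y'; exact ⟨⟨g, hg⟩, h⟩⟩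
  have hdvd : p ∣ Nat.card G := by
    have h1 := MulAction.index_stabilizer_of_transitive G ((0, 0) : ZMod 2 × ZMod p)
    have h2 := (MulAction.stabilizer G ((0, 0) : ZMod 2 × ZMod p)).index_dvd_card
    rw [h1, Nat.card_prod, Nat.card_zmod, Nat.card_zmod] at h2
    exact (dvd_mul_left p 2).trans h2
  obtain ⟨q, hq⟩ := exists_prime_orderOf_dvd_card' p hdvd
  have hqp : (q : Perm (ZMod 2 × ZMod p)) ^ p = 1 := by
    have := pow_orderOf_eq_one q
    rw [hq] at this
    exact congrArg Subtype.val this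
  obtain ⟨t, ht⟩ := exists_transPerm_of_linPart_pow hp2 (hG q.2) hqp
  have ht0 : t ≠ 0 := by
    rintro rfl
    have : q = 1 := Subtype.ext (ht.trans transPerm_zero)
    rw [this, orderOf_one] at hq
    exact (Fact.out : p.Prime).one_lt.ne hq
  have htG : transPerm t ∈ G := ht ▸ q.2
  by_cases hall : ∀ i, t i ≠ 0
  · exact ⟨t, hall, htG⟩
  push Not at hall
  obtain ⟨i, hi⟩ := hall
  have hi' : t (i + 1) ≠ 0 := fun h => ht0 <| by
    ext l
    by_cases hl : l = i
    · rw [hl, hi]; rfl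
    · rw [ZMod.two_eq_of_ne hl, h]; rfl
  obtain ⟨g, hg, hgy⟩ := htr (0, 0) (1, 0)
  obtain ⟨j, k, b, rfl⟩ := hG hg
  have hj : j = 1 := by simpa using congrArg Prod.fst hgy
  subst hj
  refine ⟨t + fun i => k * t (i + 1), fun l => ?_, ?_⟩
  · by_cases hl : l = i
    · simp [hl, hi, hi']
    · simp [ZMod.two_eq_of_ne hl, hi, hi', ZMod.two_add_add_cancel]
  · rw [← transPerm_mul, ← affPerm_conj_transPerm 1 k b]
    exact G.mul_mem htG (G.mul_mem (G.mul_mem hg htG) (G.inv_mem hg))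

end Affine

/-! ### Regular dihedral groups normalized by affine groups -/

section Dihedral

variable {p : ℕ} [Fact p.Prime]

/-- `1` or `-1` acting as scalar: the regular dihedral group with rotations `(i, x) ↦ (i, x + a c^i)`
and reflections that exchange the two lines. -/
def dihedralPerm (c : (ZMod p)ˣ) (hc : c * c = 1) : DihedralGroup p →* Perm (ZMod 2 × ZMod p) where
  toFun
    | .r a => affPerm 0 1 (fun i => if i = 0 then a else c * a)
    -- An exchange of the lines with slope k maps the vector (a, c a) to (k c a, k a); it is
    -- inverted exactly when k = -c, because c² = 1.
    | .sr a => affPerm 1 (-c) (fun i => if i = 0 then -c * a else -a)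
  map_one' := by
    change affPerm 0 1 (fun i => if i = 0 then (0 : ZMod p) else c * 0) = 1
    simp only [mul_zero, ite_self]
    exact transPerm_zero
  map_mul' := by
    have hc' : (c : ZMod p) * c = 1 := congrArg Units.val hc
    rintro (a | a) (b | b)
    · rw [DihedralGroup.r_mul_r]
      simp only [affPerm_mul]
      congr 1
      · simp
      · ext i
        rcases ZMod.two_cases i with rfl | rfl <;> simp <;> ring
    · rw [DihedralGroup.r_mul_sr]
      simp only [affPerm_mul]
      congr 1
      · simp
      · ext i
        rcases ZMod.two_cases i with rfl | rfl <;> simp [CharTwo.add_self_eq_zero] <;> ring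
    · rw [DihedralGroup.sr_mul_r]
      simp only [affPerm_mul]
      congr 1
      · simp
      · ext i
        rcases ZMod.two_cases i with rfl | rfl <;> simp <;>
          first | ring1 | linear_combination (-b) * hc'
    · rw [DihedralGroup.sr_mul_sr]
      simp only [affPerm_mul]
      congr 1
      · rw [neg_mul_neg, hc]
      · ext i
        rcases ZMod.two_cases i with rfl | rfl <;> simp [CharTwo.add_self_eq_zero] <;>
          first | ring1 | linear_combination (-b) * hc'

end Dihedral

section Regular

/-- A subgroup of `Perm X` is regular if it acts simply transitively. -/
def IsRegularSubgroup {X : Type*} (N : Subgroup (Perm X)) : Prop :=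
  ∀ x y : X, ∃! n : N, (n : Perm X) x = y

theorem IsRegularSubgroup.eq_of_apply_eq {X : Type*} {N : Subgroup (Perm X)}
    (hN : IsRegularSubgroup N) {m n : Perm X} (hm : m ∈ N) (hn : n ∈ N) {x : X} (h : m x = n x) :
    m = n :=
  congrArg Subtype.val ((hN x (n x)).unique (y₁ := ⟨m, hm⟩) (y₂ := ⟨n, hn⟩) h rfl)

theorem regular_range_of_transitive {X D : Type*} [Finite X] [Nonempty X] [Group D] [Finite D]
    (f : D →* Perm X) (hcard : Nat.card D = Nat.card X) (htr : ∀ x y, ∃ d, f d x = y) :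
    Function.Injective f ∧ IsRegularSubgroup f.range := by
  have hb : ∀ x, Function.Bijective fun d => f d x := fun x =>
    Function.Surjective.bijective_of_nat_card_le (htr x) hcard.le
  obtain ⟨x₀⟩ := ‹Nonempty X›
  refine ⟨fun a b h => (hb x₀).1 (by simp only [h]), fun x y => ?_⟩
  obtain ⟨d, hd⟩ := htr x y
  refine ⟨⟨f d, d, rfl⟩, hd, ?_⟩
  rintro ⟨_, d', rfl⟩ h
  exact Subtype.ext (congrArg f ((hb x).1 (h.trans hd.symm)))

end Regular

section DihedralGeneral

variable {p : ℕ} [Fact p.Prime] {X : Type*} {N : Subgroup (Perm X)}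

theorem DihedralGroup.eq_r_of_pow_eq_one (hp2 : p ≠ 2) {d : DihedralGroup p} (h : d ^ p = 1) :
    ∃ a, d = r a := by
  rcases d with a | a
  · exact ⟨a, rfl⟩
  · have h1 := orderOf_dvd_of_pow_eq_one h
    rw [DihedralGroup.orderOf_sr] at h1
    exact absurd ((Nat.prime_dvd_prime_iff_eq Nat.prime_two Fact.out).1 h1).symm hp2

theorem rotation_pow_prime (ψ : DihedralGroup p ≃* N) :
    (ψ (.r 1) : Perm X) ^ p = 1 := by
  have h : ψ (.r 1) ^ p = 1 := by rw [← map_pow, DihedralGroup.r_one_pow_n, map_one]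
  exact congrArg Subtype.val h

theorem rotation_eq_pow (ψ : DihedralGroup p ≃* N) (a : ZMod p) :
    (ψ (.r a) : Perm X) = (ψ (.r 1) : Perm X) ^ a.val := by
  rw [← Subgroup.coe_pow, ← map_pow, DihedralGroup.r_one_pow, ZMod.natCast_zmod_val]

theorem rotation_apply_ne (hN : IsRegularSubgroup N) (ψ : DihedralGroup p ≃* N) (x : X) :
    (ψ (.r 1) : Perm X) x ≠ x := by
  intro h
  have h1 := hN.eq_of_apply_eq (ψ (.r 1)).2 N.one_mem (x := x) h
  have h2 : ψ (.r 1) = ψ 1 := by rw [map_one]; exact Subtype.ext h1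
  have h3 := ψ.injective h2
  rw [← DihedralGroup.r_zero, DihedralGroup.r.injEq] at h3
  exact one_ne_zero h3

/-- For odd p the rotations are exactly the elements with p-th power 1. So the rotation subgroup is
characteristic and is normalized by whatever normalizes N. -/
theorem exists_conj_rotation_eq_pow (hp2 : p ≠ 2) (ψ : DihedralGroup p ≃* N) {g : Perm X}
    (hg : ∀ n ∈ N, g * n * g⁻¹ ∈ N) :
    ∃ k : ℕ, g * (ψ (.r 1) : Perm X) * g⁻¹ = (ψ (.r 1) : Perm X) ^ k := by
  obtain ⟨d, hd⟩ := ψ.surjective ⟨_, hg _ (ψ (.r 1)).2⟩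
  have hdp : d ^ p = 1 := by
    apply ψ.injective
    rw [map_pow, hd, map_one]
    apply Subtype.ext
    rw [Subgroup.coe_pow, conj_pow, rotation_pow_prime]
    simp
  obtain ⟨a, rfl⟩ := DihedralGroup.eq_r_of_pow_eq_one hp2 hdp
  refine ⟨a.val, ?_⟩
  rw [← rotation_eq_pow, hd]

end DihedralGeneral

section Dihedral

variable {p : ℕ} [Fact p.Prime]

instance : Finite (DihedralGroup p) := Finite.of_equiv _ DihedralGroup.equivSum.symm

theorem dihedralPerm_transitive (c : (ZMod p)ˣ) (hc : c * c = 1) (y y' : ZMod 2 × ZMod p) :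
    ∃ d, dihedralPerm c hc d y = y' := by
  have hc' : (c : ZMod p) * c = 1 := congrArg Units.val hc
  obtain ⟨i, x⟩ := y
  obtain ⟨i', x'⟩ := y'
  by_cases h : i' = i
  · subst h
    rcases ZMod.two_cases i' with rfl | rfl
    · exact ⟨.r (x' - x), by simp [dihedralPerm]⟩
    · refine ⟨.r (c * (x' - x)), ?_⟩
      simp [dihedralPerm]
      linear_combination (x' - x) * hc'
  · obtain rfl := ZMod.two_eq_of_ne h
    rcases ZMod.two_cases i with rfl | rfl
    · refine ⟨.sr (- x - c * x'), ?_⟩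
      simp [dihedralPerm]
      linear_combination x' * hc'
    · exact ⟨.sr (- (c * x) - x'), by simp [dihedralPerm]⟩

theorem dihedralPerm_injective_regular (c : (ZMod p)ˣ) (hc : c * c = 1) :
    Function.Injective (dihedralPerm c hc) ∧ IsRegularSubgroup (dihedralPerm c hc).range :=
  regular_range_of_transitive _
    (by rw [DihedralGroup.nat_card, Nat.card_prod, Nat.card_zmod, Nat.card_zmod])
    (dihedralPerm_transitive c hc)

/-- This is why the final count does not depend on G: both dihedral groups are normalized by every
affine permutation. -/
theorem dihedralPerm_conj (c : (ZMod p)ˣ) (hc : c * c = 1) {g : Perm (ZMod 2 × ZMod p)}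
    (hg : g ∈ affineGroup p) (d : DihedralGroup p) :
    ∃ d', g * dihedralPerm c hc d * g⁻¹ = dihedralPerm c hc d' := by
  have hc' : (c : ZMod p) * c = 1 := congrArg Units.val hc
  obtain ⟨j, k, b, rfl⟩ := hg
  simp only [mul_inv_eq_iff_eq_mul]
  rcases d with a | a
  · rcases ZMod.two_cases j with rfl | rfl
    · refine ⟨.r (k * a), ?_⟩
      simp only [dihedralPerm, MonoidHom.coe_mk, OneHom.coe_mk, affPerm_mul]
      congr 1
      · rw [mul_comm]
      · ext i
        rcases ZMod.two_cases i with rfl | rfl <;> simp <;> ring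
    -- Exchanging the entries of (a, c a) gives c a · (1, c), because c² = 1.
    · refine ⟨.r (k * c * a), ?_⟩
      simp only [dihedralPerm, MonoidHom.coe_mk, OneHom.coe_mk, affPerm_mul]
      congr 1
      · rw [mul_comm]
      · ext i
        rcases ZMod.two_cases i with rfl | rfl <;> simp [CharTwo.add_self_eq_zero] <;>
          first | ring1 | linear_combination (-k * a) * hc'
  · rcases ZMod.two_cases j with rfl | rfl
    · refine ⟨.sr (k * a - c * b 1 - b 0), ?_⟩
      simp only [dihedralPerm, MonoidHom.coe_mk, OneHom.coe_mk, affPerm_mul]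
      congr 1
      · rw [mul_comm]
      · ext i
        rcases ZMod.two_cases i with rfl | rfl <;> simp [CharTwo.add_self_eq_zero] <;>
          first | ring1 | linear_combination (-b 1) * hc'
    · refine ⟨.sr (k * c * a - b 1 - c * b 0), ?_⟩
      simp only [dihedralPerm, MonoidHom.coe_mk, OneHom.coe_mk, affPerm_mul]
      congr 1
      · rw [mul_comm]
      · ext i
        rcases ZMod.two_cases i with rfl | rfl <;> simp [CharTwo.add_self_eq_zero] <;>
          first | ring1 | linear_combination (k * a - b 0) * hc'

theorem exists_swap_mem {G : Subgroup (Perm (ZMod 2 × ZMod p))}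
    (hG : G ≤ affineGroup p) (htr : ∀ y y', ∃ g ∈ G, g y = y') :
    ∃ k b, affPerm 1 k b ∈ G := by
  obtain ⟨g, hg, hgy⟩ := htr (0, 0) (1, 0)
  obtain ⟨j, k, b, rfl⟩ := hG hg
  have hj : j = 1 := by simpa using congrArg Prod.fst hgy
  subst hj
  exact ⟨k, b, hg⟩

/-- If the conjugate of `n` by an element `q` of order dividing `p` is a power of `n`, and `n` has
order `p`, then `q` and `n` commute. -/
theorem commute_of_conj_eq_pow {Γ : Type*} [Group Γ] {q n : Γ} (hq : q ^ p = 1)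
    (hn : orderOf n = p) {k : ℕ} (h : q * n * q⁻¹ = n ^ k) : q * n = n * q := by
  have h1 : ∀ m : ℕ, q ^ m * n * (q ^ m)⁻¹ = n ^ (k ^ m) := by
    intro m
    induction m with
    | zero => simp
    | succ m ih =>
      have : q ^ (m + 1) * n * (q ^ (m + 1))⁻¹ = q * (q ^ m * n * (q ^ m)⁻¹) * q⁻¹ := by
        rw [pow_succ']; group
      rw [this, ih, ← conj_pow, h, ← pow_mul, pow_succ']
  -- From `q ^ p = 1` comes k ^ p ≡ 1 modulo p, while k ^ p ≡ k by Fermat; so k ≡ 1.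
  have h2 := h1 p
  rw [hq, one_mul, inv_one, mul_one] at h2
  nth_rewrite 1 [← pow_one n] at h2
  rw [pow_eq_pow_iff_modEq, hn, ← ZMod.natCast_eq_natCast_iff] at h2
  push_cast at h2
  rw [ZMod.pow_card] at h2
  have h3 : n ^ k = n := by
    nth_rewrite 2 [← pow_one n]
    rw [pow_eq_pow_iff_modEq, hn, ← ZMod.natCast_eq_natCast_iff]
    simpa using h2.symm
  rw [h3] at h
  exact mul_inv_eq_iff_eq_mul.1 h

/-- Commuting with a free translation makes n affine with slopes `t (i + j) / t i`. Its order
divides the odd number p, so it cannot exchange the lines; hence j = 0 and both slopes are 1. -/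
theorem exists_eq_transPerm_of_commute (hp2 : p ≠ 2) {n : Perm (ZMod 2 × ZMod p)}
    {t : ZMod 2 → ZMod p} (ht : ∀ i, t i ≠ 0) (hn : n ^ p = 1)
    (h : n * transPerm t = transPerm t * n) : ∃ s, n = transPerm s := by
  obtain ⟨j, hj⟩ := semilinear_apply ht h
  have hj1 : ∀ y, (n y).1 = y.1 + j := fun y => by rw [← Prod.mk.eta (p := y), hj]
  have h1 : ∀ (m : ℕ) y, ((n ^ m) y).1 = y.1 + m * j := by
    intro m y
    induction m with
    | zero => simp
    | succ m ih =>
      rw [pow_succ', Perm.mul_apply, hj1, ih]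
      push_cast
      ring
  have h2 := h1 p (0, 0)
  rw [hn, ZMod.natCast_eq_one_iff_odd.2 ((Fact.out : p.Prime).odd_of_ne_two hp2)] at h2
  have hj0 : j = 0 := by simpa using h2.symm
  subst hj0
  refine exists_transPerm_of_linPart_pow hp2 ⟨0, 1, fun i => (n (i, 0)).2, ?_⟩ hn
  ext1 y
  rw [← Prod.mk.eta (p := y), hj, affPerm_apply]
  simp [ht]

/-- A transitive group of affine permutations normalizes no other regular dihedral groups of order
`2 p` than the two groups `(dihedralPerm c hc).range`. -/
theorem eq_range_dihedralPerm (hp2 : p ≠ 2) {G : Subgroup (Perm (ZMod 2 × ZMod p))}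
    (hG : G ≤ affineGroup p) (htr : ∀ y y', ∃ g ∈ G, g y = y')
    {N : Subgroup (Perm (ZMod 2 × ZMod p))} (hN : IsRegularSubgroup N)
    (hGN : ∀ g ∈ G, ∀ n ∈ N, g * n * g⁻¹ ∈ N) (ψ : DihedralGroup p ≃* N) :
    ∃ c hc, N = (dihedralPerm c hc).range := by
  obtain ⟨t, ht, htG⟩ := exists_transPerm_mem hp2 hG htr
  have hr1 : (ψ (.r 1) : Perm (ZMod 2 × ZMod p)) ≠ 1 := fun h =>
    rotation_apply_ne hN ψ (0, 0) (by rw [h]; rfl)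
  -- The free translation in G normalizes the rotation group and hence centralizes it, so the
  -- rotations of N are translations themselves.
  obtain ⟨m, hm⟩ := exists_conj_rotation_eq_pow hp2 ψ (hGN _ htG)
  have hcomm := commute_of_conj_eq_pow (transPerm_pow_prime t)
    (orderOf_eq_prime (rotation_pow_prime ψ) hr1) hm
  obtain ⟨s, hs⟩ := exists_eq_transPerm_of_commute hp2 ht (rotation_pow_prime ψ) hcomm.symm
  have hs0 : ∀ i, s i ≠ 0 := by
    intro i hi
    apply rotation_apply_ne hN ψ (i, 0)
    rw [hs]
    simp [hi]
  -- An element of G exchanging the lines conjugates the translation by s to a power of it, which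
  -- forces (s 1)² = (s 0)².
  obtain ⟨k, b, hkb⟩ := exists_swap_mem hG htr
  obtain ⟨m', hm'⟩ := exists_conj_rotation_eq_pow hp2 ψ (hGN _ hkb)
  rw [hs, affPerm_conj_transPerm, transPerm_pow] at hm'
  have e0 : (k : ZMod p) * s 1 = m' * s 0 := by simpa using congrFun (transPerm_inj hm') 0
  have e1 : (k : ZMod p) * s 0 = m' * s 1 := by
    simpa [CharTwo.add_self_eq_zero] using congrFun (transPerm_inj hm') 1
  have e2 : s 1 * s 1 = s 0 * s 0 := by
    apply mul_left_cancel₀ k.ne_zero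
    linear_combination s 1 * e0 - s 0 * e1
  have hc : s 1 / s 0 * (s 1 / s 0) = 1 := by
    rw [div_mul_div_comm, e2, div_self (mul_ne_zero (hs0 0) (hs0 0))]
  obtain ⟨c, hc1⟩ : ∃ c : (ZMod p)ˣ, (c : ZMod p) = s 1 / s 0 :=
    ⟨⟨s 1 / s 0, s 1 / s 0, hc, hc⟩, rfl⟩
  have hcc : c * c = 1 := Units.ext (by rw [Units.val_mul, hc1, hc]; rfl)
  have hs1 : s 1 = c * s 0 := by rw [hc1, div_mul_cancel₀ _ (hs0 0)]
  have hrot : ∀ a, (ψ (.r a) : Perm (ZMod 2 × ZMod p)) = dihedralPerm c hcc (.r (a * s 0)) := by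
    intro a
    rw [rotation_eq_pow, hs, transPerm_pow]
    simp only [dihedralPerm, MonoidHom.coe_mk, OneHom.coe_mk, transPerm]
    congr 1
    ext i
    rcases ZMod.two_cases i with rfl | rfl
    · simp
    · simp [hs1]; ring
  have hinv : (ψ (.sr 0) : Perm (ZMod 2 × ZMod p)) * transPerm s =
      transPerm (-s) * (ψ (.sr 0) : Perm (ZMod 2 × ZMod p)) := by
    rw [← transPerm_inv, ← hs, ← Subgroup.coe_inv, ← Subgroup.coe_mul, ← Subgroup.coe_mul,
      ← map_inv, ← map_mul, ← map_mul]
    simp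
  obtain ⟨j', hj'⟩ := semilinear_apply hs0 hinv
  have hrefl : ∀ a, (ψ (.sr a) : Perm (ZMod 2 × ZMod p)) =
      (ψ (.sr 0) : Perm (ZMod 2 × ZMod p)) * ψ (.r a) := by
    intro a
    rw [← Subgroup.coe_mul, ← map_mul, DihedralGroup.sr_mul_r, zero_add]
  -- If the reflection preserved both lines, so would all of N, against transitivity.
  have hj1 : j' = 1 := by
    rcases ZMod.two_cases j' with rfl | rfl
    · exfalso
      obtain ⟨⟨n, hn⟩, hny, -⟩ := hN (0, 0) (1, 0)
      obtain ⟨d, hd⟩ := ψ.surjective ⟨n, hn⟩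
      have : (n (0, 0)).1 = 0 := by
        have hnd : n = (ψ d : Perm (ZMod 2 × ZMod p)) := by rw [hd]
        rw [hnd]
        rcases d with a | a
        · rw [hrot]; simp [dihedralPerm]
        · rw [hrefl, hrot, Perm.mul_apply]
          simp only [dihedralPerm, MonoidHom.coe_mk, OneHom.coe_mk, affPerm_apply]
          rw [hj']; simp
      simp only at hny
      rw [hny] at this
      exact one_ne_zero this
    · rfl
  subst hj1
  set b' : ZMod 2 → ZMod p := fun i =>
    ((ψ (.sr 0) : Perm (ZMod 2 × ZMod p)) (i, 0)).2 with hb'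
  have hc' : (c : ZMod p) * c = 1 := congrArg Units.val hcc
  have hs01 : s 0 = c * s 1 := by rw [hs1, ← mul_assoc, hc', one_mul]
  have href : (ψ (.sr 0) : Perm (ZMod 2 × ZMod p)) = affPerm 1 (-c) b' := by
    ext1 y
    rw [← Prod.mk.eta (p := y), hj', affPerm_apply]
    obtain ⟨i, x⟩ := y
    have : (-s) (i + 1) / s i = ((-c : (ZMod p)ˣ) : ZMod p) := by
      rw [div_eq_iff (hs0 i)]
      rcases ZMod.two_cases i with rfl | rfl
      · simp [hs1]
      · simp [CharTwo.add_self_eq_zero, hs01]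
    simp only [this, hb']
  -- The constant terms on the two lines are tied together because a reflection is an involution.
  have hbb : b' 1 = c * b' 0 := by
    have h1 : (ψ (.sr 0) : Perm (ZMod 2 × ZMod p)) * ψ (.sr 0) = 1 := by
      rw [← Subgroup.coe_mul, ← map_mul, DihedralGroup.sr_mul_self, map_one]; rfl
    rw [href, affPerm_mul, ← transPerm_zero] at h1
    have h2 := congrFun (affPerm_inj h1).2.2 0
    simp at h2
    linear_combination h2
  refine ⟨c, hcc, Subgroup.eq_of_le_of_card_ge ?_ ?_⟩
  · intro n hn
    obtain ⟨d, hd⟩ := ψ.surjective ⟨n, hn⟩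
    have hnd : n = (ψ d : Perm (ZMod 2 × ZMod p)) := by rw [hd]
    rw [hnd]
    rcases d with a | a
    · exact ⟨_, (hrot a).symm⟩
    · rw [hrefl, hrot]
      refine Subgroup.mul_mem _ ⟨.sr (-b' 1), ?_⟩ ⟨_, rfl⟩
      rw [href]
      simp only [dihedralPerm, MonoidHom.coe_mk, OneHom.coe_mk]
      congr 1
      ext i
      rcases ZMod.two_cases i with rfl | rfl
      · simp [hbb]; linear_combination b' 0 * hc'
      · simp
  · rw [← Nat.card_congr ψ.toEquiv]
    exact Nat.card_le_card_of_surjective _ (dihedralPerm c hcc).rangeRestrict_surjective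

end Dihedral

/-! ### Coordinates on a set of 2p points, and the count of two -/

section Transport

/-- `G` normalizes a cyclic group of order `p` without fixed points. -/
def NormalizesFree (p : ℕ) {X : Type*} (G : Subgroup (Perm X)) : Prop :=
  ∃ r : Perm X, r ^ p = 1 ∧ (∀ x, r x ≠ x) ∧ ∀ g ∈ G, ∃ k : ℕ, g * r * g⁻¹ = r ^ k

/-- The regular dihedral groups of order `2 p` normalized by `G`. -/
def regularDihedral (p : ℕ) {X : Type*} (G : Subgroup (Perm X)) : Set (Subgroup (Perm X)) :=
  {N | IsRegularSubgroup N ∧ (∀ g ∈ G, ∀ n ∈ N, g * n * g⁻¹ ∈ N) ∧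
    Nonempty (DihedralGroup p ≃* N)}

variable {p : ℕ} {X Y : Type*}

theorem IsRegularSubgroup.map_permCongr {N : Subgroup (Perm X)} (hN : IsRegularSubgroup N)
    (e : X ≃ Y) : IsRegularSubgroup (N.map e.permCongrHom.toMonoidHom) := by
  intro x y
  obtain ⟨n, hn, hu⟩ := hN (e.symm x) (e.symm y)
  refine ⟨⟨_, n, n.2, rfl⟩, ?_, ?_⟩
  · simp [hn]
  · rintro ⟨_, m, hm, rfl⟩ h
    have : m = n := congrArg Subtype.val (hu ⟨m, hm⟩ (by simpa [Equiv.eq_symm_apply] using h))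
    subst this
    rfl

theorem regularDihedral_map_permCongr {G N : Subgroup (Perm X)} (hN : N ∈ regularDihedral p G)
    (e : X ≃ Y) : N.map e.permCongrHom.toMonoidHom ∈
      regularDihedral p (G.map e.permCongrHom.toMonoidHom) := by
  obtain ⟨h1, h2, ⟨ψ⟩⟩ := hN
  refine ⟨h1.map_permCongr e, ?_,
    ⟨ψ.trans (N.equivMapOfInjective _ e.permCongrHom.injective)⟩⟩
  rintro _ ⟨g, hg, rfl⟩ _ ⟨n, hn, rfl⟩
  exact ⟨_, h2 g hg n hn, by simp only [map_mul, map_inv]⟩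

theorem Subgroup.map_permCongr_symm (N : Subgroup (Perm X)) (e : X ≃ Y) :
    (N.map e.permCongrHom.toMonoidHom).map e.symm.permCongrHom.toMonoidHom = N := by
  rw [Subgroup.map_map]
  convert N.map_id
  ext g x
  simp

theorem ncard_regularDihedral_map (G : Subgroup (Perm X)) (e : X ≃ Y) :
    (regularDihedral p (G.map e.permCongrHom.toMonoidHom)).ncard = (regularDihedral p G).ncard := by
  refine (Set.ncard_congr (fun N _ => N.map e.permCongrHom.toMonoidHom)
    (fun N hN => regularDihedral_map_permCongr hN e) ?_ ?_).symm
  · intro N N' _ _ h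
    rw [← N.map_permCongr_symm e, h, N'.map_permCongr_symm e]
  · intro N hN
    refine ⟨N.map e.symm.permCongrHom.toMonoidHom, ?_, N.map_permCongr_symm e.symm⟩
    have := regularDihedral_map_permCongr hN e.symm
    rwa [Subgroup.map_permCongr_symm] at this

variable [Fact p.Prime]

/-- As p is prime and r has no fixed point, every cycle of r has length p, so there are two cycles.
A base point on each of them gives the coordinates. -/
theorem exists_equiv_transPerm [Finite X] (hX : Nat.card X = 2 * p) {r : Perm X}
    (hr : r ^ p = 1) (hfree : ∀ x, r x ≠ x) :
    ∃ e : X ≃ ZMod 2 × ZMod p, e.permCongrHom r = transPerm 1 := by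
  have hp : p.Prime := Fact.out
  have hcard : Nat.card X = Nat.card (ZMod 2 × ZMod p) := by
    rw [hX, Nat.card_prod, Nat.card_zmod, Nat.card_zmod]
  -- powers of `r` without fixed points
  have hper : ∀ x, Function.minimalPeriod r x = p := by
    intro x
    have h1 : Function.IsPeriodicPt r p x := by
      change r^[p] x = x
      rw [Perm.iterate_eq_pow, hr]; rfl
    exact ((Nat.dvd_prime hp).1 h1.minimalPeriod_dvd).resolve_left fun h =>
      hfree x (Function.minimalPeriod_eq_one_iff_isFixedPt.1 h)
  have hinj : ∀ x (a b : ZMod p), (r ^ a.val) x = (r ^ b.val) x → a = b := by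
    intro x a b h
    rw [← Perm.iterate_eq_pow, ← Perm.iterate_eq_pow] at h
    exact ZMod.val_injective p (Function.iterate_injOn_Iio_minimalPeriod (x := x)
      (by rw [Set.mem_Iio, hper]; exact a.val_lt) (by rw [Set.mem_Iio, hper]; exact b.val_lt) h)
  obtain ⟨x₀⟩ : Nonempty X := Nat.card_pos_iff.1 (by rw [hX]; exact mul_pos two_pos hp.pos) |>.1
  obtain ⟨x₁, hx₁⟩ : ∃ x₁, ∀ a : ZMod p, (r ^ a.val) x₀ ≠ x₁ := by
    by_contra! h
    have := Nat.card_le_card_of_surjective (fun a : ZMod p => (r ^ a.val) x₀) h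
    rw [hX, Nat.card_zmod] at this
    have := hp.pos
    omega
  have hpow : ∀ (a : ZMod p), r ^ (a + 1).val = r * r ^ a.val := by
    intro a
    rw [← pow_succ', pow_eq_pow_iff_modEq]
    have : orderOf r = p := orderOf_eq_prime hr fun h => hfree x₀ (by rw [h]; rfl)
    rw [this, ← ZMod.natCast_eq_natCast_iff]
    simp
  have hadd : ∀ (a b : ZMod p), r ^ (a + b).val = r ^ a.val * r ^ b.val := by
    intro a b
    rw [← pow_add, pow_eq_pow_iff_modEq]
    have : orderOf r = p := orderOf_eq_prime hr fun h => hfree x₀ (by rw [h]; rfl)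
    rw [this, ← ZMod.natCast_eq_natCast_iff]
    simp
  have hne : ∀ a b : ZMod p, (r ^ a.val) x₀ ≠ (r ^ b.val) x₁ := by
    intro a b h
    apply hx₁ (-b + a)
    rw [hadd, Perm.mul_apply, h, ← Perm.mul_apply, ← hadd, neg_add_cancel]
    simp
  let f : ZMod 2 × ZMod p → X := fun y => (r ^ y.2.val) (if y.1 = 0 then x₀ else x₁)
  have hf : Function.Injective f := by
    rintro ⟨i, a⟩ ⟨i', b⟩ h
    rcases ZMod.two_cases i with rfl | rfl <;> rcases ZMod.two_cases i' with rfl | rfl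
    · exact Prod.ext rfl (hinj _ _ _ h)
    · exact absurd h (hne a b)
    · exact absurd h.symm (hne b a)
    · exact Prod.ext rfl (hinj _ _ _ h)
  have hb : Function.Bijective f := hf.bijective_of_nat_card_le hcard.le
  refine ⟨(Equiv.ofBijective f hb).symm, ?_⟩
  ext1 y
  rw [Equiv.permCongrHom_coe, Equiv.permCongr_apply, Equiv.symm_symm, Equiv.symm_apply_eq,
    transPerm_apply]
  simp only [Equiv.ofBijective_apply, f, Pi.one_apply, hpow, Perm.mul_apply]

/-- Coordinates on `X` in which a group normalizing a free cyclic group of order `p` is affine. -/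
theorem NormalizesFree.exists_equiv [Finite X] (hX : Nat.card X = 2 * p) {G : Subgroup (Perm X)}
    (h : NormalizesFree p G) :
    ∃ e : X ≃ ZMod 2 × ZMod p, G.map e.permCongrHom.toMonoidHom ≤ affineGroup p := by
  obtain ⟨r, hr, hfree, hG⟩ := h
  obtain ⟨e, he⟩ := exists_equiv_transPerm hX hr hfree
  refine ⟨e, ?_⟩
  rintro _ ⟨g, hg, rfl⟩
  obtain ⟨k, hk⟩ := hG g hg
  apply mem_affineGroup_of_conj (k := k)
  rw [← he, ← map_pow, ← hk]
  simp only [map_mul, map_inv]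
  rfl

theorem NormalizesFree.of_mem_regularDihedral (hp2 : p ≠ 2) {G N : Subgroup (Perm X)}
    (h : N ∈ regularDihedral p G) : NormalizesFree p G := by
  obtain ⟨h1, h2, ⟨ψ⟩⟩ := h
  exact ⟨ψ (.r 1), rotation_pow_prime ψ, rotation_apply_ne h1 ψ,
    fun g hg => exists_conj_rotation_eq_pow hp2 ψ (h2 g hg)⟩

theorem transitive_map_permCongr {G : Subgroup (Perm X)} (htr : ∀ x x', ∃ g ∈ G, g x = x')
    (e : X ≃ Y) (y y' : Y) : ∃ g ∈ G.map e.permCongrHom.toMonoidHom, g y = y' := by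
  obtain ⟨g, hg, h⟩ := htr (e.symm y) (e.symm y')
  exact ⟨_, ⟨g, hg, rfl⟩, by simp [h]⟩

/-- The two groups belong to the two square roots c = ±1 of 1: `dihedralPerm_conj` shows that both
occur, `eq_range_dihedralPerm` that nothing else does. -/
theorem ncard_regularDihedral_affine (hp2 : p ≠ 2) {G : Subgroup (Perm (ZMod 2 × ZMod p))}
    (hG : G ≤ affineGroup p) (htr : ∀ y y', ∃ g ∈ G, g y = y') :
    (regularDihedral p G).ncard = 2 := by
  have hmem : ∀ (c : (ZMod p)ˣ) (hc : c * c = 1),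
      (dihedralPerm c hc).range ∈ regularDihedral p G := by
    intro c hc
    obtain ⟨h1, h2⟩ := dihedralPerm_injective_regular c hc
    refine ⟨h2, ?_, ⟨MonoidHom.ofInjective h1⟩⟩
    rintro g hg _ ⟨d, rfl⟩
    obtain ⟨d', hd'⟩ := dihedralPerm_conj c hc (hG hg) d
    exact ⟨d', hd'.symm⟩
  have h1 : (1 : (ZMod p)ˣ) * 1 = 1 := one_mul 1
  have h2 : (-1 : (ZMod p)ˣ) * (-1) = 1 := by rw [neg_mul_neg, one_mul]
  have hset : regularDihedral p G = {(dihedralPerm 1 h1).range, (dihedralPerm (-1) h2).range} := by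
    ext N
    constructor
    · rintro ⟨hN, hGN, ⟨ψ⟩⟩
      obtain ⟨c, hc, rfl⟩ := eq_range_dihedralPerm hp2 hG htr hN hGN ψ
      have hc' : (c : ZMod p) * c = 1 := congrArg Units.val hc
      rcases mul_self_eq_one_iff.1 hc' with h | h
      · obtain rfl : c = 1 := Units.ext h
        exact Or.inl rfl
      · obtain rfl : c = -1 := Units.ext (by rw [h]; rfl)
        exact Or.inr rfl
    · rintro (rfl | rfl) <;> exact hmem _ _
  rw [hset, Set.ncard_pair]
  intro h
  -- The rotation by (1, 1) is not a multiple of (1, -1) for p > 2, and it is no reflection since it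
  -- preserves the lines.
  have h3 : dihedralPerm 1 h1 (.r 1) ∈ (dihedralPerm (-1) h2).range := h ▸ ⟨_, rfl⟩
  obtain ⟨d, hd⟩ := h3
  have : Fact (2 < p) := ⟨lt_of_le_of_ne (Fact.out : p.Prime).two_le (Ne.symm hp2)⟩
  rcases d with a | a
  · simp only [dihedralPerm, MonoidHom.coe_mk, OneHom.coe_mk] at hd
    have h4 := (affPerm_inj hd).2.2
    have h5 := congrFun h4 0
    have h6 := congrFun h4 1
    simp at h5 h6
    rw [h5] at h6
    exact ZMod.neg_one_ne_one h6
  · simp only [dihedralPerm, MonoidHom.coe_mk, OneHom.coe_mk] at hd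
    exact one_ne_zero (affPerm_inj hd).1

/-- A transitive group of degree `2 p` normalizing a free cyclic group of order `p` normalizes
exactly two regular dihedral groups. -/
theorem NormalizesFree.ncard_regularDihedral [Finite X] (hX : Nat.card X = 2 * p) (hp2 : p ≠ 2)
    {G : Subgroup (Perm X)} (h : NormalizesFree p G) (htr : ∀ x x', ∃ g ∈ G, g x = x') :
    (regularDihedral p G).ncard = 2 := by
  obtain ⟨e, he⟩ := h.exists_equiv hX
  rw [← ncard_regularDihedral_map G e]
  exact ncard_regularDihedral_affine hp2 he (transitive_map_permCongr htr e)

end Transport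

/-! ### Free elements and eigenvectors for groups with an abelian normal subgroup of exponent p -/

section FreeElement

variable {p : ℕ} {X : Type*}

theorem NormalizesFree.of_map_permCongr {Y : Type*} {G : Subgroup (Perm X)} (e : X ≃ Y)
    (h : NormalizesFree p (G.map e.permCongrHom.toMonoidHom)) : NormalizesFree p G := by
  obtain ⟨r, hr, hfree, hG⟩ := h
  refine ⟨e.permCongrHom.symm r, by rw [← map_pow, hr, map_one], fun x hx => ?_, fun g hg => ?_⟩
  · apply hfree (e x)
    simpa [Equiv.symm_apply_eq] using hx
  · obtain ⟨k, hk⟩ := hG _ ⟨g, hg, rfl⟩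
    refine ⟨k, e.permCongrHom.injective ?_⟩
    rw [map_mul, map_mul, map_pow, map_inv, MulEquiv.apply_symm_apply]
    exact hk

variable [Fact p.Prime]

theorem card_modEq_card_fixed [Finite X] {σ : Perm X} (hσ : σ ^ p = 1) :
    Nat.card X ≡ Nat.card {x // σ x = x} [MOD p] := by
  classical
  have := Fintype.ofFinite X
  have h := Equiv.Perm.card_fixedPoints_modEq (p := p) (n := 1) (f := (MulAction.toEndHom (M := Perm X) (α := X) σ)) (by
    rw [pow_one, ← map_pow, hσ, map_one])
  rw [Nat.card_eq_fintype_card]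
  convert h using 1
  rw [Nat.card_eq_fintype_card]
  rfl

/-- In a transitive group of degree `2 p`, an abelian normal subgroup of exponent `p` that is not
trivial contains an element without fixed points. -/
theorem exists_free_mem [Finite X] (hX : Nat.card X = 2 * p) {G Q : Subgroup (Perm X)}
    (htr : ∀ x x', ∃ g ∈ G, g x = x') (hnorm : ∀ g ∈ G, ∀ q ∈ Q, g * q * g⁻¹ ∈ Q)
    (hcomm : ∀ q ∈ Q, ∀ q' ∈ Q, q * q' = q' * q) (hexp : ∀ q ∈ Q, q ^ p = 1) (hQ : Q ≠ ⊥) :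
    ∃ r ∈ Q, ∀ x, r x ≠ x := by
  have hp : p.Prime := Fact.out
  obtain ⟨q, hq, hq1⟩ := (Subgroup.bot_or_exists_ne_one Q).resolve_left hQ
  by_cases hall : ∀ x, q x ≠ x
  · exact ⟨q, hq, hall⟩
  push Not at hall
  obtain ⟨y, hy⟩ := hall
  obtain ⟨x, hx⟩ : ∃ x, q x ≠ x := by
    by_contra! h
    exact hq1 (Equiv.ext h)
  -- The fixed point y of q is now `g x`; it is moved by the conjugate of q by g, since q moves x.
  obtain ⟨g, hg, rfl⟩ := htr x y
  set q' := g * q * g⁻¹ with hq'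
  have hq'Q : q' ∈ Q := hnorm g hg q hq
  -- A nontrivial element of Q with a fixed point has exactly p of them: their number is a positive
  -- multiple of p below 2p.
  have hcard : ∀ s ∈ Q, (∃ z, s z = z) → s ≠ 1 → Nat.card {z // s z = z} = p := by
    rintro s hs ⟨z, hz⟩ hs1
    have h1 := card_modEq_card_fixed (hexp s hs)
    rw [hX] at h1
    have h2 : p ∣ Nat.card {z // s z = z} :=
      (Nat.modEq_zero_iff_dvd.1 (h1.symm.trans (Nat.modEq_zero_iff_dvd.2 (dvd_mul_left p 2))))
    have h3 : 0 < Nat.card {z // s z = z} := Nat.card_pos_iff.2 ⟨⟨z, hz⟩, inferInstance⟩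
    have h4 : Nat.card {z // s z = z} < 2 * p := by
      rw [← hX]
      by_contra! h
      have := (Function.Injective.bijective_of_nat_card_le
        (Subtype.val_injective (p := fun z => s z = z)) h).2
      exact hs1 (Equiv.ext fun w => by obtain ⟨⟨w', hw'⟩, rfl⟩ := this w; exact hw')
    obtain ⟨c, hc⟩ := h2
    rw [hc] at h3 h4 ⊢
    have : c = 1 := by
      have h5 : 0 < c := Nat.pos_of_mul_pos_left h3
      have h6 : c < 2 := by
        rw [mul_comm] at h4
        exact Nat.lt_of_mul_lt_mul_right h4
      omega
    rw [this, mul_one]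
  have hq'x : q' (g x) ≠ g x := by
    simp [hq', hx]
  have hc1 : Nat.card {z // q z = z} = p := hcard q hq ⟨_, hy⟩ hq1
  have hc2 : Nat.card {z // q' z = z} = p :=
    hcard q' hq'Q ⟨g (g x), by simp [hq', hy]⟩ fun h => hq'x (by rw [h]; rfl)
  have hpres : ∀ z, q z = z → q (q' z) = q' z := fun z hz => by
    rw [← Perm.mul_apply, hcomm q hq q' hq'Q, Perm.mul_apply, hz]
  have hpres' : ∀ z, q z = z ↔ q (q' z) = q' z := fun z => by
    refine ⟨hpres z, fun h => q'.injective ?_⟩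
    rw [← Perm.mul_apply, ← hcomm q hq q' hq'Q, Perm.mul_apply, h]
  -- The conjugate `q'` permutes the p fixed points of q, fixes a multiple of p of them and moves `g
  -- x`; so it fixes none.
  have hdisj : ∀ z, q z = z → q' z ≠ z := by
    let τ : Perm {z // q z = z} := q'.subtypePerm fun z => (hpres' z).symm
    have hτ : τ ^ p = 1 := by
      ext z
      rw [Perm.subtypePerm_pow]
      exact DFunLike.congr_fun (hexp q' hq'Q) (z : X)
    have h1 := card_modEq_card_fixed hτ
    rw [hc1] at h1
    have h2 : p ∣ Nat.card {z // τ z = z} :=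
      (Nat.modEq_zero_iff_dvd.1 (h1.symm.trans (Nat.modEq_zero_iff_dvd.2 dvd_rfl)))
    have h3 : Nat.card {z // τ z = z} < p := by
      by_contra! h
      rw [← hc1] at h
      have := (Function.Injective.bijective_of_nat_card_le
        (Subtype.val_injective (p := fun z => τ z = z)) h).2
      obtain ⟨⟨w', hw'⟩, h5⟩ := this ⟨g x, hy⟩
      simp only at h5
      rw [h5] at hw'
      exact hq'x (congrArg Subtype.val hw')
    have h4 := Nat.eq_zero_of_dvd_of_lt h2 h3
    intro z hz hz'
    have : 0 < Nat.card {z // τ z = z} :=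
      Nat.card_pos_iff.2 ⟨⟨⟨z, hz⟩, Subtype.ext hz'⟩, inferInstance⟩
    omega
  have hcover : ∀ z, q z = z ∨ q' z = z := by
    let f : {z // q z = z} ⊕ {z // q' z = z} → X := Sum.elim Subtype.val Subtype.val
    have hf : Function.Injective f := by
      rintro (⟨a, ha⟩ | ⟨a, ha⟩) (⟨b, hb⟩ | ⟨b, hb⟩) h
      · simp only [f, Sum.elim_inl] at h; subst h; rfl
      · simp only [f, Sum.elim_inl, Sum.elim_inr] at h; subst h; exact absurd hb (hdisj _ ha)
      · simp only [f, Sum.elim_inl, Sum.elim_inr] at h; subst h; exact absurd ha (hdisj _ hb)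
      · simp only [f, Sum.elim_inr] at h; subst h; rfl
    have hs := (hf.bijective_of_nat_card_le (by rw [Nat.card_sum, hc1, hc2, hX, two_mul])).2
    intro z
    obtain ⟨⟨a, ha⟩ | ⟨a, ha⟩, rfl⟩ := hs z
    · exact Or.inl ha
    · exact Or.inr ha
  -- The two fixed sets partition X, and each factor moves every point that the other one fixes.
  refine ⟨q * q', Q.mul_mem hq hq'Q, fun z hz => ?_⟩
  rw [Perm.mul_apply] at hz
  rcases hcover z with h | h
  · rw [hpres z h] at hz
    exact hdisj z h hz
  · rw [h] at hz
    exact hdisj z hz h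

end FreeElement

section Monomial

variable {p : ℕ} [Fact p.Prime]

theorem transPerm_eq_pow (t : ZMod 2 → ZMod p) (c : ZMod p) :
    transPerm (c • t) = transPerm t ^ c.val := by
  rw [transPerm_pow]
  congr 1
  ext i
  simp

/-- A transitive group on two lines with an abelian normal subgroup `Q` of exponent `p` that
contains the translation by `1`, and with abelian quotient of exponent dividing `p - 1`. -/
theorem NormalizesFree.of_transPerm_mem (hp2 : p ≠ 2) {G Q : Subgroup (Perm (ZMod 2 × ZMod p))}
    (htr : ∀ x x', ∃ g ∈ G, g x = x') (hnorm : ∀ g ∈ G, ∀ q ∈ Q, g * q * g⁻¹ ∈ Q)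
    (hcomm : ∀ q ∈ Q, ∀ q' ∈ Q, q * q' = q' * q) (hexp : ∀ q ∈ Q, q ^ p = 1)
    (h1Q : transPerm 1 ∈ Q) (habel : ∀ g ∈ G, ∀ h ∈ G, g * h * (h * g)⁻¹ ∈ Q)
    (hpow : ∀ g ∈ G, g ^ (p - 1) ∈ Q) : NormalizesFree p G := by
  have htrans : ∀ q ∈ Q, ∃ s, q = transPerm s := fun q hq =>
    exists_eq_transPerm_of_commute hp2 (t := 1) (by simp) (hexp q hq) (hcomm _ hq _ h1Q)
  -- Conjugation by g carries the translation by 1 into Q, that is, to a translation. So g is affine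
  -- on each line, but its slopes on the two lines may still differ.
  have hform : ∀ g ∈ G, ∃ (j : ZMod 2) (κ b : ZMod 2 → ZMod p), (∀ i, κ i ≠ 0) ∧
      ∀ i x, g (i, x) = (i + j, κ i * x + b i) := by
    intro g hg
    obtain ⟨s, hs⟩ := htrans _ (hnorm g hg _ h1Q)
    obtain ⟨j, hj⟩ := semilinear_apply (t := 1) (by simp) (mul_inv_eq_iff_eq_mul.1 hs)
    refine ⟨j, fun i => s (i + j), fun i => (g (i, 0)).2, fun i hi => ?_, by simpa using hj⟩
    have h1 := hj i 0
    have h2 := hj i 1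
    simp only at hi
    simp only [hi, zero_div, zero_mul] at h1 h2
    exact zero_ne_one (congrArg Prod.snd (g.injective (h1.trans h2.symm)))
  obtain ⟨σ, hσ, hσ0⟩ := htr (0, 0) (1, 0)
  obtain ⟨j, κ, b, hκ, hσf⟩ := hform σ hσ
  obtain rfl : j = 1 := by
    have := congrArg Prod.fst ((hσf 0 0).symm.trans hσ0)
    simpa using this
  have hsq : IsSquare (κ 0 * κ 1) := by
    rw [ZMod.euler_criterion p (mul_ne_zero (hκ 0) (hκ 1))]
    obtain ⟨s, hs⟩ := htrans _ (hpow σ hσ)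
    have hodd : p - 1 = 2 * (p / 2) := by
      have := Nat.odd_iff.1 ((Fact.out : p.Prime).odd_of_ne_two hp2)
      omega
    have h1 : ∀ n : ℕ, ∃ c, ∀ x, (σ ^ (2 * n)) (0, x) = (0, (κ 0 * κ 1) ^ n * x + c) := by
      intro n
      induction n with
      | zero => exact ⟨0, fun x => by simp⟩
      | succ n ih =>
        obtain ⟨c, hc⟩ := ih
        refine ⟨κ 1 * (κ 0 * c + b 0) + b 1, fun x => ?_⟩
        have : σ ^ (2 * (n + 1)) = σ * (σ * σ ^ (2 * n)) := by
          rw [← pow_succ', ← pow_succ']; rfl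
        rw [this, Perm.mul_apply, Perm.mul_apply, hc, hσf 0, zero_add, hσf]
        ext
        · simp [CharTwo.add_self_eq_zero]
        · simp only; ring
    obtain ⟨c, hc⟩ := h1 (p / 2)
    rw [← hodd, hs] at hc
    have e0 := congrArg Prod.snd (hc 0)
    have e1 := congrArg Prod.snd (hc 1)
    simp at e0 e1
    linear_combination e0 - e1
  obtain ⟨l, hl⟩ := hsq
  have hl0 : l ≠ 0 := by
    rintro rfl
    exact mul_ne_zero (hκ 0) (hκ 1) (by rw [hl, mul_zero])
  -- An eigenvector, with eigenvalue l, of the map (t 0, t 1) ↦ (κ 1 * t 1, κ 0 * t 0) that σ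
  -- induces on translation vectors; here l² = κ 0 * κ 1 is needed.
  set s : ZMod 2 → ZMod p := fun i => if i = 0 then 1 else κ 0 / l with hs
  have hs1 : s 1 = κ 0 / l := by simp [hs]
  have hs0 : s 0 = 1 := by simp [hs]
  have hσs : σ * transPerm s * σ⁻¹ = transPerm s ^ l.val := by
    rw [← transPerm_eq_pow, mul_inv_eq_iff_eq_mul]
    ext1 ⟨i, x⟩
    rw [Perm.mul_apply, Perm.mul_apply, transPerm_apply, transPerm_apply, hσf, hσf]
    ext
    · rfl
    · rcases ZMod.two_cases i with rfl | rfl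
      · simp only [zero_add, Pi.smul_apply, hs1, hs0, smul_eq_mul]
        field_simp
        ring
      · simp only [CharTwo.add_self_eq_zero, Pi.smul_apply, hs1, hs0, smul_eq_mul]
        field_simp
        linear_combination hl
  have hscalar : ∀ g ∈ G, (g (0, 0)).1 = 0 → ∃ k : ℕ, g * transPerm s * g⁻¹ = transPerm s ^ k := by
    intro g hg hg0
    obtain ⟨j', κ', b', -, hgf⟩ := hform g hg
    obtain rfl : j' = 0 := by rw [hgf] at hg0; simpa using hg0
    obtain ⟨u, hu⟩ := htrans _ (habel g hg σ hσ)
    rw [mul_inv_eq_iff_eq_mul] at hu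
    have hκ' : κ' 1 = κ' 0 := by
      have e0 := congrArg Prod.snd (DFunLike.congr_fun hu (0, 0))
      have e1 := congrArg Prod.snd (DFunLike.congr_fun hu (0, 1))
      simp only [Perm.mul_apply, hσf, hgf, transPerm_apply, zero_add, add_zero] at e0 e1
      apply mul_left_cancel₀ (hκ 0)
      linear_combination e1 - e0
    refine ⟨(κ' 0).val, ?_⟩
    rw [← transPerm_eq_pow, mul_inv_eq_iff_eq_mul]
    ext1 ⟨i, x⟩
    rw [Perm.mul_apply, Perm.mul_apply, transPerm_apply, transPerm_apply, hgf, hgf]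
    have : κ' i = κ' 0 := by rcases ZMod.two_cases i with rfl | rfl <;> simp [hκ']
    ext
    · rfl
    · simp only [this, add_zero, Pi.smul_apply, smul_eq_mul]
      ring
  refine ⟨transPerm s, transPerm_pow_prime s, fun x h => ?_, fun g hg => ?_⟩
  · have h1 := congrArg Prod.snd h
    rcases ZMod.two_cases x.1 with h2 | h2
    · simp [h2, hs0] at h1
    · simp [h2, hs1, hκ 0, hl0] at h1
  · rcases ZMod.two_cases (g (0, 0)).1 with h | h
    · exact hscalar g hg h
    -- If g exchanges the lines, g σ⁻¹ preserves them and is covered by `hscalar`.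
    · obtain ⟨j', κ', b', -, hgf⟩ := hform _ (G.mul_mem hg (G.inv_mem hσ))
      have hj' : j' = 0 := by
        have h1 := hgf 1 (σ (0, 0)).2
        have h2 : ((1, (σ (0, 0)).2) : ZMod 2 × ZMod p) = σ (0, 0) := by
          rw [hσf]; simp
        rw [h2, Perm.mul_apply, Perm.inv_def, Equiv.symm_apply_apply] at h1
        have h3 := congrArg Prod.fst h1
        rw [h] at h3
        simpa using h3.symm
      obtain ⟨k, hk⟩ := hscalar _ (G.mul_mem hg (G.inv_mem hσ)) (by rw [hgf, hj', add_zero])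
      refine ⟨k * l.val, ?_⟩
      have : g * transPerm s * g⁻¹ =
          g * σ⁻¹ * (σ * transPerm s * σ⁻¹) * (g * σ⁻¹)⁻¹ := by group
      rw [this, hσs, ← conj_pow, hk, ← pow_mul]

end Monomial

/-! ### The listed groups normalize a free cyclic group of order p -/

section ListedShape

variable {p : ℕ}

/-- `G` is an extension of an abelian group of exponent dividing `p - 1` by an abelian group of
exponent dividing `p`. -/
def HasAbelianLayers (p : ℕ) (G : Type*) [Group G] : Prop :=
  ∃ (A : Type) (_ : CommGroup A) (χ : G →* A), (∀ g, χ g ^ (p - 1) = 1) ∧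
    (∀ g h, χ g = 1 → χ h = 1 → g * h = h * g) ∧ ∀ g, χ g = 1 → g ^ p = 1

theorem HasAbelianLayers.of_mulEquiv {G G' : Type*} [Group G] [Group G'] (e : G ≃* G')
    (h : HasAbelianLayers p G') : HasAbelianLayers p G := by
  obtain ⟨A, _, χ, h1, h2, h3⟩ := h
  refine ⟨A, inferInstance, χ.comp e.toMonoidHom, fun g => h1 _, fun g g' hg hg' => ?_,
    fun g hg => ?_⟩
  · exact e.injective (by simpa using h2 _ _ hg hg')
  · exact e.injective (by simpa using h3 _ hg)

theorem HasAbelianLayers.semidirectProduct {N Q : Type} [CommGroup N] [CommGroup Q]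
    (φ : Q →* MulAut N) (hN : ∀ n : N, n ^ p = 1) (hQ : ∀ q : Q, q ^ (p - 1) = 1) :
    HasAbelianLayers p (N ⋊[φ] Q) := by
  have hker : ∀ g : N ⋊[φ] Q, SemidirectProduct.rightHom g = 1 → ∃ n, g = SemidirectProduct.inl n :=
    fun g hg => ⟨g.left, by ext; · rfl
                            · exact hg⟩
  refine ⟨Q, inferInstance, SemidirectProduct.rightHom, fun g => hQ _, fun g h hg hh => ?_,
    fun g hg => ?_⟩
  · obtain ⟨n, rfl⟩ := hker g hg
    obtain ⟨m, rfl⟩ := hker h hh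
    rw [← map_mul, ← map_mul, mul_comm]
  · obtain ⟨n, rfl⟩ := hker g hg
    rw [← map_pow, hN, map_one]

theorem Cyc.pow_eq_one {n m : ℕ} (h : n ∣ m) (a : Cyc n) : a ^ m = 1 := by
  change m • a.toAdd = 0
  rw [nsmul_eq_mul, (ZMod.natCast_eq_zero_iff m n).2 h, zero_mul]

variable [Fact p.Prime]

/-- A p-th power in C_{2p} has square 1, and the cyclic group has only one element of order 2. -/
theorem Cyc.pow_prime_eq_of_ne_one {a b : Cyc (2 * p)} (ha : a ^ p ≠ 1) (hb : b ^ p ≠ 1) :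
    a ^ p = b ^ p := by
  have h : ∀ c : Cyc (2 * p), c ^ p ≠ 1 → (c ^ p).toAdd = (p : ZMod (2 * p)) := by
    intro c hc
    have hp : 0 < p := (Fact.out : p.Prime).pos
    have : NeZero (2 * p) := ⟨by omega⟩
    set d : ZMod (2 * p) := (c ^ p).toAdd with hd
    have h1 : 2 * d = 0 := by
      have h2 : (c ^ p) ^ 2 = 1 := by
        rw [← pow_mul]; exact Cyc.pow_eq_one (mul_comm 2 p).dvd c
      have h3 : 2 • d = 0 := congrArg Multiplicative.toAdd h2
      simpa using h3
    have h4 : d ≠ 0 := fun h => hc (congrArg Multiplicative.ofAdd h)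
    have h5 : 2 * p ∣ 2 * d.val := by
      rw [← ZMod.natCast_eq_zero_iff]
      push_cast
      rw [ZMod.natCast_zmod_val, h1]
    obtain ⟨k, hk⟩ := Nat.dvd_of_mul_dvd_mul_left two_pos h5
    have h6 := d.val_lt
    have h7 : d.val ≠ 0 := fun h => h4 ((ZMod.val_eq_zero d).1 h)
    have h8 : k = 1 := by
      rw [hk] at h6 h7
      have : k < 2 := by
        rw [mul_comm] at h6
        exact Nat.lt_of_mul_lt_mul_right h6
      have : k ≠ 0 := by rintro rfl; simp at h7
      omega
    rw [← ZMod.natCast_zmod_val d, hk, h8, mul_one]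
  exact (h a ha).trans (h b hb).symm

/-- Since C_{2p} does not have exponent p, its part of order 2 must move to the quotient. The map
(n, q) ↦ (n ^ p, q) is a homomorphism because automorphisms fix the only element of order 2, and its
kernel has exponent p. -/
theorem HasAbelianLayers.cyc_two_mul (hp2 : p ≠ 2) {m : ℕ} (hm : m ∣ p - 1)
    (φ : Cyc m →* MulAut (Cyc (2 * p))) : HasAbelianLayers p (Cyc (2 * p) ⋊[φ] Cyc m) := by
  have hφ : ∀ q n, φ q n ^ p = n ^ p := by
    intro q n
    by_cases h : n ^ p = 1
    · rw [← map_pow, h, map_one]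
    · refine Cyc.pow_prime_eq_of_ne_one (fun h' => h ?_) h
      rw [← map_pow] at h'
      exact (φ q).injective (h'.trans (map_one _).symm)
  let χ : Cyc (2 * p) ⋊[φ] Cyc m →* Cyc (2 * p) × Cyc m :=
    { toFun g := (g.left ^ p, g.right)
      map_one' := by simp
      map_mul' g h := by
        ext
        · simp only [SemidirectProduct.mul_left, Prod.fst_mul, mul_pow, hφ]
        · rfl }
  have hodd : 2 ∣ p - 1 := by
    have := Nat.odd_iff.1 ((Fact.out : p.Prime).odd_of_ne_two hp2)
    omega
  have hker : ∀ g : Cyc (2 * p) ⋊[φ] Cyc m, χ g = 1 →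
      ∃ n, n ^ p = 1 ∧ g = SemidirectProduct.inl n :=
    fun g hg => ⟨g.left, congrArg Prod.fst hg, by ext; · rfl
                                                  · exact congrArg Prod.snd hg⟩
  refine ⟨_, inferInstance, χ, fun g => ?_, fun g h hg hh => ?_, fun g hg => ?_⟩
  · refine Prod.ext ?_ (Cyc.pow_eq_one hm _)
    change (g.left ^ p) ^ (p - 1) = 1
    rw [← pow_mul]
    exact Cyc.pow_eq_one (by rw [mul_comm]; exact mul_dvd_mul_left p hodd) _
  · obtain ⟨n, -, rfl⟩ := hker g hg
    obtain ⟨m, -, rfl⟩ := hker h hh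
    rw [← map_mul, ← map_mul, mul_comm n]
  · obtain ⟨n, hn, rfl⟩ := hker g hg
    rw [← map_pow, hn, map_one]

/-- This is all that the converse needs from the four shapes. The action plays no role, which is why
(b), with arbitrary actions, implies (c). -/
theorem IsOfListedShape.hasAbelianLayers (hp2 : p ≠ 2) {G : Type*} [Group G]
    (h : IsOfListedShape p G) : HasAbelianLayers p G := by
  have hodd : 2 ∣ p - 1 := by
    have := Nat.odd_iff.1 ((Fact.out : p.Prime).odd_of_ne_two hp2)
    omega
  rcases h with ⟨m, -, hm, φ, ⟨e⟩⟩ | ⟨m, -, hm, φ, ⟨e⟩⟩ | ⟨m, hm, φ, ⟨e⟩⟩ | ⟨m, -, hm, φ, ⟨e⟩⟩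
  · exact (HasAbelianLayers.semidirectProduct φ
      (fun n => Prod.ext (Cyc.pow_eq_one dvd_rfl _) (Cyc.pow_eq_one dvd_rfl _))
      (Cyc.pow_eq_one hm)).of_mulEquiv e
  · exact (HasAbelianLayers.semidirectProduct φ
      (fun n => Prod.ext (Cyc.pow_eq_one dvd_rfl _) (Cyc.pow_eq_one dvd_rfl _))
      (fun q => Prod.ext (Cyc.pow_eq_one hodd _) (Cyc.pow_eq_one hm _))).of_mulEquiv e
  · exact (HasAbelianLayers.cyc_two_mul hp2 hm φ).of_mulEquiv e
  · exact (HasAbelianLayers.semidirectProduct φ (Cyc.pow_eq_one dvd_rfl)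
      (Cyc.pow_eq_one hm)).of_mulEquiv e

/-- With Q the kernel of χ, `exists_free_mem` provides a free element of Q; in coordinates where it
is the translation by 1, `NormalizesFree.of_transPerm_mem` applies. -/
theorem NormalizesFree.of_hasAbelianLayers (hp2 : p ≠ 2) {X : Type*} [Finite X]
    (hX : Nat.card X = 2 * p) {G : Subgroup (Perm X)} (htr : ∀ x x', ∃ g ∈ G, g x = x')
    (h : HasAbelianLayers p G) : NormalizesFree p G := by
  obtain ⟨A, _, χ, h1, h2, h3⟩ := h
  have hp : p.Prime := Fact.out
  set Q : Subgroup (Perm X) := χ.ker.map G.subtype with hQ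
  have hQmem : ∀ g : G, χ g = 1 → (g : Perm X) ∈ Q := fun g hg => ⟨g, hg, rfl⟩
  have hnorm : ∀ g ∈ G, ∀ q ∈ Q, g * q * g⁻¹ ∈ Q := by
    rintro g hg _ ⟨q, hq, rfl⟩
    refine hQmem (⟨g, hg⟩ * q * ⟨g, hg⟩⁻¹) ?_
    rw [map_mul, map_mul, map_inv, show χ q = 1 from hq, mul_one, mul_inv_cancel]
  have hcomm : ∀ q ∈ Q, ∀ q' ∈ Q, q * q' = q' * q := by
    rintro _ ⟨q, hq, rfl⟩ _ ⟨q', hq', rfl⟩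
    exact congrArg Subtype.val (h2 q q' hq hq')
  have hexp : ∀ q ∈ Q, q ^ p = 1 := by
    rintro _ ⟨q, hq, rfl⟩
    exact congrArg Subtype.val (h3 q hq)
  have habel : ∀ g ∈ G, ∀ h ∈ G, g * h * (h * g)⁻¹ ∈ Q := by
    intro g hg h hh
    refine hQmem (⟨g, hg⟩ * ⟨h, hh⟩ * (⟨h, hh⟩ * ⟨g, hg⟩)⁻¹) ?_
    rw [map_mul, map_inv, map_mul, map_mul, mul_comm (χ ⟨g, hg⟩), mul_inv_cancel]
  have hpow : ∀ g ∈ G, g ^ (p - 1) ∈ Q := by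
    intro g hg
    refine hQmem (⟨g, hg⟩ ^ (p - 1)) ?_
    rw [map_pow, h1]
  have hQ1 : Q ≠ ⊥ := by
    obtain ⟨x₀⟩ : Nonempty X :=
      (Nat.card_pos_iff.1 (by rw [hX]; exact mul_pos two_pos hp.pos)).1
    have : MulAction.IsPretransitive G X :=
      ⟨fun y y' => by obtain ⟨g, hg, h⟩ := htr y y'; exact ⟨⟨g, hg⟩, h⟩⟩
    have hdvd : p ∣ Nat.card G := by
      have h1 := MulAction.index_stabilizer_of_transitive G x₀
      have h2 := (MulAction.stabilizer G x₀).index_dvd_card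
      rw [h1, hX] at h2
      exact (dvd_mul_left p 2).trans h2
    obtain ⟨q, hq⟩ := exists_prime_orderOf_dvd_card' p hdvd
    -- The order of `χ q` divides both p and p - 1.
    have hχq : χ q = 1 := by
      have h4 : χ q ^ p = 1 := by rw [← map_pow, ← hq, pow_orderOf_eq_one, map_one]
      have h5 : p = (p - 1) + 1 := by have := hp.pos; omega
      rwa [h5, pow_succ, h1, one_mul] at h4
    intro h
    have h6 := hQmem q hχq
    rw [h, Subgroup.mem_bot] at h6
    have h7 : q = 1 := Subtype.ext h6
    rw [h7, orderOf_one] at hq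
    exact hp.one_lt.ne hq
  obtain ⟨r, hrQ, hr⟩ := exists_free_mem hX htr hnorm hcomm hexp hQ1
  obtain ⟨e, he⟩ := exists_equiv_transPerm hX (hexp r hrQ) hr
  apply NormalizesFree.of_map_permCongr e
  apply NormalizesFree.of_transPerm_mem (Q := Q.map e.permCongrHom.toMonoidHom) hp2
    (transitive_map_permCongr htr e)
  · rintro _ ⟨g, hg, rfl⟩ _ ⟨q, hq, rfl⟩
    exact ⟨_, hnorm g hg q hq, by simp only [map_mul, map_inv]⟩
  · rintro _ ⟨q, hq, rfl⟩ _ ⟨q', hq', rfl⟩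
    rw [← map_mul, hcomm q hq q' hq', map_mul]
  · rintro _ ⟨q, hq, rfl⟩
    rw [← map_pow, hexp q hq, map_one]
  · exact ⟨r, hrQ, he⟩
  · rintro _ ⟨g, hg, rfl⟩ _ ⟨h, hh, rfl⟩
    exact ⟨_, habel g hg h hh, by simp only [map_mul, map_inv]⟩
  · rintro _ ⟨g, hg, rfl⟩
    exact ⟨_, hpow g hg, by simp only [map_pow]⟩

end ListedShape

/-! ### Internal semidirect products with a computable action -/

section SemidirectTools

/-- Kernel and complement are given by homomorphisms rather than subgroups, so that φ is expressed
in chosen parametrizations and the explicit actions can be checked. The hypothesis `hdisj` covers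
both trivial intersection and injectivity of h. -/
theorem exists_mulEquiv_semidirect {G N Q : Type*} [Group G] [Group N] [Group Q]
    (f : N →* G) (h : Q →* G) (hf : Function.Injective f)
    (hnorm : ∀ q n, ∃ n', f n' = h q * f n * (h q)⁻¹) (hdisj : ∀ q n, h q = f n → q = 1)
    (hsurj : ∀ g, ∃ n q, g = f n * h q) :
    ∃ φ : Q →* MulAut N, (∀ q n, f (φ q n) = h q * f n * (h q)⁻¹) ∧
      Nonempty (G ≃* N ⋊[φ] Q) := by
  choose a ha using hnorm
  let φ : Q →* MulAut N :=
    { toFun q :=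
        { toFun := a q
          invFun := a q⁻¹
          left_inv n := hf (by rw [ha, ha, map_inv]; group)
          right_inv n := hf (by rw [ha, ha, map_inv]; group)
          map_mul' n n' := hf (by rw [ha, map_mul, map_mul, ha, ha]; group) }
      map_one' := by
        ext n
        exact hf (by change f (a 1 n) = f n; rw [ha, map_one]; group)
      map_mul' q q' := by
        ext n
        exact hf (by change f (a (q * q') n) = f (a q (a q' n)); rw [ha, ha, ha, map_mul]; group) }
  have hφ : ∀ q n, f (φ q n) = h q * f n * (h q)⁻¹ := ha
  let F : N ⋊[φ] Q →* G := SemidirectProduct.lift f h fun q => by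
    ext n
    exact hφ q n
  have hF : ∀ n q, F ⟨n, q⟩ = f n * h q := fun n q => by
    rw [SemidirectProduct.mk_eq_inl_mul_inr, map_mul]
    simp [F]
  refine ⟨φ, hφ, ⟨(MulEquiv.ofBijective F ⟨?_, ?_⟩).symm⟩⟩
  · rw [injective_iff_map_eq_one]
    rintro ⟨n, q⟩ hn
    rw [hF] at hn
    have hq : q = 1 := hdisj q n⁻¹ (by rw [map_inv]; exact eq_inv_of_mul_eq_one_right hn)
    subst hq
    rw [map_one, mul_one, ← map_one f] at hn
    rw [hf hn]
    rfl
  · intro g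
    obtain ⟨n, q, rfl⟩ := hsurj g
    exact ⟨⟨n, q⟩, hF n q⟩

theorem Cyc.exists_eq_gen_zpow {m : ℕ} (a : Cyc m) : ∃ n : ℤ, a = Cyc.gen m ^ n := by
  obtain ⟨n, hn⟩ := ZMod.intCast_surjective a.toAdd
  refine ⟨n, ?_⟩
  change a = Multiplicative.ofAdd (n • (1 : ZMod m))
  rw [zsmul_one, hn]
  rfl

theorem Cyc.exists_hom {G : Type*} [Group G] (m : ℕ) {g : G} (hg : g ^ m = 1) :
    ∃ f : Cyc m →* G, ∀ n : ℤ, f (Cyc.gen m ^ n) = g ^ n := by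
  let F : ZMod m →+ Additive G := ZMod.lift m ⟨zmultiplesHom (Additive G) (Additive.ofMul g), by
    simp only [zmultiplesHom_apply, natCast_zsmul]
    exact congrArg Additive.ofMul hg⟩
  refine ⟨AddMonoidHom.toMultiplicativeLeft F, fun n => ?_⟩
  rw [map_zpow]
  congr 1
  have : F ((1 : ℤ) : ZMod m) = (1 : ℤ) • Additive.ofMul g := ZMod.lift_coe _ _ _
  rw [Int.cast_one, one_smul] at this
  exact congrArg Additive.toMul this

theorem Cyc.gen_zpow_eq_one {m : ℕ} {n : ℤ} (h : (m : ℤ) ∣ n) : Cyc.gen m ^ n = 1 := by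
  change Multiplicative.ofAdd (n • (1 : ZMod m)) = 1
  rw [zsmul_one, (ZMod.intCast_zmod_eq_zero_iff_dvd n m).2 h]
  rfl

theorem IsOfListedShapeExplicit.of_mulEquiv {p : ℕ} {G G' : Type*} [Group G] [Group G']
    (e : G ≃* G') (h : IsOfListedShapeExplicit p G') : IsOfListedShapeExplicit p G := by
  rcases h with ⟨m, k, h1, h2, h3, φ, h4, ⟨e'⟩⟩ | ⟨m, k, h1, h2, h3, φ, h4, h5, ⟨e'⟩⟩ |
    ⟨m, h1, φ, h2, ⟨e'⟩⟩ | ⟨m, h1, h2, φ, h3, ⟨e'⟩⟩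
  · exact Or.inl ⟨m, k, h1, h2, h3, φ, h4, ⟨e.trans e'⟩⟩
  · exact Or.inr (Or.inl ⟨m, k, h1, h2, h3, φ, h4, h5, ⟨e.trans e'⟩⟩)
  · exact Or.inr (Or.inr (Or.inl ⟨m, h1, φ, h2, ⟨e.trans e'⟩⟩))
  · exact Or.inr (Or.inr (Or.inr ⟨m, h1, h2, φ, h3, ⟨e.trans e'⟩⟩))

theorem IsOfListedShapeExplicit.isOfListedShape {p : ℕ} {G : Type*} [Group G]
    (h : IsOfListedShapeExplicit p G) : IsOfListedShape p G := by
  rcases h with ⟨m, k, h1, h2, -, φ, -, h4⟩ | ⟨m, k, h1, h2, -, φ, -, -, h4⟩ |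
    ⟨m, h1, φ, -, h4⟩ | ⟨m, h1, h2, φ, -, h4⟩
  · exact Or.inl ⟨m, h1, h2, φ, h4⟩
  · exact Or.inr (Or.inl ⟨m, h1, h2, φ, h4⟩)
  · exact Or.inr (Or.inr (Or.inl ⟨m, h1, φ, h4⟩))
  · exact Or.inr (Or.inr (Or.inr ⟨m, h1, h2, φ, h4⟩))

end SemidirectTools

/-! ### Transitive affine groups, by translations and linear parts -/

section AffineSubgroups

variable {p : ℕ} [Fact p.Prime] {G : Subgroup (Perm (ZMod 2 × ZMod p))}

/-- The linear part, on a group of affine permutations. -/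
noncomputable def linHom (hG : G ≤ affineGroup p) : G →* Multiplicative (ZMod 2) × (ZMod p)ˣ :=
  (linPart p).comp (Subgroup.inclusion hG)

theorem exists_eq_affPerm_linHom (hG : G ≤ affineGroup p) (g : G) :
    ∃ b, (g : Perm (ZMod 2 × ZMod p)) = affPerm (linHom hG g).1.toAdd (linHom hG g).2 b :=
  exists_eq_affPerm (Subgroup.inclusion hG g)

theorem linHom_mk (hG : G ≤ affineGroup p) {j : ZMod 2} {k : (ZMod p)ˣ} {b : ZMod 2 → ZMod p}
    (h : affPerm j k b ∈ G) : linHom hG ⟨_, h⟩ = (.ofAdd j, k) := linPart_affPerm j k b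

theorem exists_eq_transPerm_of_linHom (hG : G ≤ affineGroup p) {g : G} (h : linHom hG g = 1) :
    ∃ s, (g : Perm (ZMod 2 × ZMod p)) = transPerm s := by
  obtain ⟨b, hb⟩ := exists_eq_affPerm_linHom hG g
  rw [h] at hb
  exact ⟨b, hb⟩

theorem linHom_transPerm (hG : G ≤ affineGroup p) {s : ZMod 2 → ZMod p} (h : transPerm s ∈ G) :
    linHom hG ⟨_, h⟩ = 1 := linHom_mk hG h

theorem conj_transPerm_linHom (hG : G ≤ affineGroup p) (g : G) (s : ZMod 2 → ZMod p) :
    (g : Perm (ZMod 2 × ZMod p)) * transPerm s * (g : Perm (ZMod 2 × ZMod p))⁻¹ =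
      transPerm (fun i => ((linHom hG g).2 : ZMod p) * s (i + (linHom hG g).1.toAdd)) := by
  obtain ⟨b, hb⟩ := exists_eq_affPerm_linHom hG g
  rw [hb, affPerm_conj_transPerm]

/-- Every linear part in the group is the linear part of an element of the same order. -/
theorem exists_lift_linHom (hp2 : p ≠ 2) (hG : G ≤ affineGroup p) (g : G) :
    ∃ τ : G, linHom hG τ = linHom hG g ∧ ∀ n : ℤ, linHom hG g ^ n = 1 → τ ^ n = 1 := by
  -- The p-th power keeps the linear part and kills translations: if `g ^ n` is a translation, then
  -- (g ^ p) ^ n = (g ^ n) ^ p = 1.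
  refine ⟨g ^ p, by rw [map_pow, linPart_pow_prime hp2], fun n hn => ?_⟩
  rw [← map_zpow] at hn
  obtain ⟨s, hs⟩ := exists_eq_transPerm_of_linHom hG hn
  rw [← zpow_natCast, zpow_comm, zpow_natCast]
  exact Subtype.ext (by rw [Subgroup.coe_pow, hs, transPerm_pow_prime]; rfl)

theorem exists_linHom_fst (hG : G ≤ affineGroup p) (htr : ∀ y y', ∃ g ∈ G, g y = y') :
    ∃ g, (linHom hG g).1 = .ofAdd 1 := by
  obtain ⟨k, b, h⟩ := exists_swap_mem hG htr
  exact ⟨⟨_, h⟩, by rw [linHom_mk]⟩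

/-- The translation vector `(x, c y)`. -/
def lineVec (c : (ZMod p)ˣ) (a : Cyc p × Cyc p) : ZMod 2 → ZMod p :=
  fun i => if i = 0 then a.1.toAdd else c * a.2.toAdd

/-- The translations as a homomorphism, with a factor `c` on the second line. -/
def transHom (hall : ∀ s, transPerm s ∈ G) (c : (ZMod p)ˣ) : Cyc p × Cyc p →* G where
  toFun a := ⟨transPerm (lineVec c a), hall _⟩
  map_one' := Subtype.ext (by
    have : lineVec c 1 = 0 := funext fun i => by simp [lineVec]
    simp only [this, transPerm_zero]
    rfl)
  map_mul' a b := Subtype.ext (by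
    have : lineVec c (a * b) = lineVec c a + lineVec c b := funext fun i => by
      by_cases hi : i = 0 <;> simp [lineVec, hi, mul_add]
    simp only [this, ← transPerm_mul]
    rfl)

theorem coe_transHom (hall : ∀ s, transPerm s ∈ G) (c : (ZMod p)ˣ) (a : Cyc p × Cyc p) :
    (transHom hall c a : Perm (ZMod 2 × ZMod p)) = transPerm (lineVec c a) := rfl

theorem transHom_injective (hall : ∀ s, transPerm s ∈ G) (c : (ZMod p)ˣ) :
    Function.Injective (transHom hall c) := by
  intro a b h
  have h' := congrArg Subtype.val h
  rw [coe_transHom, coe_transHom] at h'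
  have h1 := transPerm_inj h'
  have e0 := congrFun h1 0
  have e1 := congrFun h1 1
  simp [lineVec] at e0 e1
  exact Prod.ext e0 e1

theorem exists_transHom_eq (hG : G ≤ affineGroup p) (hall : ∀ s, transPerm s ∈ G) (c : (ZMod p)ˣ)
    {g : G} (h : linHom hG g = 1) : ∃ a, transHom hall c a = g := by
  obtain ⟨s, hs⟩ := exists_eq_transPerm_of_linHom hG h
  refine ⟨(.ofAdd (s 0), .ofAdd (c⁻¹ * s 1)), Subtype.ext ?_⟩
  rw [hs, coe_transHom]
  congr 1
  ext i
  rcases ZMod.two_cases i with rfl | rfl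
  · simp [lineVec]
  · simp only [lineVec, one_ne_zero, if_false, toAdd_ofAdd, Units.mul_inv_cancel_left]

theorem linHom_transHom (hG : G ≤ affineGroup p) (hall : ∀ s, transPerm s ∈ G) (c : (ZMod p)ˣ)
    (a : Cyc p × Cyc p) : linHom hG (transHom hall c a) = 1 := linHom_transPerm hG (hall _)

theorem conj_transHom (hG : G ≤ affineGroup p) (hall : ∀ s, transPerm s ∈ G) (c : (ZMod p)ˣ)
    (g : G) (a : Cyc p × Cyc p) : ∃ a', transHom hall c a' = g * transHom hall c a * g⁻¹ := by
  apply exists_transHom_eq hG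
  rw [map_mul, map_mul, linHom_transHom, mul_one, map_inv, mul_inv_cancel]

/-- The constant translations as a homomorphism. -/
def diagHom (h1 : ∀ x : ZMod p, transPerm (fun _ => x) ∈ G) : Cyc p →* G where
  toFun a := ⟨transPerm fun _ => a.toAdd, h1 _⟩
  map_one' := Subtype.ext (by rw [Subgroup.coe_one, ← transPerm_zero]; rfl)
  map_mul' a b := Subtype.ext (by rw [Subgroup.coe_mul, transPerm_mul]; rfl)

theorem natCast_val_units (k : (ZMod p)ˣ) : (((k : ZMod p).val : ℕ) : ZMod p) = k :=
  ZMod.natCast_zmod_val _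

theorem orderOf_unit_dvd (k : (ZMod p)ˣ) : orderOf k ∣ p - 1 := by
  have := orderOf_dvd_card (x := k)
  rwa [ZMod.card_units] at this

/-- All translations, and a cyclic linear part generated by an element that exchanges the lines. -/
theorem explicit_of_cyclic_linHom (hp2 : p ≠ 2) (hG : G ≤ affineGroup p)
    (hall : ∀ s, transPerm s ∈ G) {g₀ : G} {k : (ZMod p)ˣ} (hg₀ : linHom hG g₀ = (.ofAdd 1, k))
    (hgen : ∀ g, ∃ n : ℤ, linHom hG g = linHom hG g₀ ^ n) {c : (ZMod p)ˣ} (hc : c * c = 1)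
    (heven : Even (orderOf (c * k))) : IsOfListedShapeExplicit p G := by
  obtain ⟨τ, hτ, hτ1⟩ := exists_lift_linHom hp2 hG g₀
  rw [hg₀] at hτ hτ1
  have hcn : ∀ n : ℤ, Even n → c ^ n = 1 := by
    rintro _ ⟨n, rfl⟩
    rw [zpow_add, ← mul_zpow, hc, one_zpow]
  -- The linear part (1, k) has the order of `c * k`: powers of either are trivial only for even n,
  -- and there `c ^ n = 1`.
  have hone : ∀ n : ℤ, ((orderOf (c * k) : ℕ) : ℤ) ∣ n ↔
      ((.ofAdd 1, k) : Multiplicative (ZMod 2) × (ZMod p)ˣ) ^ n = 1 := by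
    intro n
    rw [orderOf_dvd_iff_zpow_eq_one, mul_zpow, Prod.ext_iff]
    have h2 : (Multiplicative.ofAdd (1 : ZMod 2)) ^ n = 1 ↔ Even n := by
      rw [← ofAdd_zsmul, zsmul_one, ofAdd_eq_one, ZMod.intCast_eq_zero_iff_even]
    constructor
    · intro h
      have hn : Even n := by
        rw [← mul_zpow, ← orderOf_dvd_iff_zpow_eq_one] at h
        exact (Int.even_coe_nat _).2 heven |>.trans_dvd h
      rw [hcn n hn, one_mul] at h
      exact ⟨h2.2 hn, h⟩
    · rintro ⟨h, h'⟩
      rw [hcn n (h2.1 h), one_mul]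
      exact h'
  obtain ⟨h, hh⟩ := Cyc.exists_hom (orderOf (c * k)) (g := τ) (by
    rw [← zpow_natCast]
    exact hτ1 _ ((hone _).1 dvd_rfl))
  obtain ⟨φ, hφ, he⟩ := exists_mulEquiv_semidirect (transHom hall c) h (transHom_injective hall c)
    (fun q n => conj_transHom hG hall c _ _)
    (fun q n hqn => by
      obtain ⟨i, rfl⟩ := Cyc.exists_eq_gen_zpow q
      have := congrArg (linHom hG) hqn
      rw [hh, linHom_transHom, map_zpow, hτ] at this
      exact Cyc.gen_zpow_eq_one ((hone i).2 this))
    (fun g => by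
      obtain ⟨n, hn⟩ := hgen g
      obtain ⟨a, ha⟩ := exists_transHom_eq hG hall c (g := g * (τ ^ n)⁻¹) (by
        rw [map_mul, map_inv, map_zpow, hτ, hn, hg₀, mul_inv_cancel])
      exact ⟨a, Cyc.gen _ ^ n, by rw [ha, hh, inv_mul_cancel_right]⟩)
  -- The factor c built into the second coordinate changes the multiplier from k to `c * k`, in both
  -- coordinates because c² = 1.
  refine Or.inl ⟨orderOf (c * k), ((c * k : (ZMod p)ˣ) : ZMod p).val, heven, orderOf_unit_dvd _,
    by rw [natCast_val_units, orderOf_units], φ, fun x y => ?_, he⟩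
  apply transHom_injective hall c
  rw [hφ]
  have hgen1 : h (Cyc.gen (orderOf (c * k))) = τ := by
    have := hh 1
    rwa [zpow_one, zpow_one] at this
  rw [hgen1]
  apply Subtype.ext
  refine (conj_transPerm_linHom hG τ _).trans ?_
  rw [hτ, coe_transHom]
  have hc' : (c : ZMod p) * c = 1 := congrArg Units.val hc
  congr 1
  ext i
  rcases ZMod.two_cases i with rfl | rfl
  · simp [lineVec]; ring
  · simp [lineVec, CharTwo.add_self_eq_zero]
    linear_combination (- k * x.toAdd) * hc'

end AffineSubgroups

section AffineSubgroups

variable {p : ℕ} [Fact p.Prime] {G : Subgroup (Perm (ZMod 2 × ZMod p))}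

theorem diagHom_injective (h1 : ∀ x : ZMod p, transPerm (fun _ => x) ∈ G) :
    Function.Injective (diagHom h1) := by
  intro a b h
  have h' : transPerm (fun _ => a.toAdd) = transPerm (fun _ => b.toAdd) := congrArg Subtype.val h
  exact congrFun (transPerm_inj h') 0

theorem linHom_diagHom (hG : G ≤ affineGroup p) (h1 : ∀ x : ZMod p, transPerm (fun _ => x) ∈ G)
    (a : Cyc p) : linHom hG (diagHom h1 a) = 1 := linHom_transPerm hG (h1 _)

theorem exists_diagHom_eq (hG : G ≤ affineGroup p) (h1 : ∀ x : ZMod p, transPerm (fun _ => x) ∈ G)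
    (hconst : ∀ s : ZMod 2 → ZMod p, transPerm s ∈ G → s 1 = s 0)
    {g : G} (h : linHom hG g = 1) : ∃ a, diagHom h1 a = g := by
  obtain ⟨s, hs⟩ := exists_eq_transPerm_of_linHom hG h
  have hs1 := hconst s (hs ▸ g.2)
  refine ⟨.ofAdd (s 0), Subtype.ext ?_⟩
  rw [hs]
  change transPerm (fun _ => s 0) = _
  congr 1
  ext i
  rcases ZMod.two_cases i with rfl | rfl
  · rfl
  · exact hs1.symm

theorem conj_diagHom (hG : G ≤ affineGroup p) (h1 : ∀ x : ZMod p, transPerm (fun _ => x) ∈ G)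
    (g : G) (a : Cyc p) : g * diagHom h1 a * g⁻¹ =
      diagHom h1 (.ofAdd (((linHom hG g).2 : ZMod p) * a.toAdd)) :=
  Subtype.ext (conj_transPerm_linHom hG g _)

/-- All translations, and a linear part that contains the exchange of the lines. -/
theorem explicit_of_flip_of_all (hG : G ≤ affineGroup p)
    (hall : ∀ s, transPerm s ∈ G) {ι g₀ : G} {k : (ZMod p)ˣ} (hι : linHom hG ι = (.ofAdd 1, 1))
    (hg₀ : linHom hG g₀ = (1, k)) (hgen : ∀ g, ∃ n : ℤ, (linHom hG g).2 = k ^ n)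
    (heven : Even (orderOf k)) : IsOfListedShapeExplicit p G := by
  -- With all translations in G, the constant terms can be removed, so the linear parts lift to a
  -- subgroup of G.
  have hzero : ∀ g : G, affPerm (linHom hG g).1.toAdd (linHom hG g).2 0 ∈ G := by
    intro g
    obtain ⟨b, hb⟩ := exists_eq_affPerm_linHom hG g
    have := G.mul_mem (hall fun i => - b (i - (linHom hG g).1.toAdd)) g.2
    rw [hb, transPerm, affPerm_mul] at this
    convert this using 2
    · rw [zero_add]
    · rw [one_mul]
    · ext i
      simp
  have hιG := hzero ι
  have hτG := hzero g₀
  rw [hι] at hιG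
  rw [hg₀] at hτG
  set ι' : G := ⟨_, hιG⟩ with hι'
  set τ : G := ⟨_, hτG⟩ with hτ'
  have hlι : linHom hG ι' = (.ofAdd 1, 1) := linHom_mk hG hιG
  have hlτ : linHom hG τ = (1, k) := linHom_mk hG hτG
  have hι2 : ι' ^ 2 = 1 := Subtype.ext (by
    rw [Subgroup.coe_pow, hι', pow_two, affPerm_mul, Subgroup.coe_one, ← transPerm_zero]
    simp only [toAdd_ofAdd, CharTwo.add_self_eq_zero, mul_one, transPerm]
    congr 1
    ext i
    simp)
  have hτm : τ ^ orderOf k = 1 := by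
    have h1 : ∀ n : ℕ, (τ : Perm (ZMod 2 × ZMod p)) ^ n = affPerm 0 (k ^ n) 0 := by
      intro n
      induction n with
      | zero => simpa [transPerm] using (transPerm_zero (p := p)).symm
      | succ n ih =>
        rw [pow_succ, ih, hτ', affPerm_mul]
        simp only [toAdd_one, zero_add]
        congr 1
        · rw [pow_succ]
        · funext i
          simp
    exact Subtype.ext (by
      rw [Subgroup.coe_pow, h1, pow_orderOf_eq_one, Subgroup.coe_one]; exact transPerm_zero)
  have hcomm : ι' * τ = τ * ι' := Subtype.ext (by
    rw [Subgroup.coe_mul, Subgroup.coe_mul, hι', hτ', affPerm_mul, affPerm_mul]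
    simp only [toAdd_ofAdd, toAdd_one, add_zero, zero_add, one_mul, mul_one, Pi.zero_apply,
      mul_zero])
  obtain ⟨f₁, hf₁⟩ := Cyc.exists_hom 2 hι2
  obtain ⟨f₂, hf₂⟩ := Cyc.exists_hom (orderOf k) hτm
  have hcomm' : ∀ a b, Commute (f₁ a) (f₂ b) := by
    intro a b
    obtain ⟨n, rfl⟩ := Cyc.exists_eq_gen_zpow a
    obtain ⟨m, rfl⟩ := Cyc.exists_eq_gen_zpow b
    rw [hf₁, hf₂]
    exact Commute.zpow_zpow hcomm n m
  set h : Cyc 2 × Cyc (orderOf k) →* G := f₁.noncommCoprod f₂ hcomm' with hh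
  have hh' : ∀ n m : ℤ, h (Cyc.gen 2 ^ n, Cyc.gen (orderOf k) ^ m) = ι' ^ n * τ ^ m := by
    intro n m
    rw [hh, MonoidHom.noncommCoprod_apply, hf₁, hf₂]
  have hlin : ∀ n m : ℤ, linHom hG (ι' ^ n * τ ^ m) = (.ofAdd (n : ZMod 2), k ^ m) := by
    intro n m
    rw [map_mul, map_zpow, map_zpow, hlι, hlτ]
    refine Prod.ext ?_ ?_
    · change (Multiplicative.ofAdd (1 : ZMod 2)) ^ n * 1 ^ m = _
      rw [one_zpow, mul_one, ← ofAdd_zsmul, zsmul_one]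
    · simp only [Prod.snd_mul, Prod.pow_snd, one_zpow, one_mul]
  obtain ⟨φ, hφ, he⟩ := exists_mulEquiv_semidirect (transHom hall 1) h (transHom_injective hall 1)
    (fun q n => conj_transHom hG hall 1 _ _)
    (fun q n hqn => by
      obtain ⟨q₁, q₂⟩ := q
      obtain ⟨i, rfl⟩ := Cyc.exists_eq_gen_zpow q₁
      obtain ⟨j, rfl⟩ := Cyc.exists_eq_gen_zpow q₂
      have := congrArg (linHom hG) hqn
      rw [hh', linHom_transHom, hlin] at this
      refine Prod.ext (Cyc.gen_zpow_eq_one ?_) (Cyc.gen_zpow_eq_one ?_)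
      · exact (ZMod.intCast_zmod_eq_zero_iff_dvd i 2).1 (congrArg Prod.fst this)
      · exact orderOf_dvd_iff_zpow_eq_one.2 (congrArg Prod.snd this))
    (fun g => by
      obtain ⟨n, hn⟩ := hgen g
      obtain ⟨i, hi⟩ := ZMod.intCast_surjective (linHom hG g).1.toAdd
      obtain ⟨a, ha⟩ := exists_transHom_eq hG hall 1 (g := g * (ι' ^ i * τ ^ n)⁻¹) (by
        have h2 : linHom hG g = linHom hG (ι' ^ i * τ ^ n) := by
          rw [hlin, hi, ← hn]; rfl
        rw [map_mul, map_inv, h2, mul_inv_cancel])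
      exact ⟨a, (Cyc.gen _ ^ i, Cyc.gen _ ^ n), by rw [ha, hh', inv_mul_cancel_right]⟩)
  refine Or.inr (Or.inl ⟨orderOf k, (k : ZMod p).val, heven, orderOf_unit_dvd _,
    by rw [natCast_val_units, orderOf_units], φ, fun x y => ?_, fun x y => ?_, he⟩)
  · apply transHom_injective hall 1
    have h1 := hh' 1 0
    rw [zpow_one, zpow_one, zpow_zero, zpow_zero, mul_one] at h1
    rw [hφ, h1]
    apply Subtype.ext
    refine (conj_transPerm_linHom hG ι' _).trans ?_
    rw [hlι, coe_transHom]
    congr 1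
    ext i
    rcases ZMod.two_cases i with rfl | rfl
    · simp [lineVec]
    · simp [lineVec, CharTwo.add_self_eq_zero]
  · apply transHom_injective hall 1
    have h1 := hh' 0 1
    rw [zpow_one, zpow_one, zpow_zero, zpow_zero, one_mul] at h1
    rw [hφ, h1]
    apply Subtype.ext
    refine (conj_transPerm_linHom hG τ _).trans ?_
    rw [hlτ, coe_transHom]
    congr 1
    ext i
    rcases ZMod.two_cases i with rfl | rfl <;> simp [lineVec]

/-- Only constant translations, and a linear part without the exchange of the lines. -/
theorem explicit_of_not_flip_of_const (hp2 : p ≠ 2) (hG : G ≤ affineGroup p)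
    (h1 : ∀ x : ZMod p, transPerm (fun _ => x) ∈ G)
    (hconst : ∀ s : ZMod 2 → ZMod p, transPerm s ∈ G → s 1 = s 0) {g₀ : G}
    (hgen : ∀ g, ∃ n : ℤ, (linHom hG g).2 = (linHom hG g₀).2 ^ n)
    (hker : ∀ g, (linHom hG g).2 = 1 → linHom hG g = 1)
    (heven : Even (orderOf (linHom hG g₀).2)) : IsOfListedShapeExplicit p G := by
  obtain ⟨τ, hτ, hτ1⟩ := exists_lift_linHom hp2 hG g₀
  set k := (linHom hG g₀).2 with hk
  -- Slope 1 forces a trivial linear part, so the lift τ has the order of its slope k.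
  have hpow : ∀ n : ℤ, k ^ n = 1 → linHom hG g₀ ^ n = 1 := by
    intro n hn
    rw [← map_zpow]
    apply hker
    rw [map_zpow, Prod.pow_snd]
    exact hn
  obtain ⟨h, hh⟩ := Cyc.exists_hom (orderOf k) (g := τ) (by
    rw [← zpow_natCast]
    exact hτ1 _ (hpow _ (by rw [zpow_natCast, pow_orderOf_eq_one])))
  have hlin : ∀ n : ℤ, linHom hG (τ ^ n) = linHom hG g₀ ^ n := fun n => by rw [map_zpow, hτ]
  obtain ⟨φ, hφ, he⟩ := exists_mulEquiv_semidirect (diagHom h1) h (diagHom_injective h1)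
    (fun q n => ⟨_, (conj_diagHom hG h1 _ _).symm⟩)
    (fun q n hqn => by
      obtain ⟨i, rfl⟩ := Cyc.exists_eq_gen_zpow q
      have := congrArg (linHom hG) hqn
      rw [hh, linHom_diagHom, hlin] at this
      exact Cyc.gen_zpow_eq_one (orderOf_dvd_iff_zpow_eq_one.2 (congrArg Prod.snd this)))
    (fun g => by
      obtain ⟨n, hn⟩ := hgen g
      obtain ⟨a, ha⟩ := exists_diagHom_eq hG h1 hconst (g := g * (τ ^ n)⁻¹) (by
        apply hker
        rw [map_mul, map_inv, hlin, Prod.snd_mul, hn, Prod.snd_inv, Prod.pow_snd, mul_inv_cancel])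
      exact ⟨a, Cyc.gen _ ^ n, by rw [ha, hh, inv_mul_cancel_right]⟩)
  refine Or.inr (Or.inr (Or.inr ⟨orderOf k, heven, orderOf_unit_dvd _, φ, ?_, he⟩))
  rw [injective_iff_map_eq_one]
  intro q hq
  obtain ⟨i, rfl⟩ := Cyc.exists_eq_gen_zpow q
  have h2 := hφ (Cyc.gen _ ^ i) (.ofAdd 1)
  rw [hq, hh, conj_diagHom hG h1, hlin] at h2
  have h3 := diagHom_injective h1 h2
  have h4 : ((k ^ i : (ZMod p)ˣ) : ZMod p) * 1 = 1 := (congrArg Multiplicative.toAdd h3).symm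
  rw [mul_one] at h4
  exact Cyc.gen_zpow_eq_one (orderOf_dvd_iff_zpow_eq_one.2 (Units.ext h4))

/-- Only constant translations, and a linear part that contains the exchange of the lines. -/
theorem explicit_of_flip_of_const (hp2 : p ≠ 2) (hG : G ≤ affineGroup p)
    (h1 : ∀ x : ZMod p, transPerm (fun _ => x) ∈ G)
    (hconst : ∀ s : ZMod 2 → ZMod p, transPerm s ∈ G → s 1 = s 0) {g₁ g₀ : G} {k : (ZMod p)ˣ}
    (hg₁ : linHom hG g₁ = (.ofAdd 1, 1)) (hg₀ : linHom hG g₀ = (1, k))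
    (hgen : ∀ g, ∃ n : ℤ, (linHom hG g).2 = k ^ n) : IsOfListedShapeExplicit p G := by
  have hodd := (Fact.out : p.Prime).odd_of_ne_two hp2
  obtain ⟨τ, hτ, hτ1⟩ := exists_lift_linHom hp2 hG g₀
  obtain ⟨ι, hι, hι1⟩ := exists_lift_linHom hp2 hG g₁
  rw [hg₀] at hτ hτ1
  rw [hg₁] at hι hι1
  have hι2 : ι ^ 2 = 1 := by
    have := hι1 2 (Prod.ext (show (Multiplicative.ofAdd (1 : ZMod 2)) ^ (2 : ℤ) = 1 by decide) (one_zpow 2))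
    exact_mod_cast this
  set r : G := diagHom h1 (.ofAdd 1) with hr
  have hrp : r ^ p = 1 := by
    rw [hr, ← map_pow, Cyc.pow_eq_one dvd_rfl, map_one]
  have hr1 : r ≠ 1 := by
    rw [hr, ← map_one (diagHom h1)]
    intro h
    have := diagHom_injective h1 h
    exact one_ne_zero (α := ZMod p) (congrArg Multiplicative.toAdd this)
  have hrι : Commute ι r := by
    have := conj_diagHom hG h1 ι (.ofAdd 1)
    rw [hι] at this
    simp only [toAdd_ofAdd, Units.val_one, mul_one] at this
    exact mul_inv_eq_iff_eq_mul.1 this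
  have hι1' : ι ≠ 1 := by
    rintro h
    rw [h, map_one] at hι
    exact absurd (congrArg (fun a => a.1.toAdd) hι) (zero_ne_one (α := ZMod 2))
  -- The exchange ι of slope 1 has order 2 and commutes with the constant translation r of order p;
  -- their product generates the factor C_{2p}.
  have hz : orderOf (ι * r) = 2 * p := by
    rw [hrι.orderOf_mul_eq_mul_orderOf_of_coprime]
    · rw [orderOf_eq_prime hι2 hι1', orderOf_eq_prime hrp hr1]
    · rw [orderOf_eq_prime hι2 hι1', orderOf_eq_prime hrp hr1]
      exact (Nat.coprime_two_left).2 hodd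
  obtain ⟨f, hf⟩ := Cyc.exists_hom (2 * p) (g := ι * r) (by rw [← hz, pow_orderOf_eq_one])
  have hfinj : Function.Injective f := by
    rw [injective_iff_map_eq_one]
    intro a ha
    obtain ⟨n, rfl⟩ := Cyc.exists_eq_gen_zpow a
    rw [hf] at ha
    refine Cyc.gen_zpow_eq_one ?_
    rw [← hz]
    exact orderOf_dvd_iff_zpow_eq_one.2 ha
  have hlf : ∀ a, (linHom hG (f a)).2 = 1 := by
    intro a
    obtain ⟨n, rfl⟩ := Cyc.exists_eq_gen_zpow a
    rw [hf, map_zpow, map_mul, hι, hr, linHom_diagHom, mul_one, Prod.pow_snd, one_zpow]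
  have hιf : ι ∈ f.range := by
    refine ⟨Cyc.gen _ ^ (p : ℤ), ?_⟩
    rw [hf, zpow_natCast, hrι.mul_pow, hrp, mul_one]
    obtain ⟨m, hm⟩ := hodd
    have : ι ^ (2 * m + 1) = ι := by rw [pow_succ, pow_mul, hι2, one_pow, one_mul]
    rwa [← hm] at this
  have hrf : r ∈ f.range := by
    have h2 : ι * r ∈ f.range := ⟨Cyc.gen _ ^ (1 : ℤ), by rw [hf, zpow_one]⟩
    have := f.range.mul_mem (f.range.inv_mem hιf) h2
    rwa [inv_mul_cancel_left] at this
  have hdiag : ∀ a, diagHom h1 a ∈ f.range := by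
    intro a
    obtain ⟨n, rfl⟩ := Cyc.exists_eq_gen_zpow a
    rw [map_zpow]
    exact f.range.zpow_mem hrf n
  -- The cyclic group of order 2p is the whole kernel of the slope, hence normal.
  have hslope : ∀ g, (linHom hG g).2 = 1 → g ∈ f.range := by
    intro g hg
    rcases ZMod.two_cases (linHom hG g).1.toAdd with h | h
    · obtain ⟨a, rfl⟩ := exists_diagHom_eq hG h1 hconst (g := g) (Prod.ext h hg)
      exact hdiag a
    · obtain ⟨a, ha⟩ := exists_diagHom_eq hG h1 hconst (g := ι⁻¹ * g) (by
        have : linHom hG g = linHom hG ι := by rw [hι]; exact Prod.ext h hg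
        rw [map_mul, map_inv, this, inv_mul_cancel])
      have := f.range.mul_mem hιf (hdiag a)
      rwa [ha, mul_inv_cancel_left] at this
  obtain ⟨h, hh⟩ := Cyc.exists_hom (orderOf k) (g := τ) (by
    rw [← zpow_natCast]
    refine hτ1 _ (Prod.ext ?_ ?_)
    · rw [Prod.pow_fst, one_zpow]; rfl
    · rw [Prod.pow_snd, zpow_natCast, pow_orderOf_eq_one]; rfl)
  have hlin : ∀ n : ℤ, (linHom hG (τ ^ n)).2 = k ^ n := fun n => by
    rw [map_zpow, hτ, Prod.pow_snd]
  obtain ⟨φ, hφ, he⟩ := exists_mulEquiv_semidirect f h hfinj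
    (fun q n => hslope _ (by
      rw [map_mul, map_mul, map_inv, Prod.snd_mul, Prod.snd_mul, Prod.snd_inv, hlf, mul_one,
        mul_inv_cancel]))
    (fun q n hqn => by
      obtain ⟨i, rfl⟩ := Cyc.exists_eq_gen_zpow q
      have := congrArg (fun g => (linHom hG g).2) hqn
      simp only [hh, hlf, hlin] at this
      exact Cyc.gen_zpow_eq_one (orderOf_dvd_iff_zpow_eq_one.2 this))
    (fun g => by
      obtain ⟨n, hn⟩ := hgen g
      obtain ⟨a, ha⟩ := hslope (g * (τ ^ n)⁻¹) (by
        rw [map_mul, map_inv, Prod.snd_mul, hn, Prod.snd_inv, hlin, mul_inv_cancel])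
      exact ⟨a, Cyc.gen _ ^ n, by rw [ha, hh, inv_mul_cancel_right]⟩)
  refine Or.inr (Or.inr (Or.inl ⟨orderOf k, orderOf_unit_dvd _, φ, ?_, he⟩))
  rw [injective_iff_map_eq_one]
  intro q hq
  obtain ⟨i, rfl⟩ := Cyc.exists_eq_gen_zpow q
  obtain ⟨a, ha⟩ := hrf
  have h2 := hφ (Cyc.gen _ ^ i) a
  rw [hq, hh, MulAut.one_apply, ha, hr, conj_diagHom hG h1, hlin] at h2
  have h3 := diagHom_injective h1 h2
  have h4 : ((k ^ i : (ZMod p)ˣ) : ZMod p) * 1 = 1 := (congrArg Multiplicative.toAdd h3).symm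
  rw [mul_one] at h4
  exact Cyc.gen_zpow_eq_one (orderOf_dvd_iff_zpow_eq_one.2 (Units.ext h4))

/-- The structure of the transitive groups of affine permutations that contain the translation
by `1`. -/
theorem explicit_of_le_affineGroup (hp2 : p ≠ 2) (hG : G ≤ affineGroup p)
    (htr : ∀ y y', ∃ g ∈ G, g y = y') (hone : transPerm 1 ∈ G) : IsOfListedShapeExplicit p G := by
  have h1 : ∀ x : ZMod p, transPerm (fun _ => x) ∈ G := by
    intro x
    have := G.pow_mem hone x.val
    rw [← transPerm_eq_pow] at this
    convert this using 2
    ext i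
    simp
  obtain ⟨s₀, hs₀⟩ := exists_linHom_fst hG htr
  obtain ⟨⟨_, g₀, rfl⟩, hg₀⟩ :=
    IsCyclic.exists_generator (α := ((MonoidHom.snd _ _).comp (linHom hG)).range)
  have hgen : ∀ g, ∃ n : ℤ, (linHom hG g).2 = (linHom hG g₀).2 ^ n := by
    intro g
    obtain ⟨n, hn⟩ := hg₀ ⟨_, g, rfl⟩
    exact ⟨n, (congrArg Subtype.val hn).symm⟩
  set k := (linHom hG g₀).2 with hk
  -- The translations in G form a subspace of F_p² containing (1, 1), so either the diagonal or
  -- everything.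
  have hconst : (∀ s, transPerm s ∈ G) ∨ ∀ s : ZMod 2 → ZMod p, transPerm s ∈ G → s 1 = s 0 := by
    by_contra! h
    obtain ⟨⟨u, hu⟩, s, hs, hs1⟩ := h
    apply hu
    have h2 := G.mul_mem (h1 (u 0 - (u 1 - u 0) / (s 1 - s 0) * s 0))
      (G.pow_mem hs ((u 1 - u 0) / (s 1 - s 0)).val)
    rw [← transPerm_eq_pow, transPerm_mul] at h2
    convert h2 using 2
    have h3 : s 1 - s 0 ≠ 0 := sub_ne_zero.2 hs1
    ext i
    rcases ZMod.two_cases i with rfl | rfl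
    · simp
    · simp
      field_simp
      ring
  by_cases hflip : ∃ ι, linHom hG ι = (.ofAdd 1, 1)
  · obtain ⟨ι, hι⟩ := hflip
    obtain ⟨g₂, hg₂⟩ : ∃ g, linHom hG g = (1, k) := by
      rcases ZMod.two_cases (linHom hG g₀).1.toAdd with h | h
      · exact ⟨g₀, Prod.ext h rfl⟩
      · refine ⟨g₀ * ι, ?_⟩
        rw [map_mul, hι]
        refine Prod.ext ?_ (mul_one _)
        change Multiplicative.ofAdd ((linHom hG g₀).1.toAdd + 1) = 1
        rw [h]
        decide
    rcases hconst with hall | hconst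
    · by_cases heven : Even (orderOf k)
      · exact explicit_of_flip_of_all hG hall hι hg₂ hgen heven
      -- For odd m the group C_2 × C_m is cyclic, generated by (1, k), so the shape is (i) rather
      -- than (ii). The sign c = -1 supplies the multiplier -k, of even order 2m.
      · have hodd : Odd (orderOf k) := Nat.not_even_iff_odd.1 heven
        have hm1 : orderOf (-1 : (ZMod p)ˣ) = 2 := by
          refine orderOf_eq_prime (by simp) fun h => ?_
          have : Fact (2 < p) :=
            ⟨lt_of_le_of_ne (Fact.out : p.Prime).two_le (Ne.symm hp2)⟩
          exact ZMod.neg_one_ne_one (n := p) (congrArg Units.val h)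
        have hg₃ : linHom hG (ι * g₂) = (.ofAdd 1, k) := by
          rw [map_mul, hι, hg₂]
          exact Prod.ext (mul_one _) (one_mul _)
        refine explicit_of_cyclic_linHom hp2 hG hall hg₃ (fun g => ?_) (c := -1)
          (by rw [neg_mul_neg, one_mul]) ?_
        · obtain ⟨n, hn⟩ := hgen g
          have hkm : ∀ m : ℤ, k ^ (m * orderOf k) = 1 := fun m => by
            rw [mul_comm, zpow_mul, zpow_natCast, pow_orderOf_eq_one, one_zpow]
          obtain ⟨a, ha⟩ := ZMod.intCast_surjective (linHom hG g).1.toAdd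
          -- This exponent is a modulo 2, as the order of k is odd, and n modulo that order.
          refine ⟨n + (a - n) * orderOf k, ?_⟩
          rw [hg₃]
          refine Prod.ext ?_ ?_
          · rw [Prod.pow_fst]
            change (linHom hG g).1 = (Multiplicative.ofAdd (1 : ZMod 2)) ^ _
            rw [← ofAdd_zsmul, zsmul_one]
            push_cast
            rw [ha, ZMod.natCast_eq_one_iff_odd.2 hodd, mul_one, add_sub_cancel]
            rfl
          · rw [Prod.pow_snd, zpow_add, hkm, mul_one, hn]
        · rw [(Commute.all _ _).orderOf_mul_eq_mul_orderOf_of_coprime, hm1]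
          · exact even_two_mul _
          · rw [hm1]
            exact Nat.coprime_two_left.2 hodd
    · exact explicit_of_flip_of_const hp2 hG h1 hconst hι hg₂ hgen
  · have hker : ∀ g, (linHom hG g).2 = 1 → linHom hG g = 1 := by
      intro g hg
      rcases ZMod.two_cases (linHom hG g).1.toAdd with h | h
      · exact Prod.ext h hg
      · exact absurd ⟨g, Prod.ext h hg⟩ hflip
    have hgen' : ∀ g, ∃ n : ℤ, linHom hG g = linHom hG g₀ ^ n := by
      intro g
      obtain ⟨n, hn⟩ := hgen g
      refine ⟨n, ?_⟩
      have := hker (g * (g₀ ^ n)⁻¹) (by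
        rw [map_mul, map_inv, map_zpow, Prod.snd_mul, hn, Prod.snd_inv, Prod.pow_snd,
          mul_inv_cancel])
      rw [map_mul, map_inv, map_zpow, mul_inv_eq_one] at this
      exact this
    have hg₀1 : linHom hG g₀ = (.ofAdd 1, k) := by
      refine Prod.ext ?_ rfl
      rcases ZMod.two_cases (linHom hG g₀).1.toAdd with h | h
      · obtain ⟨n, hn⟩ := hgen' s₀
        have h2 := congrArg Prod.fst hn
        rw [hs₀, Prod.pow_fst, show (linHom hG g₀).1 = 1 from h, one_zpow] at h2
        exact absurd (congrArg Multiplicative.toAdd h2) one_ne_zero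
      · exact h
    -- Raised to the order of its slope, g₀ gets slope 1 and so preserves the lines, although g₀
    -- itself exchanges them.
    have heven : Even (orderOf k) := by
      have h2 := hker (g₀ ^ orderOf k) (by
        rw [map_pow, Prod.pow_snd, ← hk, pow_orderOf_eq_one])
      rw [map_pow, hg₀1] at h2
      have h3 : (Multiplicative.ofAdd (1 : ZMod 2)) ^ orderOf k = 1 := congrArg Prod.fst h2
      rw [← ofAdd_nsmul, nsmul_one, ofAdd_eq_one] at h3
      exact ZMod.natCast_eq_zero_iff_even.1 h3
    rcases hconst with hall | hconst
    · exact explicit_of_cyclic_linHom hp2 hG hall hg₀1 hgen' (one_mul 1) (by rwa [one_mul])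
    · exact explicit_of_not_flip_of_const hp2 hG h1 hconst hgen hker heven

end AffineSubgroups

section Classification

variable {p : ℕ} [Fact p.Prime] {X : Type*}

theorem explicit_of_normalizesFree_mem (hp2 : p ≠ 2) [Finite X] (hX : Nat.card X = 2 * p)
    {G : Subgroup (Perm X)} (htr : ∀ x x', ∃ g ∈ G, g x = x') {r : Perm X} (hr : r ^ p = 1)
    (hfree : ∀ x, r x ≠ x) (hnorm : ∀ g ∈ G, ∃ k : ℕ, g * r * g⁻¹ = r ^ k) (hrG : r ∈ G) :
    IsOfListedShapeExplicit p G := by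
  obtain ⟨e, he⟩ := exists_equiv_transPerm hX hr hfree
  refine (explicit_of_le_affineGroup hp2 ?_ (transitive_map_permCongr htr e)
    ⟨r, hrG, he⟩).of_mulEquiv (G.equivMapOfInjective _ e.permCongrHom.injective)
  rintro _ ⟨g, hg, rfl⟩
  obtain ⟨k, hk⟩ := hnorm g hg
  apply mem_affineGroup_of_conj (k := k)
  rw [← he, ← map_pow, ← hk]
  simp only [map_mul, map_inv]
  rfl

/-- If the translation by 1 is not in G, a free translation t in G spans a line stable under
conjugation: an independent conjugate would generate all translations together with t. Coordinates
adapted to t then reduce to the case where the translation by 1 is in G. -/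
theorem explicit_of_affine (hp2 : p ≠ 2) {G : Subgroup (Perm (ZMod 2 × ZMod p))}
    (hG : G ≤ affineGroup p) (htr : ∀ y y', ∃ g ∈ G, g y = y') : IsOfListedShapeExplicit p G := by
  by_cases hone : transPerm 1 ∈ G
  · exact explicit_of_le_affineGroup hp2 hG htr hone
  obtain ⟨t, ht, htG⟩ := exists_transPerm_mem hp2 hG htr
  refine explicit_of_normalizesFree_mem hp2
    (by rw [Nat.card_prod, Nat.card_zmod, Nat.card_zmod]) htr (transPerm_pow_prime t)
    (fun y hy => ht y.1 (by simpa using congrArg Prod.snd hy)) (fun g hg => ?_) htG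
  obtain ⟨j, k, b, rfl⟩ := hG hg
  have hmem := G.mul_mem (G.mul_mem hg htG) (G.inv_mem hg)
  rw [affPerm_conj_transPerm] at hmem ⊢
  set s : ZMod 2 → ZMod p := fun i => k * t (i + j) with hs
  have hD : s 0 * t 1 - s 1 * t 0 = 0 := by
    by_contra hD
    apply hone
    -- Cramer's rule for (1, 1) as a combination of s and t.
    have h2 := G.mul_mem (G.pow_mem hmem ((t 1 - t 0) / (s 0 * t 1 - s 1 * t 0)).val)
      (G.pow_mem htG ((s 0 - s 1) / (s 0 * t 1 - s 1 * t 0)).val)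
    rw [← transPerm_eq_pow, ← transPerm_eq_pow, transPerm_mul] at h2
    convert h2 using 2
    ext i
    rcases ZMod.two_cases i with rfl | rfl
    · simp only [Pi.one_apply, Pi.add_apply, Pi.smul_apply, smul_eq_mul]
      rw [div_mul_eq_mul_div, div_mul_eq_mul_div, ← add_div, eq_div_iff hD]
      ring
    · simp only [Pi.one_apply, Pi.add_apply, Pi.smul_apply, smul_eq_mul]
      rw [div_mul_eq_mul_div, div_mul_eq_mul_div, ← add_div, eq_div_iff hD]
      ring
  refine ⟨(s 0 / t 0).val, ?_⟩
  rw [← transPerm_eq_pow]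
  congr 1
  ext i
  have ht0 := ht 0
  rcases ZMod.two_cases i with rfl | rfl
  · simp only [Pi.smul_apply, smul_eq_mul]
    rw [div_mul_cancel₀ _ ht0]
  · simp only [Pi.smul_apply, smul_eq_mul]
    rw [div_mul_eq_mul_div, eq_div_iff ht0]
    linear_combination -hD

theorem NormalizesFree.isOfListedShapeExplicit (hp2 : p ≠ 2) [Finite X] (hX : Nat.card X = 2 * p)
    {G : Subgroup (Perm X)} (h : NormalizesFree p G) (htr : ∀ x x', ∃ g ∈ G, g x = x') :
    IsOfListedShapeExplicit p G := by
  obtain ⟨e, he⟩ := h.exists_equiv hX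
  exact (explicit_of_affine hp2 he (transitive_map_permCongr htr e)).of_mulEquiv
    (G.equivMapOfInjective _ e.permCongrHom.injective)

end Classification

/-! ### Embeddings into the normal closure: independence and descent -/

section Embeddings

variable {K : Type u} {L : Type v} {M : Type w} [Field K] [Field L] [Field M]
  [Algebra K L] [Algebra K M]

/-- The Galois group acting on the embeddings of `L` into its normal closure. -/
def galPerm (K : Type u) (L : Type v) (M : Type w) [Field K] [Field L] [Field M]
    [Algebra K L] [Algebra K M] : (M ≃ₐ[K] M) →* Perm (L →ₐ[K] M) where
  toFun σ :=
    { toFun x := σ.toAlgHom.comp x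
      invFun x := σ.symm.toAlgHom.comp x
      left_inv x := by ext l; simp
      right_inv x := by ext l; simp }
  map_one' := by ext x l; rfl
  map_mul' σ τ := by ext x l; rfl

@[simp] theorem galPerm_apply (σ : M ≃ₐ[K] M) (x : L →ₐ[K] M) (l : L) :
    galPerm K L M σ x l = σ (x l) := rfl

variable [FiniteDimensional K L] [Algebra.IsSeparable K L] [hcl : IsNormalClosure K L M]

include hcl in
theorem card_embeddings : Nat.card (L →ₐ[K] M) = Module.finrank K L :=
  AlgHom.natCard_of_splits K L M hcl.splits

omit [FiniteDimensional K L] in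
include hcl in
theorem normalClosure_eq_top : IntermediateField.normalClosure K L M = ⊤ :=
  (Algebra.IsAlgebraic.isNormalClosure_iff.1 hcl).2

variable (K L M) in
include hcl in
theorem finiteDimensional_of_isNormalClosure : FiniteDimensional K M := by
  have h : FiniteDimensional K (IntermediateField.normalClosure K L M) := inferInstance
  rw [normalClosure_eq_top] at h
  exact IntermediateField.topEquiv.toLinearEquiv.finiteDimensional

variable (K L M) in
omit [FiniteDimensional K L] in
include hcl in
theorem isGalois_of_isNormalClosure : IsGalois K M := by
  have h1 : Normal K M := hcl.normal
  have h2 : ∀ f : L →ₐ[K] M, Algebra.IsSeparable K f.fieldRange := fun f =>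
    Algebra.IsSeparable.of_algHom K L (AlgEquiv.ofInjectiveField f).symm.toAlgHom
  have h3 : Algebra.IsSeparable K (IntermediateField.normalClosure K L M) :=
    IntermediateField.isSeparable_iSup _ _ (h := h2)
  rw [normalClosure_eq_top] at h3
  have h4 : Algebra.IsSeparable K M :=
    Algebra.IsSeparable.of_algHom K _ IntermediateField.topEquiv.symm.toAlgHom
  exact ⟨⟩

include hcl in
theorem nonempty_embeddings : Nonempty (L →ₐ[K] M) :=
  (Nat.card_pos_iff.1 (by rw [card_embeddings]; exact Module.finrank_pos)).1

omit [FiniteDimensional K L] [Algebra.IsSeparable K L] in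
include hcl in
theorem exists_galPerm_eq (x y : L →ₐ[K] M) : ∃ σ, galPerm K L M σ x = y := by
  have : Normal K M := hcl.normal
  let χ : x.fieldRange ≃ₐ[K] y.fieldRange :=
    (AlgEquiv.ofInjectiveField x).symm.trans (AlgEquiv.ofInjectiveField y)
  refine ⟨χ.liftNormal M, ?_⟩
  ext l
  have h := χ.liftNormal_commutes M (AlgEquiv.ofInjectiveField x l)
  have h1 : χ (AlgEquiv.ofInjectiveField x l) = AlgEquiv.ofInjectiveField y l := by
    change AlgEquiv.ofInjectiveField y ((AlgEquiv.ofInjectiveField x).symm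
      (AlgEquiv.ofInjectiveField x l)) = _
    rw [AlgEquiv.symm_apply_apply]
  rw [h1] at h
  exact h

omit [FiniteDimensional K L] in
include hcl in
-- An automorphism acting trivially on the embeddings fixes all their images, and these generate M.
theorem galPerm_injective : Function.Injective (galPerm K L M) := by
  rw [injective_iff_map_eq_one]
  intro σ hσ
  have h1 : IntermediateField.normalClosure K L M ≤
      IntermediateField.fixedField (Subgroup.zpowers σ) := by
    rw [normalClosure_le_iff]
    rintro f _ ⟨l, rfl⟩
    rintro ⟨τ, hτ⟩
    obtain ⟨n, rfl⟩ := hτ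
    change (σ ^ n) (f l) = f l
    rw [← galPerm_apply, map_zpow, hσ, one_zpow]
    rfl
  rw [normalClosure_eq_top] at h1
  ext m
  exact h1 (IntermediateField.mem_top (x := m)) ⟨σ, Subgroup.mem_zpowers σ⟩

include hcl in
/-- Galois descent for `M ⊗ L = M ^ X`: the equivariant functions come from `L`. -/
theorem exists_of_equivariant (f : (L →ₐ[K] M) → M)
    (hf : ∀ σ x, f (galPerm K L M σ x) = σ (f x)) : ∃ l, ∀ x : L →ₐ[K] M, x l = f x := by
  have := isGalois_of_isNormalClosure K L M
  have := finiteDimensional_of_isNormalClosure K L M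
  obtain ⟨x₀⟩ := nonempty_embeddings (K := K) (L := L) (M := M)
  -- Automorphisms over x₀(L) fix the point x₀ of X, so they fix `f x₀`, which therefore lies in
  -- x₀(L).
  have h1 : f x₀ ∈ IntermediateField.fixedField (x₀.fieldRange.fixingSubgroup) := by
    rintro ⟨σ, hσ⟩
    change σ (f x₀) = f x₀
    rw [← hf]
    congr 1
    ext l
    exact hσ ⟨x₀ l, l, rfl⟩
  rw [IsGalois.fixedField_fixingSubgroup] at h1
  obtain ⟨l, hl⟩ := h1
  refine ⟨l, fun x => ?_⟩
  obtain ⟨σ, rfl⟩ := exists_galPerm_eq x₀ x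
  rw [hf, galPerm_apply]
  exact congrArg σ hl

variable (K L M) in
include hcl in
-- Dedekind independence, and as many embeddings as the dimension.
theorem span_embeddings :
    Submodule.span M (Set.range (AlgHom.toLinearMap : (L →ₐ[K] M) → L →ₗ[K] M)) = ⊤ := by
  have : Fintype (L →ₐ[K] M) := Fintype.ofFinite _
  refine (linearIndependent_toLinearMap K L M).span_eq_top_of_card_eq_finrank' ?_
  rw [← Nat.card_eq_fintype_card, card_embeddings, Module.finrank_linearMap_self]

variable (K L M) in
/-- The embeddings as a basis of the space of `K`-linear maps `L → M`. -/
noncomputable def embBasis : Module.Basis (L →ₐ[K] M) M (L →ₗ[K] M) :=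
  Module.Basis.mk (linearIndependent_toLinearMap K L M) (span_embeddings K L M).ge

theorem embBasis_apply (x : L →ₐ[K] M) : embBasis K L M x = x.toLinearMap := by
  simp [embBasis]

variable (K L M) in
/-- The map `M ⊗ L → M`, `m ⊗ l ↦ m x(l)`. -/
noncomputable def tensorEval (x : L →ₐ[K] M) : M ⊗[K] L →ₗ[M] M :=
  LinearMap.liftBaseChange M x.toLinearMap

omit [FiniteDimensional K L] [Algebra.IsSeparable K L] hcl in
@[simp] theorem tensorEval_tmul (x : L →ₐ[K] M) (m : M) (l : L) :
    tensorEval K L M x (m ⊗ₜ l) = m * x l := by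
  simp [tensorEval]

include hcl in
-- The coordinate functionals of a basis of L, taken with values in M, are combinations of
-- embeddings; so the coordinates of t vanish.
theorem eq_zero_of_tensorEval {t : M ⊗[K] L} (h : ∀ x, tensorEval K L M x t = 0) : t = 0 := by
  let b := Module.finBasis K L
  obtain ⟨c, rfl⟩ := TensorProduct.eq_repr_basis_right b t
  let F : (L →ₗ[K] M) →ₗ[M] M := c.sum fun i m => m • LinearMap.applyₗ' M (b i)
  have hF : ∀ f, F f = c.sum fun i m => m * f (b i) := by
    intro f
    simp [F, Finsupp.sum, LinearMap.sum_apply]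
  have hF0 : F = 0 := by
    apply (embBasis K L M).ext
    intro x
    rw [embBasis_apply, hF, LinearMap.zero_apply, ← h x, Finsupp.sum, Finsupp.sum, map_sum]
    simp
  have hc : c = 0 := by
    ext i
    have := hF ((Algebra.linearMap K M) ∘ₗ b.coord i)
    rw [hF0, LinearMap.zero_apply, Finsupp.sum] at this
    simp only [LinearMap.comp_apply, Module.Basis.coord_apply, Module.Basis.repr_self,
      Algebra.linearMap_apply] at this
    rw [Finset.sum_eq_single i] at this
    · simpa using this.symm
    · intro j _ hj
      simp [hj]
    · intro hi
      simp [Finsupp.notMem_support_iff.1 hi]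
  rw [hc, Finsupp.sum_zero_index]

end Embeddings

/-! ### Base change of an action along an embedding -/

section Pairing

variable {F E U V : Type*} [Field F] [CommRing E] [Algebra F E] [AddCommGroup U] [Module F U]
  [AddCommGroup V] [Module F V] {I J : Type*}

/-- If functionals separate the points of `U`, and of `E ⊗ V`, then their products separate the
points of `U ⊗ V`. -/
theorem eq_zero_of_pairing (φ : I → U →ₗ[F] E) (ψ : J → V →ₗ[F] E)
    (hφ : ∀ u, (∀ i, φ i u = 0) → u = 0)
    (hψ : ∀ w : E ⊗[F] V, (∀ j, (ψ j).liftBaseChange E w = 0) → w = 0) {t : U ⊗[F] V}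
    (ht : ∀ i j, LinearMap.mul' F E (TensorProduct.map (φ i) (ψ j) t) = 0) : t = 0 := by
  let b := Module.Free.chooseBasis F V
  obtain ⟨c, rfl⟩ := TensorProduct.eq_repr_basis_right b t
  have hc : c = 0 := by
    ext k
    refine hφ _ fun i => ?_
    have h1 : (c.mapRange (φ i) (map_zero _)).sum (fun k e => e ⊗ₜ[F] b k) = 0 := by
      refine hψ _ fun j => ?_
      rw [Finsupp.sum_mapRange_index (by simp), Finsupp.sum, map_sum, ← ht i j, Finsupp.sum,
        map_sum, map_sum]
      simp
    have h2 := TensorProduct.sum_tmul_basis_right_eq_zero b _ h1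
    exact DFunLike.congr_fun h2 k
  rw [hc, Finsupp.sum_zero_index]

end Pairing

section EvalAt

variable {K : Type u} {L : Type v} {M : Type w} [Field K] [Field L] [Field M]
  [Algebra K L] [Algebra K M] {A : Type*} [Ring A] [Algebra K A] (μ : A →ₐ[K] Module.End K L)

/-- The base change of an action on `L` composed with an embedding: `m ⊗ h` becomes
`l ↦ m x(h • l)`. -/
noncomputable def evalAt (x : L →ₐ[K] M) : M ⊗[K] A →ₗ[M] (L →ₗ[K] M) :=
  LinearMap.liftBaseChange M (LinearMap.llcomp K L L M x.toLinearMap ∘ₗ μ.toLinearMap)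

@[simp] theorem evalAt_tmul (x : L →ₐ[K] M) (m : M) (h : A) (l : L) :
    evalAt μ x (m ⊗ₜ h) l = m * x (μ h l) := by
  simp [evalAt]

theorem evalAt_apply (x : L →ₐ[K] M) (g : M ⊗[K] A) (l : L) :
    evalAt μ x g l = (x.toLinearMap ∘ₗ μ.toLinearMap.flip l).liftBaseChange M g := by
  induction g with
  | zero => simp
  | tmul m h => simp
  | add a b ha hb => simp only [map_add, LinearMap.add_apply, ha, hb]

theorem evalAt_mul_tmul (x : L →ₐ[K] M) (g : M ⊗[K] A) (m : M) (h : A) (l : L) :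
    evalAt μ x (g * (m ⊗ₜ h)) l = m * evalAt μ x g (μ h l) := by
  induction g with
  | zero => simp
  | tmul m' h' => simp; ring
  | add a b ha hb => simp only [add_mul, map_add, LinearMap.add_apply, ha, hb, mul_add]

/-- Products act on embeddings in reversed order, which is why `permHom` inverts its argument. -/
theorem evalAt_mul {x y : L →ₐ[K] M} {g : M ⊗[K] A} (hg : evalAt μ x g = y.toLinearMap)
    (g' : M ⊗[K] A) : evalAt μ x (g * g') = evalAt μ y g' := by
  induction g' with
  | zero => simp
  | tmul m h => ext l; rw [evalAt_mul_tmul, hg]; simp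
  | add a b ha hb => rw [mul_add, map_add, map_add, ha, hb]

theorem evalAt_galois (σ : M ≃ₐ[K] M) (x : L →ₐ[K] M) (g : M ⊗[K] A) (l : L) :
    evalAt μ (galPerm K L M σ x) (σ.toLinearMap.rTensor A g) l = σ (evalAt μ x g l) := by
  induction g with
  | zero => simp
  | tmul m h => simp
  | add a b ha hb => simp only [map_add, LinearMap.add_apply, ha, hb]

theorem mul'_map_flip_apply (t : L ⊗[K] A) (l : L) :
    (LinearMap.mul' K (Module.End K L) ∘ₗ
      TensorProduct.map (Algebra.lmul K L).toLinearMap μ.toLinearMap) t l =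
    (μ.toLinearMap.flip l).liftBaseChange L t := by
  induction t with
  | zero => simp
  | tmul m h => simp
  | add a b ha hb => simp only [map_add, LinearMap.add_apply, ha, hb]

theorem comp_mul'_map_apply (x : L →ₐ[K] M) (t : L ⊗[K] A) (l : L) :
    x ((LinearMap.mul' K (Module.End K L) ∘ₗ
      TensorProduct.map (Algebra.lmul K L).toLinearMap μ.toLinearMap) t l) =
    evalAt μ x (x.toLinearMap.rTensor A t) l := by
  induction t with
  | zero => simp
  | tmul m h => simp
  | add a b ha hb => simp only [map_add, LinearMap.add_apply, ha, hb]

variable [FiniteDimensional K L]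

theorem finrank_of_bijective [Module.Finite K A] (hj : Function.Bijective
    (LinearMap.mul' K (Module.End K L) ∘ₗ
      TensorProduct.map (Algebra.lmul K L).toLinearMap μ.toLinearMap)) :
    Module.finrank K A = Module.finrank K L := by
  have h := (LinearEquiv.ofBijective _ hj).finrank_eq
  rw [Module.finrank_tensorProduct, Module.finrank_linearMap] at h
  exact Nat.eq_of_mul_eq_mul_left Module.finrank_pos h

/-- This is the base change along x of the bijection L ⊗ A → End(L). Both sides have the same
dimension over M, so surjectivity suffices. -/
theorem evalAt_bijective [Module.Finite K A] (hj : Function.Bijective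
    (LinearMap.mul' K (Module.End K L) ∘ₗ
      TensorProduct.map (Algebra.lmul K L).toLinearMap μ.toLinearMap)) (x : L →ₐ[K] M) :
    Function.Bijective (evalAt μ x) := by
  have hs : Function.Surjective (evalAt μ x) := by
    intro f
    let b := Module.finBasis K L
    choose t ht using fun j => hj.2 ((b.coord j).smulRight 1)
    -- The `t j` are preimages of the coordinate projections, through which f is expanded.
    refine ⟨∑ j, f (b j) • x.toLinearMap.rTensor A (t j), ?_⟩
    refine b.ext fun i => ?_
    simp only [map_sum, map_smul, LinearMap.sum_apply, LinearMap.smul_apply]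
    simp_rw [← comp_mul'_map_apply, ht]
    rw [Finset.sum_eq_single i]
    · simp
    · intro j _ hj
      simp [Finsupp.single_eq_of_ne hj]
    · simp
  refine ⟨(LinearMap.injective_iff_surjective_of_finrank_eq_finrank ?_).2 hs, hs⟩
  rw [Module.finrank_baseChange, finrank_of_bijective μ hj, Module.finrank_linearMap_self]

end EvalAt

section Descent

variable {K : Type u} {L : Type v} {M : Type w} [Field K] [Field L] [Field M]
  [Algebra K L] [Algebra K M]

variable (K M) in
/-- A `K`-linear retraction of `K → M`. -/
noncomputable def retraction : M →ₗ[K] K :=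
  ((Algebra.linearMap K M).exists_leftInverse_of_injective
    (LinearMap.ker_eq_bot.2 (algebraMap K M).injective)).choose

theorem retraction_one : retraction K M 1 = 1 := by
  have h := ((Algebra.linearMap K M).exists_leftInverse_of_injective
    (LinearMap.ker_eq_bot.2 (algebraMap K M).injective)).choose_spec
  have h1 := LinearMap.congr_fun h 1
  simpa [retraction] using h1

variable (K M) in
/-- A `K`-linear retraction of `V → M ⊗ V`. -/
noncomputable def tensorRetraction (V : Type*) [AddCommGroup V] [Module K V] : M ⊗[K] V →ₗ[K] V :=
  (TensorProduct.lid K V).toLinearMap ∘ₗ (retraction K M).rTensor V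

theorem map_tensorRetraction {V W : Type*} [AddCommGroup V] [Module K V] [AddCommGroup W]
    [Module K W] (f : V →ₗ[K] W) (s : M ⊗[K] V) :
    f (tensorRetraction K M V s) = tensorRetraction K M W (f.baseChange M s) := by
  induction s with
  | zero => simp
  | tmul m h => simp [tensorRetraction]
  | add a b ha hb => simp only [map_add, ha, hb]

theorem tensorEval_baseChange {V : Type*} [AddCommGroup V] [Module K V] (x : L →ₐ[K] M)
    (f : V →ₗ[K] L) (s : M ⊗[K] V) :
    tensorEval K L M x (f.baseChange M s) = (x.toLinearMap ∘ₗ f).liftBaseChange M s := by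
  induction s with
  | zero => simp
  | tmul m h => simp
  | add a b ha hb => simp only [map_add, ha, hb]

variable [FiniteDimensional K L] [Algebra.IsSeparable K L] [hcl : IsNormalClosure K L M]

include hcl in
/-- Descent: if `s` in `M ⊗ V` is mapped to `1 ⊗ l` by `f : V → L`, then so is its retraction. -/
theorem apply_tensorRetraction {V : Type*} [AddCommGroup V] [Module K V] (f : V →ₗ[K] L)
    {s : M ⊗[K] V} {l : L}
    (h : ∀ x : L →ₐ[K] M, (x.toLinearMap ∘ₗ f).liftBaseChange M s = x l) :
    f (tensorRetraction K M V s) = l := by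
  have h1 : f.baseChange M s - 1 ⊗ₜ l = 0 := by
    refine eq_zero_of_tensorEval fun x => ?_
    rw [map_sub, tensorEval_baseChange, h, tensorEval_tmul, one_mul, sub_self]
  rw [map_tensorRetraction, sub_eq_zero.1 h1]
  simp [tensorRetraction, retraction_one]

include hcl in
theorem action_tensorRetraction {A : Type*} [Ring A] [Algebra K A] (μ : A →ₐ[K] Module.End K L)
    {s : M ⊗[K] A} {l l' : L} (h : ∀ x : L →ₐ[K] M, evalAt μ x s l = x l') :
    μ (tensorRetraction K M A s) l = l' := by
  refine apply_tensorRetraction (M := M) (μ.toLinearMap.flip l) fun x => ?_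
  rw [← evalAt_apply, h]

end Descent

/-! ### From Hopf Galois structures to regular subgroups -/

namespace HopfGaloisStructure

section GroupLike

variable {K : Type u} {L : Type v} {M : Type w} [Field K] [Field L] [Field M]
  [Algebra K L] [Algebra K M] (S : HopfGaloisStructure K L)

theorem evalAt_one (x : L →ₐ[K] M) (g : M ⊗[K] S.H) :
    evalAt S.μ x g 1 = Coalgebra.counit (R := M) g := by
  induction g with
  | zero => simp
  | tmul m h => simp [S.act_one, Algebra.smul_def, mul_comm]
  | add a b ha hb => simp only [map_add, LinearMap.add_apply, ha, hb]

/-- The functional `g ↦ evalAt x g l`. -/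
noncomputable def evalAtFlip (x : L →ₐ[K] M) (l : L) : M ⊗[K] S.H →ₗ[M] M :=
  LinearMap.applyₗ' M l ∘ₗ evalAt S.μ x

@[simp] theorem evalAtFlip_apply (x : L →ₐ[K] M) (l : L) (g : M ⊗[K] S.H) :
    evalAtFlip S x l g = evalAt S.μ x g l := rfl

theorem evalAt_apply_mul (x : L →ₐ[K] M) (g : M ⊗[K] S.H) (l l' : L) :
    evalAt S.μ x g (l * l') = LinearMap.mul' M M (TensorProduct.map
      (evalAtFlip S x l) (evalAtFlip S x l') (Coalgebra.comul (R := M) g)) := by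
  induction g with
  | zero => simp
  | tmul m h =>
    rw [TensorProduct.comul_tmul, evalAt_tmul, S.act_mul, CommSemiring.comul_apply]
    induction Coalgebra.comul (R := K) h with
    | zero => simp
    | tmul a b => simp; ring
    | add a b ha hb => simp only [map_add, TensorProduct.tmul_add, mul_add, ha, hb]
  | add a b ha hb => simp only [map_add, LinearMap.add_apply, ha, hb]

/-- A group-like element over `M` sends embeddings to embeddings. -/
theorem exists_evalAt_eq_of_isGroupLike {g : M ⊗[K] S.H} (hg : IsGroupLikeElem M g)
    (x : L →ₐ[K] M) : ∃ y : L →ₐ[K] M, evalAt S.μ x g = y.toLinearMap := by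
  refine ⟨AlgHom.ofLinearMap (evalAt S.μ x g) ?_ ?_, ?_⟩
  · rw [evalAt_one, hg.counit_eq_one]
  · intro l l'
    rw [evalAt_apply_mul, hg.comul_eq_tmul_self]
    simp
  · ext l
    rfl

variable [FiniteDimensional K L]

/-- Evaluations at x separate the points of M ⊗ H, so their products separate those of its tensor
square. Tested this way, the comultiplication of g equals g ⊗ g because y is multiplicative. -/
theorem isGroupLike_of_evalAt_eq {g : M ⊗[K] S.H} {x y : L →ₐ[K] M}
    (h : evalAt S.μ x g = y.toLinearMap) : IsGroupLikeElem M g := by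
  have hinj := (evalAt_bijective S.μ S.bijective x).1
  have hsep : ∀ u, (∀ l, evalAtFlip S x l u = 0) → u = 0 := fun u hu =>
    hinj (by rw [map_zero]; ext l; exact hu l)
  refine ⟨?_, ?_⟩
  · rw [← S.evalAt_one x, h]
    simp
  · rw [← sub_eq_zero]
    refine eq_zero_of_pairing (evalAtFlip S x) (evalAtFlip S x) hsep ?_ ?_
    · intro w hw
      obtain ⟨v, rfl⟩ := (TensorProduct.lid M (M ⊗[K] S.H)).symm.surjective w
      rw [hsep v fun l => by simpa using hw l, map_zero]
    · intro l l'
      rw [map_sub, map_sub, ← evalAt_apply_mul]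
      simp [h]

end GroupLike

section PermGroup

variable {K : Type u} {L : Type v} {M : Type w} [Field K] [Field L] [Field M]
  [Algebra K L] [Algebra K M] (S : HopfGaloisStructure K L)

/-- The map on embeddings given by a group-like element. -/
noncomputable def groupLikeMap (g : GroupLike M (M ⊗[K] S.H)) (x : L →ₐ[K] M) : L →ₐ[K] M :=
  (S.exists_evalAt_eq_of_isGroupLike g.2 x).choose

theorem evalAt_groupLike (g : GroupLike M (M ⊗[K] S.H)) (x : L →ₐ[K] M) :
    evalAt S.μ x g.1 = (S.groupLikeMap g x).toLinearMap :=
  (S.exists_evalAt_eq_of_isGroupLike g.2 x).choose_spec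

theorem groupLikeMap_eq_iff {g : GroupLike M (M ⊗[K] S.H)} {x y : L →ₐ[K] M} :
    S.groupLikeMap g x = y ↔ evalAt S.μ x g.1 = y.toLinearMap := by
  rw [evalAt_groupLike]
  exact AlgHom.toLinearMap_injective.eq_iff.symm

theorem groupLikeMap_one (x : L →ₐ[K] M) : S.groupLikeMap (M := M) 1 x = x := by
  rw [groupLikeMap_eq_iff]
  ext l
  rw [GroupLike.val_one, Algebra.TensorProduct.one_def, evalAt_tmul]
  simp

theorem groupLikeMap_mul (g g' : GroupLike M (M ⊗[K] S.H)) (x : L →ₐ[K] M) :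
    S.groupLikeMap (g * g') x = S.groupLikeMap g' (S.groupLikeMap g x) := by
  rw [groupLikeMap_eq_iff, GroupLike.val_mul, evalAt_mul S.μ (S.evalAt_groupLike g x),
    evalAt_groupLike]

variable (M) in
/-- The group-like elements over `M` act on the embeddings of `L` into `M`. -/
noncomputable def permHom : GroupLike M (M ⊗[K] S.H) →* Perm (L →ₐ[K] M) where
  toFun g :=
    { toFun := S.groupLikeMap g⁻¹
      invFun := S.groupLikeMap g
      left_inv x := by rw [← groupLikeMap_mul, inv_mul_cancel, groupLikeMap_one]
      right_inv x := by rw [← groupLikeMap_mul, mul_inv_cancel, groupLikeMap_one] }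
  map_one' := by
    ext x l
    change S.groupLikeMap (M := M) 1⁻¹ x l = x l
    rw [inv_one, groupLikeMap_one]
  map_mul' g g' := by
    ext x l
    change S.groupLikeMap (g * g')⁻¹ x l = S.groupLikeMap g⁻¹ (S.groupLikeMap g'⁻¹ x) l
    rw [mul_inv_rev, groupLikeMap_mul]

theorem permHom_apply (g : GroupLike M (M ⊗[K] S.H)) (x : L →ₐ[K] M) :
    S.permHom M g x = S.groupLikeMap g⁻¹ x := rfl

variable (M) in
/-- The permutations of the embeddings given by the group-like elements. -/
noncomputable def permGroup : Subgroup (Perm (L →ₐ[K] M)) := (S.permHom M).range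

theorem exists_evalAt_of_mem_permGroup {n : Perm (L →ₐ[K] M)} (hn : n ∈ S.permGroup M) :
    ∃ g : M ⊗[K] S.H, ∀ x, evalAt S.μ x g = (n x).toLinearMap := by
  obtain ⟨g, rfl⟩ := hn
  exact ⟨g⁻¹.1, fun x => S.evalAt_groupLike g⁻¹ x⟩

variable [FiniteDimensional K L]

theorem mem_permGroup_of_evalAt [Nonempty (L →ₐ[K] M)] {n : Perm (L →ₐ[K] M)}
    {g : M ⊗[K] S.H} (h : ∀ x, evalAt S.μ x g = (n x).toLinearMap) : n ∈ S.permGroup M := by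
  obtain ⟨x₀⟩ := ‹Nonempty (L →ₐ[K] M)›
  refine ⟨⟨g, S.isGroupLike_of_evalAt_eq (h x₀)⟩⁻¹, ?_⟩
  ext x : 1
  rw [permHom_apply, inv_inv, groupLikeMap_eq_iff, h]

theorem permHom_injective [Nonempty (L →ₐ[K] M)] : Function.Injective (S.permHom M) := by
  obtain ⟨x₀⟩ := ‹Nonempty (L →ₐ[K] M)›
  intro g g' h
  rw [← inv_inj]
  apply GroupLike.val_injective
  apply (evalAt_bijective S.μ S.bijective x₀).1
  rw [evalAt_groupLike, evalAt_groupLike, ← permHom_apply, ← permHom_apply, h]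

/-- By `evalAt_bijective` each target embedding y comes from a unique element of M ⊗ H, which is
group-like because y is an algebra homomorphism. -/
theorem isRegularSubgroup_permGroup : IsRegularSubgroup (S.permGroup M) := by
  intro x y
  have : Nonempty (L →ₐ[K] M) := ⟨x⟩
  obtain ⟨g, hg⟩ := (evalAt_bijective S.μ S.bijective x).2 y.toLinearMap
  refine ⟨⟨S.permHom M ⟨g, S.isGroupLike_of_evalAt_eq hg⟩⁻¹, _, rfl⟩, ?_, ?_⟩
  · change S.permHom M _ x = y
    rw [permHom_apply, inv_inv, groupLikeMap_eq_iff, hg]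
  · rintro ⟨_, g', rfl⟩ h
    refine Subtype.ext (congrArg (S.permHom M) ?_)
    rw [← inv_inj, inv_inv]
    apply GroupLike.val_injective
    apply (evalAt_bijective S.μ S.bijective x).1
    rw [hg]
    exact S.groupLikeMap_eq_iff.1 h

theorem conj_mem_permGroup (σ : M ≃ₐ[K] M) {n : Perm (L →ₐ[K] M)} (hn : n ∈ S.permGroup M) :
    galPerm K L M σ * n * (galPerm K L M σ)⁻¹ ∈ S.permGroup M := by
  cases isEmpty_or_nonempty (L →ₐ[K] M)
  · rw [Subsingleton.elim (galPerm K L M σ * n * (galPerm K L M σ)⁻¹) n]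
    exact hn
  obtain ⟨g, hg⟩ := S.exists_evalAt_of_mem_permGroup hn
  refine S.mem_permGroup_of_evalAt (g := σ.toLinearMap.rTensor S.H g) fun x => ?_
  ext l
  obtain ⟨y, rfl⟩ := (galPerm K L M σ).surjective x
  rw [evalAt_galois, hg]
  simp

end PermGroup

end HopfGaloisStructure

/-! ### Types and isomorphism classes in terms of permutations -/

section Action

variable {K : Type u} {L : Type v} [Field K] [Field L] [Algebra K L] {A : Type*} [Ring A]
  [Algebra K A] {μ : A →ₐ[K] Module.End K L}

theorem action_injective (hj : Function.Bijective
    (LinearMap.mul' K (Module.End K L) ∘ₗ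
      TensorProduct.map (Algebra.lmul K L).toLinearMap μ.toLinearMap)) :
    Function.Injective μ := by
  intro a b h
  have h1 : (1 : L) ⊗ₜ[K] a = 1 ⊗ₜ b := hj.1 (by simp [h])
  exact Algebra.TensorProduct.includeRight_injective (R := K) (A := L) (B := A)
    (algebraMap K L).injective h1

/-- The products `(h • l)(h' • l')` determine an element of `A ⊗ A`. -/
theorem eq_zero_of_action_pairing (hj : Function.Bijective
    (LinearMap.mul' K (Module.End K L) ∘ₗ
      TensorProduct.map (Algebra.lmul K L).toLinearMap μ.toLinearMap)) {U : Type*}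
    [AddCommGroup U] [Module K U] {I : Type*} (φ : I → U →ₗ[K] L)
    (hφ : ∀ u, (∀ i, φ i u = 0) → u = 0) {t : U ⊗[K] A}
    (ht : ∀ i l, LinearMap.mul' K L (TensorProduct.map (φ i) (μ.toLinearMap.flip l) t) = 0) :
    t = 0 := by
  refine eq_zero_of_pairing φ μ.toLinearMap.flip hφ (fun w hw => ?_) ht
  apply hj.1
  rw [map_zero]
  ext l
  rw [mul'_map_flip_apply, hw, LinearMap.zero_apply]

theorem eq_zero_of_action (hj : Function.Bijective
    (LinearMap.mul' K (Module.End K L) ∘ₗ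
      TensorProduct.map (Algebra.lmul K L).toLinearMap μ.toLinearMap)) (a : A)
    (ha : ∀ l, μ.toLinearMap.flip l a = 0) : a = 0 :=
  action_injective hj (by rw [map_zero]; ext l; exact ha l)

end Action

namespace HopfGaloisStructure

variable {K : Type u} {L : Type v} {M : Type w} [Field K] [Field L] [Field M]
  [Algebra K L] [Algebra K M]

theorem Iso.permGroup_le {S T : HopfGaloisStructure K L} [FiniteDimensional K L]
    [Nonempty (L →ₐ[K] M)] (h : Iso S T) : S.permGroup M ≤ T.permGroup M := by
  obtain ⟨e, he⟩ := h
  intro n hn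
  obtain ⟨g, hg⟩ := S.exists_evalAt_of_mem_permGroup hn
  refine T.mem_permGroup_of_evalAt (g := (e.toAlgEquiv.toLinearEquiv.toLinearMap).baseChange M g)
    fun x => ?_
  rw [← hg]
  clear hg
  induction g using TensorProduct.induction_on with
  | zero => simp
  | tmul m h =>
    ext l
    simp [he]
  | add a b ha hb => rw [map_add, map_add, map_add, ha, hb]

variable [FiniteDimensional K L] [Algebra.IsSeparable K L] [hcl : IsNormalClosure K L M]

include hcl in
-- The group-like elements of a group algebra are the group itself. Conversely, those of M ⊗ H are
-- linearly independent and, by regularity, as many as its dimension, so they form a basis and M ⊗ H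
-- is their group algebra.
theorem isOfType_iff {N : Type} [Group N] (S : HopfGaloisStructure K L) :
    S.IsOfType M N ↔ Nonempty (N ≃* S.permGroup M) := by
  have hX := nonempty_embeddings (K := K) (L := L) (M := M)
  let f := MonoidHom.ofInjective (S.permHom_injective (M := M))
  constructor
  · rintro ⟨e⟩
    let q : N →* GroupLike M (M ⊗[K] S.H) :=
      { toFun n := ⟨e.symm (MonoidAlgebra.of M N n),
          (MonoidAlgebra.isGroupLikeElem_of (R := M) n).map e.symm⟩
        map_one' := GroupLike.ext (by
          change e.symm (MonoidAlgebra.of M N 1) = 1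
          rw [map_one, map_one])
        map_mul' a b := GroupLike.ext (by
          change e.symm (MonoidAlgebra.of M N (a * b)) =
            e.symm (MonoidAlgebra.of M N a) * e.symm (MonoidAlgebra.of M N b)
          rw [map_mul, map_mul]) }
    have hq : Function.Bijective q := by
      constructor
      · intro a b h
        exact MonoidAlgebra.of_injective (e.symm.injective (congrArg GroupLike.val h))
      · intro g
        obtain ⟨n, hn⟩ := MonoidAlgebra.isGroupLikeElem_iff_mem_range_of.1 (g.2.map e)
        refine ⟨n, GroupLike.ext ?_⟩
        change e.symm _ = _
        rw [hn, BialgEquiv.symm_apply_apply]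
    exact ⟨(MulEquiv.ofBijective q hq).trans f⟩
  · rintro ⟨e⟩
    let F := MonoidAlgebra.liftGroupLikeBialgHom (R := M) (A := M ⊗[K] S.H)
    have : Fintype (GroupLike M (M ⊗[K] S.H)) :=
      @Fintype.ofFinite _ (Finite.of_equiv _ f.toEquiv.symm)
    have hcard : Nat.card (GroupLike M (M ⊗[K] S.H)) = Module.finrank M (M ⊗[K] S.H) := by
      rw [Module.finrank_baseChange, finrank_of_bijective S.μ S.bijective,
        ← card_embeddings (K := K) (L := L) (M := M), Nat.card_congr f.toEquiv]
      obtain ⟨x⟩ := hX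
      refine Nat.card_congr (Equiv.ofBijective (fun n => (n : Perm (L →ₐ[K] M)) x) ?_)
      exact (Function.bijective_iff_existsUnique _).2 (S.isRegularSubgroup_permGroup x)
    have hli := linearIndep_groupLikeVal (R := M) (A := M ⊗[K] S.H)
    have hval : ∀ a, F a = Finsupp.linearCombination M GroupLike.val
        (MonoidAlgebra.coeffLinearEquiv M a) := by
      intro a
      change MonoidAlgebra.lift _ _ _ _ a = _
      rw [MonoidAlgebra.lift_apply]
      rfl
    have hF : Function.Bijective F := by
      constructor
      · intro a b h
        rw [hval, hval] at h
        exact (MonoidAlgebra.coeffLinearEquiv M).injective (hli h)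
      · intro g
        have hsp := hli.span_eq_top_of_card_eq_finrank' (by
          rw [← Nat.card_eq_fintype_card, hcard])
        have hg : g ∈ Submodule.span M (Set.range (GroupLike.val (R := M) (A := M ⊗[K] S.H))) := by
          rw [hsp]
          trivial
        rw [← Finsupp.range_linearCombination] at hg
        obtain ⟨c, hc⟩ := hg
        refine ⟨(MonoidAlgebra.coeffLinearEquiv M).symm c, ?_⟩
        rw [hval, LinearEquiv.apply_symm_apply, hc]
    exact ⟨(BialgEquiv.ofBijective F hF).symm.trans
      (MonoidAlgebra.domCongrBialgEquiv M M (f.trans e.symm))⟩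

include hcl in
theorem exists_coeff (S : HopfGaloisStructure K L) (g : M ⊗[K] S.H) :
    ∃ a : S.permGroup M → M, ∀ x, evalAt S.μ x g =
      ∑ᶠ n, a n • ((n : Perm (L →ₐ[K] M)) x).toLinearMap := by
  obtain ⟨x₀⟩ := nonempty_embeddings (K := K) (L := L) (M := M)
  have : Fintype (L →ₐ[K] M) := Fintype.ofFinite _
  have : Fintype (S.permGroup M) := Fintype.ofFinite _
  choose G hG using fun n : S.permGroup M => S.exists_evalAt_of_mem_permGroup n.2
  let c := (embBasis K L M).repr (evalAt S.μ x₀ g)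
  let b : S.permGroup M ≃ (L →ₐ[K] M) := Equiv.ofBijective (fun n => (n : Perm (L →ₐ[K] M)) x₀)
    ((Function.bijective_iff_existsUnique _).2 (S.isRegularSubgroup_permGroup x₀))
  have h1 : g = ∑ n, c (b n) • G n := by
    apply (evalAt_bijective S.μ S.bijective x₀).1
    rw [map_sum, ← (embBasis K L M).sum_repr (evalAt S.μ x₀ g), ← b.sum_comp]
    refine Finset.sum_congr rfl fun n _ => ?_
    rw [map_smul, hG, embBasis_apply]
    rfl
  refine ⟨fun n => c (b n), fun x => ?_⟩
  rw [finsum_eq_sum_of_fintype]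
  conv_lhs => rw [h1]
  rw [map_sum]
  refine Finset.sum_congr rfl fun n _ => ?_
  rw [map_smul, hG]

include hcl in
-- The action of s is a combination of permutations, which can be rebuilt in the other algebra over
-- M; a K-linear retraction of K → M brings it back to K.
theorem range_le_of_permGroup_le {S T : HopfGaloisStructure K L}
    (h : S.permGroup M ≤ T.permGroup M) : S.μ.range ≤ T.μ.range := by
  rintro _ ⟨s, rfl⟩
  obtain ⟨a, ha⟩ := S.exists_coeff (M := M) (1 ⊗ₜ s)
  have : Fintype (L →ₐ[K] M) := Fintype.ofFinite _
  have : Fintype (S.permGroup M) := Fintype.ofFinite _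
  choose G hG using fun n : S.permGroup M => T.exists_evalAt_of_mem_permGroup (h n.2)
  refine ⟨tensorRetraction K M T.H (∑ n, a n • G n), ?_⟩
  ext l
  refine action_tensorRetraction T.μ fun x => ?_
  have h1 := LinearMap.congr_fun (ha x) l
  rw [evalAt_tmul, one_mul] at h1
  change _ = x (S.μ s l)
  rw [h1, finsum_eq_sum_of_fintype, map_sum]
  congr 1
  refine Finset.sum_congr rfl fun n _ => ?_
  rw [map_smul, hG]

omit [FiniteDimensional K L] [Algebra.IsSeparable K L] in
-- The image in End(L) determines the structure: the action is faithful, and it determines counit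
-- and comultiplication.
theorem iso_of_range_eq {S T : HopfGaloisStructure K L} (h : S.μ.range = T.μ.range) :
    Iso S T := by
  have hS := action_injective S.bijective
  have hT := action_injective T.bijective
  let e : S.H ≃ₐ[K] T.H := (AlgEquiv.ofInjective S.μ hS).trans
    ((Subalgebra.equivOfEq _ _ h).trans (AlgEquiv.ofInjective T.μ hT).symm)
  have he : ∀ s, T.μ (e s) = S.μ s := by
    intro s
    exact congrArg Subtype.val ((AlgEquiv.ofInjective T.μ hT).apply_symm_apply
      (Subalgebra.equivOfEq _ _ h (AlgEquiv.ofInjective S.μ hS s)))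
  refine ⟨BialgEquiv.ofAlgEquiv e ?_ ?_, he⟩
  · ext s
    apply (algebraMap K L).injective
    change algebraMap K L (Coalgebra.counit (e s)) = algebraMap K L (Coalgebra.counit s)
    rw [← S.act_one, ← T.act_one, he]
  · ext s
    change TensorProduct.map e.toLinearMap e.toLinearMap (Coalgebra.comul s) =
      Coalgebra.comul (e s)
    rw [← sub_eq_zero]
    refine eq_zero_of_action_pairing T.bijective T.μ.toLinearMap.flip
      (eq_zero_of_action T.bijective) fun l l' => ?_
    have he' : ∀ l, T.μ.toLinearMap.flip l ∘ₗ e.toLinearMap = S.μ.toLinearMap.flip l :=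
      fun l => LinearMap.ext fun s => LinearMap.congr_fun (he s) l
    rw [map_sub, map_sub, ← T.act_mul, he, S.act_mul, ← LinearMap.comp_apply (TensorProduct.map _ _),
      ← TensorProduct.map_comp, he', he', sub_self]

include hcl in
theorem iso_iff {S T : HopfGaloisStructure K L} :
    Iso S T ↔ S.permGroup M = T.permGroup M := by
  have := nonempty_embeddings (K := K) (L := L) (M := M)
  exact ⟨fun h => le_antisymm h.permGroup_le h.symm.permGroup_le, fun h => iso_of_range_eq
    (le_antisymm (range_le_of_permGroup_le h.le) (range_le_of_permGroup_le h.ge))⟩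

end HopfGaloisStructure

/-! ### Hopf algebra structure determined by an action -/

section Construction

variable {K : Type u} {L : Type v} [Field K] [Field L] [Algebra K L] {A : Type*} [Ring A]
  [Algebra K A] (μ : A →ₐ[K] Module.End K L)

/-- The functional `a ⊗ b ↦ (a • l)(b • l')` on `A ⊗ A`. -/
noncomputable def actionPairing (l l' : L) : A ⊗[K] A →ₗ[K] L :=
  LinearMap.mul' K L ∘ₗ TensorProduct.map (μ.toLinearMap.flip l) (μ.toLinearMap.flip l')

@[simp] theorem actionPairing_tmul (l l' : L) (a b : A) :
    actionPairing μ l l' (a ⊗ₜ b) = μ a l * μ b l' := rfl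

theorem actionPairing_mul_tmul (l l' : L) (t : A ⊗[K] A) (a b : A) :
    actionPairing μ l l' (t * (a ⊗ₜ b)) = actionPairing μ (μ a l) (μ b l') t := by
  induction t with
  | zero => simp
  | tmul c d => simp
  | add c d hc hd => simp only [add_mul, map_add, hc, hd]

theorem actionPairing_comm (l l' : L) (t : A ⊗[K] A) :
    actionPairing μ l l' (TensorProduct.comm K A A t) = actionPairing μ l' l t := by
  induction t with
  | zero => simp
  | tmul c d => simp [mul_comm]
  | add c d hc hd => simp only [map_add, hc, hd]

/-- An algebra acting on a field extension in such a way that the action determines a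
comultiplication, a counit and an antipode. The last one is the adjoint with respect to an
invariant nondegenerate functional `T`. -/
structure IsHopfGaloisAction {E : Type*} [AddCommGroup E] [Module K E] (T : L →ₗ[K] E) : Prop where
  bijective : Function.Bijective
    (LinearMap.mul' K (Module.End K L) ∘ₗ
      TensorProduct.map (Algebra.lmul K L).toLinearMap μ.toLinearMap)
  exists_comul : ∀ h, ∃ t, ∀ l l', actionPairing μ l l' t = μ h (l * l')
  exists_counit : ∀ h, ∃ c, μ h 1 = algebraMap K L c
  nondegenerate : ∀ l, (∀ l', T (l' * l) = 0) → l = 0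
  exists_antipode : ∀ h, ∃ s, ∀ l l', T (l * μ s l') = T (μ h l * l')
  invariant : ∀ h l, T (μ h l) = T (μ h 1 * l)

namespace IsHopfGaloisAction

variable {μ} {E : Type*} [AddCommGroup E] [Module K E] {T : L →ₗ[K] E}
  (hμ : IsHopfGaloisAction μ T)

include hμ

theorem pairing_ext {t t' : A ⊗[K] A}
    (h : ∀ l l', actionPairing μ l l' t = actionPairing μ l l' t') : t = t' := by
  rw [← sub_eq_zero]
  refine eq_zero_of_action_pairing hμ.bijective μ.toLinearMap.flip
    (eq_zero_of_action hμ.bijective) fun l l' => ?_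
  have := h l l'
  rw [← sub_eq_zero, ← map_sub] at this
  exact this

theorem pairing_ext₃ {t t' : (A ⊗[K] A) ⊗[K] A}
    (h : ∀ l l' l'', LinearMap.mul' K L (TensorProduct.map (actionPairing μ l l')
      (μ.toLinearMap.flip l'') t) = LinearMap.mul' K L (TensorProduct.map (actionPairing μ l l')
      (μ.toLinearMap.flip l'') t')) : t = t' := by
  rw [← sub_eq_zero]
  refine eq_zero_of_action_pairing hμ.bijective (fun i : L × L => actionPairing μ i.1 i.2)
    (fun u hu => hμ.pairing_ext fun l l' => ?_) fun i l => ?_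
  · rw [hu (l, l'), map_zero]
  · rw [map_sub, map_sub, h, sub_self]

theorem action_ext {a b : A} (h : ∀ l, μ a l = μ b l) : a = b :=
  action_injective hμ.bijective (LinearMap.ext h)

/-- The comultiplication determined by the action. -/
noncomputable def comulMap : A →ₗ[K] A ⊗[K] A where
  toFun h := (hμ.exists_comul h).choose
  map_add' a b := hμ.pairing_ext fun l l' => by
    rw [map_add (actionPairing μ l l'), (hμ.exists_comul _).choose_spec, (hμ.exists_comul _).choose_spec,
      (hμ.exists_comul _).choose_spec, map_add, LinearMap.add_apply]
  map_smul' c a := hμ.pairing_ext fun l l' => by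
    rw [RingHom.id_apply, map_smul (actionPairing μ l l'), (hμ.exists_comul _).choose_spec,
      (hμ.exists_comul _).choose_spec, map_smul, LinearMap.smul_apply]

theorem comulMap_spec (h : A) (l l' : L) :
    actionPairing μ l l' (hμ.comulMap h) = μ h (l * l') :=
  (hμ.exists_comul h).choose_spec l l'

/-- The counit determined by the action. -/
noncomputable def counitMap : A →ₗ[K] K where
  toFun h := (hμ.exists_counit h).choose
  map_add' a b := (algebraMap K L).injective <| by
    rw [map_add (algebraMap K L), ← (hμ.exists_counit _).choose_spec, ← (hμ.exists_counit _).choose_spec,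
      ← (hμ.exists_counit _).choose_spec, map_add, LinearMap.add_apply]
  map_smul' c a := (algebraMap K L).injective <| by
    rw [RingHom.id_apply, smul_eq_mul, map_mul, ← (hμ.exists_counit _).choose_spec,
      ← (hμ.exists_counit _).choose_spec, map_smul, LinearMap.smul_apply, Algebra.smul_def]

theorem counitMap_spec (h : A) : μ h 1 = algebraMap K L (hμ.counitMap h) :=
  (hμ.exists_counit h).choose_spec

theorem adjoint_ext {a b : A} (h : ∀ l l', T (l * μ a l') = T (l * μ b l')) : a = b :=
  hμ.action_ext fun l => by
    rw [← sub_eq_zero]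
    refine hμ.nondegenerate _ fun l' => ?_
    rw [mul_sub, map_sub, h, sub_self]

/-- The antipode determined by the action. -/
noncomputable def antipodeMap : A →ₗ[K] A where
  toFun h := (hμ.exists_antipode h).choose
  map_add' a b := hμ.adjoint_ext fun l l' => by
    rw [(hμ.exists_antipode _).choose_spec, map_add, map_add, LinearMap.add_apply,
      LinearMap.add_apply, mul_add, map_add, (hμ.exists_antipode _).choose_spec,
      (hμ.exists_antipode _).choose_spec, add_mul, map_add]
  map_smul' c a := hμ.adjoint_ext fun l l' => by
    rw [(hμ.exists_antipode _).choose_spec, map_smul, RingHom.id_apply, map_smul,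
      LinearMap.smul_apply, LinearMap.smul_apply, mul_smul_comm, map_smul,
      (hμ.exists_antipode _).choose_spec, smul_mul_assoc, map_smul]

theorem antipodeMap_spec (h : A) (l l' : L) :
    T (l * μ (hμ.antipodeMap h) l') = T (μ h l * l') :=
  (hμ.exists_antipode h).choose_spec l l'

theorem pairing_rTensor_comulMap (l l' l'' : L) (t : A ⊗[K] A) :
    LinearMap.mul' K L (TensorProduct.map (actionPairing μ l l') (μ.toLinearMap.flip l'')
      (hμ.comulMap.rTensor A t)) = actionPairing μ (l * l') l'' t := by
  induction t with
  | zero => simp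
  | tmul c d => simp [comulMap_spec]
  | add c d hc hd => simp only [map_add, hc, hd]

omit hμ in
theorem pairing_assoc_symm_tmul (l l' l'' : L) (a : A) (t : A ⊗[K] A) :
    LinearMap.mul' K L (TensorProduct.map (actionPairing μ l l') (μ.toLinearMap.flip l'')
      ((TensorProduct.assoc K A A A).symm (a ⊗ₜ t))) = μ a l * actionPairing μ l' l'' t := by
  induction t with
  | zero => simp
  | tmul c d => simp [mul_assoc]
  | add c d hc hd => simp only [TensorProduct.tmul_add, map_add, hc, hd, mul_add]

theorem pairing_lTensor_comulMap (l l' l'' : L) (t : A ⊗[K] A) :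
    LinearMap.mul' K L (TensorProduct.map (actionPairing μ l l') (μ.toLinearMap.flip l'')
      ((TensorProduct.assoc K A A A).symm (hμ.comulMap.lTensor A t))) =
    actionPairing μ l (l' * l'') t := by
  induction t with
  | zero => simp
  | tmul c d => rw [LinearMap.lTensor_tmul, pairing_assoc_symm_tmul, comulMap_spec]; rfl
  | add c d hc hd => simp only [map_add, hc, hd]

theorem action_lid_rTensor_counitMap (l : L) (t : A ⊗[K] A) :
    μ (TensorProduct.lid K A (hμ.counitMap.rTensor A t)) l = actionPairing μ 1 l t := by
  induction t with
  | zero => simp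
  | tmul c d => simp [counitMap_spec hμ c, Algebra.smul_def]
  | add c d hc hd => simp only [map_add, LinearMap.add_apply, hc, hd]

theorem action_rid_lTensor_counitMap (l : L) (t : A ⊗[K] A) :
    μ (TensorProduct.rid K A (hμ.counitMap.lTensor A t)) l = actionPairing μ l 1 t := by
  induction t with
  | zero => simp
  | tmul c d => simp [counitMap_spec hμ d, Algebra.smul_def, mul_comm]
  | add c d hc hd => simp only [map_add, LinearMap.add_apply, hc, hd]

/-- The coalgebra structure determined by the action. -/
@[reducible] noncomputable def coalgebra : Coalgebra K A where
  comul := hμ.comulMap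
  counit := hμ.counitMap
  coassoc := by
    ext h
    rw [LinearMap.comp_apply, LinearMap.comp_apply, LinearMap.comp_apply, LinearEquiv.coe_coe,
      ← LinearEquiv.eq_symm_apply]
    refine hμ.pairing_ext₃ fun l l' l'' => ?_
    rw [pairing_rTensor_comulMap, pairing_lTensor_comulMap, comulMap_spec, comulMap_spec,
      mul_assoc]
  rTensor_counit_comp_comul := by
    ext h
    apply (TensorProduct.lid K A).injective
    refine hμ.action_ext fun l => ?_
    rw [LinearMap.comp_apply, action_lid_rTensor_counitMap, comulMap_spec]
    simp
  lTensor_counit_comp_comul := by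
    ext h
    apply (TensorProduct.rid K A).injective
    refine hμ.action_ext fun l => ?_
    rw [LinearMap.comp_apply, action_rid_lTensor_counitMap, comulMap_spec]
    simp

theorem action_actionPairing (h : A) (l l' : L) (t : A ⊗[K] A) :
    μ h (actionPairing μ l l' t) = actionPairing μ l l' (hμ.comulMap h * t) := by
  induction t with
  | zero => simp
  | tmul c d => rw [actionPairing_mul_tmul, comulMap_spec, actionPairing_tmul]
  | add c d hc hd => simp only [map_add, mul_add, hc, hd]

/-- The bialgebra structure determined by the action. -/
@[reducible] noncomputable def bialgebra : Bialgebra K A :=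
  letI := hμ.coalgebra
  Bialgebra.mk' K A
    ((algebraMap K L).injective (by
      change algebraMap K L (hμ.counitMap 1) = _
      rw [← counitMap_spec, map_one μ, Module.End.one_apply, map_one]))
    (fun {a b} => (algebraMap K L).injective (by
      change algebraMap K L (hμ.counitMap _) =
        algebraMap K L (hμ.counitMap _ * hμ.counitMap _)
      rw [← counitMap_spec, map_mul, Module.End.mul_apply, counitMap_spec hμ b,
        Algebra.algebraMap_eq_smul_one (hμ.counitMap b), map_smul, counitMap_spec hμ a, map_mul,
        Algebra.smul_def, mul_comm]))
    (hμ.pairing_ext fun l l' => by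
      change actionPairing μ l l' (hμ.comulMap 1) = _
      rw [comulMap_spec, Algebra.TensorProduct.one_def, actionPairing_tmul, map_one]
      rfl)
    (fun {a b} => hμ.pairing_ext fun l l' => by
      change actionPairing μ l l' (hμ.comulMap _) =
        actionPairing μ l l' (hμ.comulMap _ * hμ.comulMap _)
      rw [← action_actionPairing, comulMap_spec, comulMap_spec, map_mul μ, Module.End.mul_apply])

theorem adjoint_mul'_rTensor (l l' : L) (t : A ⊗[K] A) :
    T (l * μ (LinearMap.mul' K A (hμ.antipodeMap.rTensor A t)) l') =
      T (actionPairing μ l l' t) := by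
  induction t with
  | zero => simp
  | tmul c d => simp [antipodeMap_spec]
  | add c d hc hd => simp only [map_add, mul_add, LinearMap.add_apply, hc, hd]

/-- The Hopf algebra structure determined by the action. -/
@[reducible] noncomputable def hopfAlgebra [Module.Finite K A] : HopfAlgebra K A :=
  letI := hμ.bialgebra
  -- Adjointness gives T(l · S(h₁)h₂ l') = T((h₁ l)(h₂ l')) = T(h(l l')), and invariance turns this
  -- into ε(h) T(l l').
  have h1 : LinearMap.mul' K A ∘ₗ hμ.antipodeMap.rTensor A ∘ₗ
      (Coalgebra.comul : A →ₗ[K] A ⊗[K] A) = Algebra.linearMap K A ∘ₗ Coalgebra.counit := by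
    ext h
    refine hμ.adjoint_ext fun l l' => ?_
    change T (l * μ (LinearMap.mul' K A (hμ.antipodeMap.rTensor A (hμ.comulMap h))) l') =
      T (l * μ (algebraMap K A (hμ.counitMap h)) l')
    rw [adjoint_mul'_rTensor, comulMap_spec, hμ.invariant, counitMap_spec hμ h, AlgHom.commutes,
      Module.algebraMap_end_apply, Algebra.smul_def, mul_left_comm]
  { antipode := hμ.antipodeMap
    mul_antipode_rTensor_comul := h1
    mul_antipode_lTensor_comul := by
      -- In the convolution algebra, which is finite over K, a one-sided inverse of the identity is
      -- two-sided.
      have h2 : WithConv.toConv hμ.antipodeMap * WithConv.toConv (LinearMap.id : A →ₗ[K] A) = 1 :=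
        congrArg WithConv.toConv h1
      have : Module.Finite K (WithConv (A →ₗ[K] A)) :=
        Module.Finite.equiv (WithConv.linearEquiv K (A →ₗ[K] A)).symm
      have : IsArtinianRing (WithConv (A →ₗ[K] A)) := IsArtinianRing.of_finite K _
      exact congrArg WithConv.ofConv (mul_eq_one_symm h2) }

end IsHopfGaloisAction

end Construction

namespace HopfGaloisStructure

variable {K : Type u} {L : Type v} [Field K] [Field L] [Algebra K L] {A : Type u} [Ring A]
  [Algebra K A] {μ : A →ₐ[K] Module.End K L} [Module.Finite K A]
  {E : Type*} [AddCommGroup E] [Module K E] {T : L →ₗ[K] E}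

/-- The Hopf Galois structure determined by the action. -/
noncomputable def ofAction (hμ : IsHopfGaloisAction μ T) : HopfGaloisStructure K L :=
  letI := hμ.hopfAlgebra
  { H := A
    cocomm := ⟨by
      ext h
      refine hμ.pairing_ext fun l l' => ?_
      change actionPairing μ l l' (TensorProduct.comm K A A (hμ.comulMap h)) =
        actionPairing μ l l' (hμ.comulMap h)
      rw [actionPairing_comm, hμ.comulMap_spec, hμ.comulMap_spec, mul_comm]⟩
    μ := μ
    act_one := hμ.counitMap_spec
    act_mul := fun h x y => (hμ.comulMap_spec h x y).symm
    bijective := hμ.bijective }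

end HopfGaloisStructure

/-! ### The algebra descended from a regular subgroup -/

section DualElements

variable {K : Type u} {M : Type w} [Field K] [Field M] [Algebra K M] [FiniteDimensional K M]

/-- Dual families for the automorphisms: `∑ᵢ aᵢ σ(bᵢ)` is `1` if `σ = 1` and `0` otherwise. -/
theorem exists_dual_families : ∃ (d : ℕ) (a b : Fin d → M), ∑ i, a i * b i = 1 ∧
    ∀ σ : M ≃ₐ[K] M, σ ≠ 1 → ∑ i, a i * σ (b i) = 0 := by
  have hli := linearIndependent_toLinearMap K M M
  -- An M-linear functional that picks out the coefficient of the identity among the embeddings;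
  -- written in a K-basis of M it yields the two families.
  obtain ⟨g, hg⟩ := LinearMap.exists_extend ((Finsupp.lapply (AlgHom.id K M)) ∘ₗ hli.repr)
  let B := Module.finBasis K M
  have key : ∀ f : M →ₗ[K] M,
      g f = ∑ i, g ((Algebra.linearMap K M) ∘ₗ B.coord i) * f (B i) := by
    intro f
    have hf : f = ∑ i, f (B i) • ((Algebra.linearMap K M) ∘ₗ B.coord i) := by
      refine B.ext fun j => ?_
      rw [LinearMap.sum_apply, Finset.sum_eq_single j]
      · simp
      · intro i _ hi
        simp [Finsupp.single_eq_of_ne hi]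
      · simp
    conv_lhs => rw [hf]
    rw [map_sum]
    exact Finset.sum_congr rfl fun i _ => by rw [map_smul, smul_eq_mul, mul_comm]
  have hgσ : ∀ σ : M →ₐ[K] M, g σ.toLinearMap = Finsupp.single σ (1 : M) (AlgHom.id K M) := by
    intro σ
    have h1 := LinearMap.congr_fun hg ⟨σ.toLinearMap, Submodule.subset_span ⟨σ, rfl⟩⟩
    rw [LinearMap.comp_apply, LinearMap.comp_apply, hli.repr_eq_single σ _ rfl] at h1
    exact h1
  refine ⟨_, fun i => g ((Algebra.linearMap K M) ∘ₗ B.coord i), B, ?_, fun σ hσ => ?_⟩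
  · have h1 := key (AlgHom.id K M).toLinearMap
    rw [hgσ, Finsupp.single_eq_same] at h1
    exact h1.symm
  · have h1 := key (σ : M →ₐ[K] M).toLinearMap
    rw [hgσ, Finsupp.single_eq_of_ne] at h1
    · exact h1.symm
    · intro h2
      exact hσ (AlgEquiv.ext fun m => (DFunLike.congr_fun h2 m).symm)

end DualElements

section PermAlgebra

variable {K : Type u} {L : Type v} {M : Type w} [Field K] [Field L] [Field M]
  [Algebra K L] [Algebra K M] (N : Subgroup (Perm (L →ₐ[K] M))) [Fintype N]

/-- The endomorphism `φ` of `L` is given by the combination `∑ aₙ n` of permutations of the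
embeddings. -/
def HasCoeff (φ : Module.End K L) (a : N → M) : Prop :=
  ∀ (x : L →ₐ[K] M) (l : L), x (φ l) = ∑ n : N, a n * (n : Perm (L →ₐ[K] M)) x l

variable {N}

/-- At x the composite is ∑ a n * b m * (m n x)(l), so the factors in N appear in reversed order and
k = m n. -/
theorem HasCoeff.mul {φ ψ : Module.End K L} {a b : N → M} (hφ : HasCoeff N φ a)
    (hψ : HasCoeff N ψ b) : HasCoeff N (φ * ψ) fun k => ∑ n : N, a n * b (k * n⁻¹) := by
  intro x l
  rw [Module.End.mul_apply, hφ]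
  simp_rw [hψ _ l, Finset.mul_sum, Finset.sum_mul]
  refine Eq.trans (Finset.sum_congr rfl fun n _ => ?_) Finset.sum_comm
  rw [← (Equiv.mulRight n).bijective.sum_comp fun k : N => a n * b (k * n⁻¹) * (k : Perm (L →ₐ[K] M)) x l]
  refine Finset.sum_congr rfl fun m _ => ?_
  simp [mul_assoc]

theorem HasCoeff.add {φ ψ : Module.End K L} {a b : N → M} (hφ : HasCoeff N φ a)
    (hψ : HasCoeff N ψ b) : HasCoeff N (φ + ψ) (a + b) := by
  intro x l
  rw [LinearMap.add_apply, map_add, hφ, hψ, ← Finset.sum_add_distrib]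
  exact Finset.sum_congr rfl fun n _ => (add_mul _ _ _).symm

open Classical in
theorem hasCoeff_algebraMap (c : K) : HasCoeff N (algebraMap K (Module.End K L) c)
    (Pi.single 1 (algebraMap K M c)) := by
  intro x l
  rw [Finset.sum_eq_single 1]
  · simp [Module.algebraMap_end_apply, Algebra.smul_def]
  · intro n _ hn
    simp [hn]
  · simp

variable (N) in
/-- The endomorphisms of `L` that are combinations of permutations in `N`. -/
noncomputable def permSubalgebra : Subalgebra K (Module.End K L) where
  carrier := {φ | ∃ a, HasCoeff N φ a}
  mul_mem' := fun ⟨_, ha⟩ ⟨_, hb⟩ => ⟨_, ha.mul hb⟩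
  add_mem' := fun ⟨_, ha⟩ ⟨_, hb⟩ => ⟨_, ha.add hb⟩
  algebraMap_mem' c := ⟨_, hasCoeff_algebraMap c⟩

theorem mem_permSubalgebra {φ : Module.End K L} : φ ∈ permSubalgebra N ↔ ∃ a, HasCoeff N φ a :=
  Iff.rfl

/-- Conjugation by a Galois automorphism. -/
def conjBy (hG : ∀ σ, ∀ n ∈ N, galPerm K L M σ * n * (galPerm K L M σ)⁻¹ ∈ N)
    (σ : M ≃ₐ[K] M) (n : N) : N :=
  ⟨galPerm K L M σ * n * (galPerm K L M σ)⁻¹, hG σ n n.2⟩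

variable (hG : ∀ σ, ∀ n ∈ N, galPerm K L M σ * n * (galPerm K L M σ)⁻¹ ∈ N)

omit [Fintype N] in
theorem conjBy_apply (σ : M ≃ₐ[K] M) (n : N) (x : L →ₐ[K] M) (l : L) :
    (conjBy hG σ n : Perm (L →ₐ[K] M)) (galPerm K L M σ x) l =
      σ ((n : Perm (L →ₐ[K] M)) x l) := by
  simp [conjBy]

omit [Fintype N] in
theorem conjBy_injective (σ : M ≃ₐ[K] M) : Function.Injective (conjBy hG σ) := by
  intro a b h
  have h1 := congrArg Subtype.val h
  exact Subtype.ext (by simpa [conjBy] using h1)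

theorem conjBy_bijective (σ : M ≃ₐ[K] M) : Function.Bijective (conjBy hG σ) :=
  Finite.injective_iff_bijective.1 (conjBy_injective hG σ)

omit [Fintype N] in
theorem conjBy_mul (σ τ : M ≃ₐ[K] M) (n : N) :
    conjBy hG (σ * τ) n = conjBy hG σ (conjBy hG τ n) :=
  Subtype.ext (by simp [conjBy, mul_assoc])

omit [Fintype N] in
theorem conjBy_one (n : N) : conjBy hG 1 n = n := Subtype.ext (by simp [conjBy])

omit [Fintype N] in
theorem conjBy_inv (σ : M ≃ₐ[K] M) (n : N) : conjBy hG σ n⁻¹ = (conjBy hG σ n)⁻¹ :=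
  Subtype.ext (by simp [conjBy, mul_assoc])

variable [FiniteDimensional K L] [Algebra.IsSeparable K L] [hcl : IsNormalClosure K L M]

include hcl in
-- Equivariant coefficients make x ↦ ∑ a n * (n x)(l) an equivariant function on the embeddings,
-- which comes from an element of L by `exists_of_equivariant`.
theorem exists_hasCoeff {a : N → M} (ha : ∀ σ n, a (conjBy hG σ n) = σ (a n)) :
    ∃ φ : Module.End K L, HasCoeff N φ a := by
  obtain ⟨x₀⟩ := nonempty_embeddings (K := K) (L := L) (M := M)
  have h1 : ∀ l, ∃ l', ∀ x : L →ₐ[K] M, x l' = ∑ n : N, a n * (n : Perm (L →ₐ[K] M)) x l := by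
    intro l
    refine exists_of_equivariant _ fun σ x => ?_
    rw [← (conjBy_bijective hG σ).sum_comp, map_sum]
    exact Finset.sum_congr rfl fun n _ => by rw [conjBy_apply, ha, map_mul]
  choose f hf using h1
  have hx₀ : Function.Injective x₀ := x₀.injective
  refine ⟨⟨⟨f, fun l l' => hx₀ ?_⟩, fun c l => hx₀ ?_⟩, fun x l => hf l x⟩
  · rw [map_add, hf, hf, hf, ← Finset.sum_add_distrib]
    exact Finset.sum_congr rfl fun n _ => by rw [map_add, mul_add]
  · rw [RingHom.id_apply, map_smul, hf, hf, Finset.smul_sum]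
    exact Finset.sum_congr rfl fun n _ => by rw [map_smul, mul_smul_comm]

variable (hN : IsRegularSubgroup N)

omit [FiniteDimensional K L] [Algebra.IsSeparable K L] hcl in
include hN in
-- Regularity makes the embeddings n x distinct, so Dedekind independence applies.
theorem eq_zero_of_sum_perm {a : N → M} (x : L →ₐ[K] M)
    (h : ∀ l, ∑ n : N, a n * (n : Perm (L →ₐ[K] M)) x l = 0) : a = 0 := by
  have hli := (linearIndependent_toLinearMap K L M).comp
    (fun n : N => (n : Perm (L →ₐ[K] M)) x)
    (fun m n hmn => Subtype.ext (hN.eq_of_apply_eq m.2 n.2 hmn))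
  ext n
  refine Fintype.linearIndependent_iff.1 hli a ?_ n
  ext l
  simpa [LinearMap.sum_apply] using h l

include hcl hN in
theorem HasCoeff.equivariant {φ : Module.End K L} {a : N → M} (h : HasCoeff N φ a)
    (σ : M ≃ₐ[K] M) (n : N) : a (conjBy hG σ n) = σ (a n) := by
  obtain ⟨x⟩ := nonempty_embeddings (K := K) (L := L) (M := M)
  have h1 : (fun n => σ.symm (a (conjBy hG σ n)) - a n) = 0 := by
    refine eq_zero_of_sum_perm hN x fun l => ?_
    simp only [sub_mul, Finset.sum_sub_distrib]
    rw [← h x l, sub_eq_zero]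
    apply σ.injective
    rw [← galPerm_apply, h, map_sum, ← (conjBy_bijective hG σ).sum_comp fun n : N =>
      a n * (n : Perm (L →ₐ[K] M)) (galPerm K L M σ x) l]
    exact Finset.sum_congr rfl fun n _ => by rw [conjBy_apply, map_mul, AlgEquiv.apply_symm_apply]
  have h2 := sub_eq_zero.1 (congrFun h1 n)
  rw [← h2, AlgEquiv.apply_symm_apply]

variable {A : Type*} [Ring A] [Algebra K A] {μ : A →ₐ[K] Module.End K L}
  (hμ : Function.Injective μ) (hr : μ.range = permSubalgebra N)

omit [FiniteDimensional K L] [Algebra.IsSeparable K L] hcl in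
include hr in
theorem exists_coeff_evalAt (s : M ⊗[K] A) :
    ∃ a : N → M, ∀ x l, evalAt μ x s l = ∑ n : N, a n * (n : Perm (L →ₐ[K] M)) x l := by
  induction s with
  | zero => exact ⟨0, by simp⟩
  | tmul m h =>
    obtain ⟨a, ha⟩ := mem_permSubalgebra.1 (hr.le ⟨h, rfl⟩)
    refine ⟨fun n => m * a n, fun x l => ?_⟩
    rw [evalAt_tmul]
    erw [ha]
    simp [Finset.mul_sum, mul_assoc]
  | add s t hs ht =>
    obtain ⟨a, ha⟩ := hs
    obtain ⟨b, hb⟩ := ht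
    refine ⟨a + b, fun x l => ?_⟩
    rw [map_add, LinearMap.add_apply, ha, hb, ← Finset.sum_add_distrib]
    exact Finset.sum_congr rfl fun n _ => (add_mul _ _ _).symm

include hcl hG hr in
/-- Every permutation in `N` comes from the algebra over `M`. -/
theorem exists_evalAt_eq_perm (n₀ : N) : ∃ t : M ⊗[K] A, ∀ x,
    evalAt μ x t = ((n₀ : Perm (L →ₐ[K] M)) x).toLinearMap := by
  classical
  have := isGalois_of_isNormalClosure K L M
  have := finiteDimensional_of_isNormalClosure K L M
  obtain ⟨d, a, b, h1, h2⟩ := exists_dual_families (K := K) (M := M)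
  -- The orbit sums ∑ σ(m) σ n₀ σ⁻¹ are equivariant and so come from the algebra; the dual families
  -- then isolate the term σ = 1.
  have h3 : ∀ m : M, ∃ φ : Module.End K L, HasCoeff N φ fun n =>
      ∑ σ : M ≃ₐ[K] M, if conjBy hG σ n₀ = n then σ m else 0 := by
    intro m
    refine exists_hasCoeff hG fun τ n => ?_
    rw [map_sum, ← (Equiv.mulLeft τ).bijective.sum_comp]
    refine Finset.sum_congr rfl fun σ _ => ?_
    simp only [Equiv.coe_mulLeft, conjBy_mul, (conjBy_injective hG τ).eq_iff]
    split_ifs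
    · rfl
    · rw [map_zero]
  have h4 : ∀ m : M, ∃ h : A, ∀ (x : L →ₐ[K] M) l, x (μ h l) =
      ∑ σ : M ≃ₐ[K] M, σ m * (conjBy hG σ n₀ : Perm (L →ₐ[K] M)) x l := by
    intro m
    obtain ⟨φ, hφ⟩ := h3 m
    obtain ⟨h, rfl⟩ := hr.ge (mem_permSubalgebra.2 ⟨_, hφ⟩)
    refine ⟨h, fun x l => ?_⟩
    refine (hφ x l).trans ?_
    simp_rw [Finset.sum_mul]
    rw [Finset.sum_comm]
    refine Finset.sum_congr rfl fun σ _ => ?_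
    rw [Finset.sum_eq_single (conjBy hG σ n₀)]
    · simp
    · intro n _ hn
      rw [if_neg hn.symm, zero_mul]
    · simp
  choose h hh using h4
  refine ⟨∑ i, a i ⊗ₜ h (b i), fun x => ?_⟩
  ext l
  rw [map_sum, LinearMap.sum_apply]
  simp_rw [evalAt_tmul, hh, Finset.mul_sum]
  rw [Finset.sum_comm, Finset.sum_eq_single 1]
  · simp_rw [← mul_assoc, ← Finset.sum_mul, conjBy_one, AlgEquiv.one_apply]
    rw [h1, one_mul]
    rfl
  · intro σ _ hσ
    simp_rw [← mul_assoc, ← Finset.sum_mul]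
    rw [h2 σ hσ, zero_mul]
  · simp

include hcl in
omit [Fintype N] in
theorem eq_zero_of_evalAt (hμ : Function.Injective μ) {s : M ⊗[K] A}
    (h : ∀ x : L →ₐ[K] M, evalAt μ x s = 0) : s = 0 := by
  let B := Module.Free.chooseBasis K M
  obtain ⟨c, rfl⟩ := TensorProduct.eq_repr_basis_left B s
  have hc : c = 0 := by
    ext i
    apply hμ
    ext l
    have h1 : (c.mapRange (μ.toLinearMap.flip l) (map_zero _)).sum (fun i e => B i ⊗ₜ[K] e) = 0 := by
      refine eq_zero_of_tensorEval fun x => ?_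
      have h2 := LinearMap.congr_fun (h x) l
      rw [Finsupp.sum, map_sum, LinearMap.sum_apply] at h2
      rw [Finsupp.sum_mapRange_index (by simp), Finsupp.sum, map_sum]
      refine Eq.trans (Finset.sum_congr rfl fun i _ => ?_) h2
      simp
    have h2 := DFunLike.congr_fun (TensorProduct.sum_tmul_basis_left_eq_zero B _ h1) i
    simpa using h2
  rw [hc, Finsupp.sum_zero_index]

include hcl hN hr hμ in
theorem evalAt_injective_of_range (x : L →ₐ[K] M) : Function.Injective (evalAt μ x) := by
  rw [injective_iff_map_eq_zero]
  intro s hs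
  obtain ⟨a, ha⟩ := exists_coeff_evalAt hr s
  have ha0 : a = 0 := eq_zero_of_sum_perm hN x fun l => by rw [← ha, hs, LinearMap.zero_apply]
  refine eq_zero_of_evalAt hμ fun y => ?_
  ext l
  rw [ha, ha0]
  simp

include hcl hG hN hr in
theorem evalAt_surjective_of_range (x : L →ₐ[K] M) : Function.Surjective (evalAt μ x) := by
  rw [← LinearMap.range_eq_top, eq_top_iff, ← span_embeddings K L M, Submodule.span_le]
  rintro _ ⟨y, rfl⟩
  obtain ⟨n, hn, -⟩ := hN x y
  obtain ⟨t, ht⟩ := exists_evalAt_eq_perm hG hr n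
  exact ⟨t, by rw [ht, hn]⟩

include hcl hG hN hr hμ in
-- Extending scalars along x turns the map into `evalAt μ x`, so injectivity descends; the
-- bijectivity of the latter also gives the dimension count for surjectivity.
theorem action_bijective_of_range [Module.Finite K A] : Function.Bijective
    (LinearMap.mul' K (Module.End K L) ∘ₗ
      TensorProduct.map (Algebra.lmul K L).toLinearMap μ.toLinearMap) := by
  obtain ⟨x⟩ := nonempty_embeddings (K := K) (L := L) (M := M)
  have hx := evalAt_injective_of_range hN hμ hr x
  have hinj : Function.Injective (LinearMap.mul' K (Module.End K L) ∘ₗ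
      TensorProduct.map (Algebra.lmul K L).toLinearMap μ.toLinearMap) := by
    rw [injective_iff_map_eq_zero]
    intro t ht
    apply Module.Flat.rTensor_preserves_injective_linearMap (M := A) x.toLinearMap x.injective
    rw [map_zero]
    apply hx
    rw [map_zero]
    ext l
    rw [← comp_mul'_map_apply, ht]
    simp
  refine ⟨hinj, (LinearMap.injective_iff_surjective_of_finrank_eq_finrank ?_).1 hinj⟩
  have h1 := (LinearEquiv.ofBijective _ ⟨hx, evalAt_surjective_of_range hG hN hr x⟩).finrank_eq
  rw [Module.finrank_baseChange, Module.finrank_linearMap_self] at h1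
  rw [Module.finrank_tensorProduct, h1]
  exact (Module.finrank_linearMap _ _ _ _).symm

end PermAlgebra

/-! ### Comultiplication, counit and antipode of the descended algebra -/

section PermAction

variable {K : Type u} {L : Type v} {M : Type w} [Field K] [Field L] [Field M]
  [Algebra K L] [Algebra K M] {N : Subgroup (Perm (L →ₐ[K] M))} [Fintype N]
  (hG : ∀ σ, ∀ n ∈ N, galPerm K L M σ * n * (galPerm K L M σ)⁻¹ ∈ N)
  (hN : IsRegularSubgroup N)
  {A : Type*} [Ring A] [Algebra K A] {μ : A →ₐ[K] Module.End K L}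
  (hμ : Function.Injective μ) (hr : μ.range = permSubalgebra N)

theorem exists_liftBaseChange_actionPairing (s t : M ⊗[K] A) : ∃ u : M ⊗[K] (A ⊗[K] A),
    ∀ (x : L →ₐ[K] M) (l l' : L), (x.toLinearMap ∘ₗ actionPairing μ l l').liftBaseChange M u =
      evalAt μ x s l * evalAt μ x t l' := by
  induction s with
  | zero => exact ⟨0, by simp⟩
  | tmul m a =>
    induction t with
    | zero => exact ⟨0, by simp⟩
    | tmul m' a' => exact ⟨(m * m') ⊗ₜ (a ⊗ₜ a'), fun x l l' => by simp; ring⟩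
    | add b c hb hc =>
      obtain ⟨u, hu⟩ := hb
      obtain ⟨v, hv⟩ := hc
      exact ⟨u + v, fun x l l' => by rw [map_add, hu, hv, map_add, LinearMap.add_apply, mul_add]⟩
  | add b c hb hc =>
    obtain ⟨u, hu⟩ := hb
    obtain ⟨v, hv⟩ := hc
    exact ⟨u + v, fun x l l' => by rw [map_add, hu, hv, map_add, LinearMap.add_apply, add_mul]⟩

variable [FiniteDimensional K L] [Algebra.IsSeparable K L] [hcl : IsNormalClosure K L M]

include hcl hG hr in
-- Over M the comultiplication of ∑ a n · n is ∑ a n · n ⊗ n; it is formed there and retracted to K,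
-- which preserves the pairings.
theorem exists_comul_of_range (h : A) :
    ∃ t, ∀ l l', actionPairing μ l l' t = μ h (l * l') := by
  obtain ⟨a, ha⟩ := mem_permSubalgebra.1 (hr.le ⟨h, rfl⟩)
  choose t ht using exists_evalAt_eq_perm hG hr
  choose u hu using fun n => exists_liftBaseChange_actionPairing (μ := μ) (t n) (t n)
  refine ⟨tensorRetraction K M _ (∑ n, a n • u n), fun l l' =>
    apply_tensorRetraction (actionPairing μ l l') fun x => ?_⟩
  refine Eq.trans ?_ (ha x (l * l')).symm
  rw [map_sum]
  refine Finset.sum_congr rfl fun n _ => ?_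
  rw [map_smul, hu, ht, map_mul]
  rfl

include hcl hr in
-- Every embedding maps `μ h 1` to ∑ a n, so its image is fixed by the Galois group.
theorem exists_counit_of_range (h : A) : ∃ c, μ h 1 = algebraMap K L c := by
  obtain ⟨x⟩ := nonempty_embeddings (K := K) (L := L) (M := M)
  have := isGalois_of_isNormalClosure K L M
  have := finiteDimensional_of_isNormalClosure K L M
  obtain ⟨a, ha⟩ := mem_permSubalgebra.1 (hr.le ⟨h, rfl⟩)
  have h1 : ∀ y : L →ₐ[K] M, y (μ h 1) = ∑ n, a n := fun y =>
    (ha y 1).trans (Finset.sum_congr rfl fun n _ => by rw [map_one, mul_one])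
  obtain ⟨c, hc⟩ := (IsGalois.mem_range_algebraMap_iff_fixed (F := K) (x (μ h 1))).2 fun σ => by
    rw [← galPerm_apply, h1, h1]
  exact ⟨c, x.injective (hc.symm.trans (x.commutes c).symm)⟩

variable (K L M) in
/-- The trace, as the sum of all embeddings. -/
noncomputable def embSum : L →ₗ[K] M :=
  letI := Fintype.ofFinite (L →ₐ[K] M)
  ∑ x : L →ₐ[K] M, x.toLinearMap

omit [Algebra.IsSeparable K L] hcl in
theorem embSum_apply [Fintype (L →ₐ[K] M)] (l : L) : embSum K L M l = ∑ x : L →ₐ[K] M, x l := by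
  rw [embSum, LinearMap.sum_apply]
  exact Finset.sum_congr (by ext; simp) fun _ _ => rfl

include hcl in
theorem eq_zero_of_embSum (l : L) (h : ∀ l', embSum K L M (l' * l) = 0) : l = 0 := by
  obtain ⟨x₀⟩ := nonempty_embeddings (K := K) (L := L) (M := M)
  have := Fintype.ofFinite (L →ₐ[K] M)
  have h1 := Fintype.linearIndependent_iff.1 (linearIndependent_toLinearMap K L M)
    (fun x => x l) (by
      ext l'
      have h2 := h l'
      rw [embSum_apply] at h2
      simpa [LinearMap.sum_apply, mul_comm] using h2) x₀
  exact x₀.injective (h1.trans (map_zero x₀).symm)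

omit [Algebra.IsSeparable K L] hcl in
theorem embSum_action [Fintype (L →ₐ[K] M)] {φ : Module.End K L} {a : N → M}
    (h : HasCoeff N φ a) (l : L) : embSum K L M (φ l) = (∑ n, a n) * embSum K L M l := by
  rw [embSum_apply, embSum_apply]
  simp_rw [h _ l]
  rw [Finset.sum_comm, Finset.sum_mul]
  refine Finset.sum_congr rfl fun n _ => ?_
  rw [← Finset.mul_sum, (n : Perm (L →ₐ[K] M)).bijective.sum_comp fun x : L →ₐ[K] M => x l]

include hcl hG hN hr in
-- The antipode inverts group elements: its coefficients n ↦ a n⁻¹ are equivariant because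
-- conjugation respects inverses. Adjointness is the substitution x ↦ n x in the sum over
-- embeddings.
theorem exists_antipode_of_range (h : A) : ∃ s, ∀ l l',
    embSum K L M (l * μ s l') = embSum K L M (μ h l * l') := by
  have := Fintype.ofFinite (L →ₐ[K] M)
  obtain ⟨a, ha⟩ := mem_permSubalgebra.1 (hr.le ⟨h, rfl⟩)
  obtain ⟨φ, hφ⟩ := exists_hasCoeff hG (a := fun n => a n⁻¹) fun σ n => by
    rw [← conjBy_inv, ha.equivariant hG hN]
  obtain ⟨s, rfl⟩ := hr.ge (mem_permSubalgebra.2 ⟨_, hφ⟩)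
  refine ⟨s, fun l l' => ?_⟩
  rw [embSum_apply, embSum_apply]
  have h1 : ∀ x : L →ₐ[K] M, x (l * μ s l') =
      ∑ n : N, a n * (x l * (n⁻¹ : Perm (L →ₐ[K] M)) x l') := by
    intro x
    rw [map_mul, show x (μ s l') = _ from hφ x l', ← (Equiv.inv N).bijective.sum_comp,
      Finset.mul_sum]
    exact Finset.sum_congr rfl fun n _ => by simp; ring
  have h2 : ∀ x : L →ₐ[K] M, x (μ h l * l') =
      ∑ n : N, a n * ((n : Perm (L →ₐ[K] M)) x l * x l') := by
    intro x
    rw [map_mul, show x (μ h l) = _ from ha x l, Finset.sum_mul]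
    exact Finset.sum_congr rfl fun n _ => by ring
  simp_rw [h1, h2]
  refine Finset.sum_comm.trans (Eq.trans (Finset.sum_congr rfl fun n _ => ?_) Finset.sum_comm)
  rw [← Finset.mul_sum, ← Finset.mul_sum, ← (n : Perm (L →ₐ[K] M)).bijective.sum_comp
    fun x : L →ₐ[K] M => x l * (n⁻¹ : Perm (L →ₐ[K] M)) x l']
  simp

include hcl hG hN hr hμ in
theorem isHopfGaloisAction_of_range [Module.Finite K A] : IsHopfGaloisAction μ (embSum K L M) where
  bijective := action_bijective_of_range hG hN hμ hr
  exists_comul := exists_comul_of_range hG hr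
  exists_counit := exists_counit_of_range hr
  nondegenerate := eq_zero_of_embSum
  exists_antipode := exists_antipode_of_range hG hN hr
  invariant h l := by
    have := Fintype.ofFinite (L →ₐ[K] M)
    obtain ⟨a, ha⟩ := mem_permSubalgebra.1 (hr.le ⟨h, rfl⟩)
    have h1 : ∀ x : L →ₐ[K] M, x (μ h 1 * l) = (∑ n, a n) * x l := fun x => by
      rw [map_mul, show x (μ h 1) = _ from ha x 1]
      simp
    rw [show embSum K L M (μ h l) = _ from embSum_action ha l, embSum_apply, embSum_apply]
    simp_rw [h1]
    rw [Finset.mul_sum]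

end PermAction

/-! ### The correspondence and the main theorem -/

namespace HopfGaloisStructure

variable {K : Type u} {L : Type v} {M : Type w} [Field K] [Field L] [Field M]
  [Algebra K L] [Algebra K M] [FiniteDimensional K L] [Algebra.IsSeparable K L]
  [hcl : IsNormalClosure K L M]

include hcl in
/-- Every regular subgroup normalized by the Galois group comes from a Hopf Galois structure. -/
theorem exists_permGroup_eq {N : Subgroup (Perm (L →ₐ[K] M))} (hN : IsRegularSubgroup N)
    (hG : ∀ σ, ∀ n ∈ N, galPerm K L M σ * n * (galPerm K L M σ)⁻¹ ∈ N) :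
    ∃ S : HopfGaloisStructure K L, S.permGroup M = N := by
  obtain ⟨x₀⟩ := nonempty_embeddings (K := K) (L := L) (M := M)
  have : Fintype N := Fintype.ofFinite N
  have : Module.Free K (permSubalgebra N) := Module.Free.of_divisionRing K (permSubalgebra N)
  -- The algebra lives in the universe of L; being finite over K, it has a copy in the universe of
  -- K.
  have hsm : Small.{u} (permSubalgebra N) :=
    small_of_injective (Module.finBasis K (permSubalgebra N)).equivFun.injective
  let e := Shrink.algEquiv K (permSubalgebra N)
  have : Module.Finite K (Shrink.{u} (permSubalgebra N)) :=
    Module.Finite.equiv e.symm.toLinearEquiv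
  let μ : Shrink.{u} (permSubalgebra N) →ₐ[K] Module.End K L :=
    (permSubalgebra N).val.comp e.toAlgHom
  have hμ : Function.Injective μ := Subtype.val_injective.comp e.injective
  have hr : μ.range = permSubalgebra N := by
    ext φ
    constructor
    · rintro ⟨a, rfl⟩
      exact (e a).2
    · intro hφ
      exact ⟨e.symm ⟨φ, hφ⟩, congrArg Subtype.val (e.apply_symm_apply ⟨φ, hφ⟩)⟩
  let S := ofAction (isHopfGaloisAction_of_range (A := Shrink.{u} (permSubalgebra N)) hG hN hμ hr)
  have h1 : N ≤ S.permGroup M := by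
    intro n hn
    obtain ⟨t, ht⟩ := exists_evalAt_eq_perm (A := Shrink.{u} (permSubalgebra N)) hG hr ⟨n, hn⟩
    have : Nonempty (L →ₐ[K] M) := ⟨x₀⟩
    exact S.mem_permGroup_of_evalAt (g := t) ht
  -- Two regular groups, one contained in the other, coincide.
  refine ⟨S, le_antisymm (fun m hm => ?_) h1⟩
  obtain ⟨n, hn, -⟩ := hN x₀ (m x₀)
  rw [S.isRegularSubgroup_permGroup.eq_of_apply_eq hm (h1 n.2) hn.symm]
  exact n.2

end HopfGaloisStructure

namespace HopfGaloisStructure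

variable {K : Type u} {L : Type v} {M : Type w} [Field K] [Field L] [Field M]
  [Algebra K L] [Algebra K M] [FiniteDimensional K L] [Algebra.IsSeparable K L]
  [hcl : IsNormalClosure K L M]

include hcl in
theorem isOfType_dihedral_iff {p : ℕ} (S : HopfGaloisStructure K L) :
    S.IsOfType M (DihedralGroup p) ↔
      S.permGroup M ∈ regularDihedral p (galPerm K L M).range := by
  rw [isOfType_iff]
  refine ⟨fun h => ⟨S.isRegularSubgroup_permGroup, ?_, h⟩, fun h => h.2.2⟩
  rintro _ ⟨σ, rfl⟩ n hn
  exact S.conj_mem_permGroup σ hn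

include hcl in
theorem exists_of_mem_regularDihedral {p : ℕ} {N : Subgroup (Perm (L →ₐ[K] M))}
    (hN : N ∈ regularDihedral p (galPerm K L M).range) :
    ∃ S : HopfGaloisStructure K L, S.permGroup M = N :=
  exists_permGroup_eq hN.1 fun σ n hn => hN.2.1 _ ⟨σ, rfl⟩ n hn

include hcl in
/-- Byott's count: the structures of dihedral type correspond to the regular dihedral subgroups
normalized by the Galois group. -/
theorem numberOfType_dihedral (p : ℕ) : numberOfType K L M (DihedralGroup p) =
    (regularDihedral p (galPerm K L M).range).ncard := by
  rw [numberOfType, ← Nat.card_coe_set_eq]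
  refine Nat.card_congr (Equiv.ofBijective
    (Quotient.lift (fun S => ⟨S.1.permGroup M, S.1.isOfType_dihedral_iff.1 S.2⟩)
      fun S T h => Subtype.ext (iso_iff.1 h)) ⟨?_, ?_⟩)
  · rintro ⟨S⟩ ⟨T⟩ h
    exact Quotient.sound (iso_iff.2 (congrArg Subtype.val h))
  · rintro ⟨N, hN⟩
    obtain ⟨S, rfl⟩ := exists_of_mem_regularDihedral hN
    exact ⟨Quotient.mk _ ⟨S, S.isOfType_dihedral_iff.2 hN⟩, rfl⟩

end HopfGaloisStructure

theorem theorem5p2 {K : Type u} {L : Type v} {M : Type w} [Field K] [Field L] [Field M]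
    [Algebra K L] [Algebra K M] (p : ℕ) (hp : p.Prime) (hp2 : p ≠ 2)
    [Algebra.IsSeparable K L] (hdeg : Module.finrank K L = 2 * p) [IsNormalClosure K L M] :
    ((∃ S : HopfGaloisStructure K L, S.IsOfType M (DihedralGroup p)) ↔
      IsOfListedShape p (M ≃ₐ[K] M)) ∧
    ((∃ S : HopfGaloisStructure K L, S.IsOfType M (DihedralGroup p)) ↔
      IsOfListedShapeExplicit p (M ≃ₐ[K] M)) ∧
    ((∃ S : HopfGaloisStructure K L, S.IsOfType M (DihedralGroup p)) →
      HopfGaloisStructure.numberOfType K L M (DihedralGroup p) = 2) := by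
  have : Fact p.Prime := ⟨hp⟩
  have : FiniteDimensional K L :=
    FiniteDimensional.of_finrank_pos (by rw [hdeg]; have := hp.pos; omega)
  have hX : Nat.card (L →ₐ[K] M) = 2 * p := by rw [card_embeddings, hdeg]
  have htr : ∀ x x' : L →ₐ[K] M, ∃ g ∈ (galPerm K L M).range, g x = x' := fun x x' => by
    obtain ⟨σ, hσ⟩ := exists_galPerm_eq x x'
    exact ⟨_, ⟨σ, rfl⟩, hσ⟩
  have e : (M ≃ₐ[K] M) ≃* (galPerm K L M).range :=
    MonoidHom.ofInjective (galPerm_injective (K := K) (L := L))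
  have h1 : (∃ S : HopfGaloisStructure K L, S.IsOfType M (DihedralGroup p)) →
      NormalizesFree p (galPerm K L M).range := fun ⟨S, hS⟩ =>
    NormalizesFree.of_mem_regularDihedral hp2 (S.isOfType_dihedral_iff.1 hS)
  have h2 : NormalizesFree p (galPerm K L M).range → IsOfListedShapeExplicit p (M ≃ₐ[K] M) :=
    fun h => (h.isOfListedShapeExplicit hp2 hX htr).of_mulEquiv e
  have h3 : IsOfListedShape p (M ≃ₐ[K] M) → NormalizesFree p (galPerm K L M).range := fun h =>
    NormalizesFree.of_hasAbelianLayers hp2 hX htr ((h.hasAbelianLayers hp2).of_mulEquiv e.symm)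
  have h4 : NormalizesFree p (galPerm K L M).range →
      ∃ S : HopfGaloisStructure K L, S.IsOfType M (DihedralGroup p) := fun h => by
    have hc := h.ncard_regularDihedral hX hp2 htr
    obtain ⟨N, hN⟩ := Set.nonempty_of_ncard_ne_zero (by rw [hc]; decide)
    obtain ⟨S, rfl⟩ := HopfGaloisStructure.exists_of_mem_regularDihedral hN
    exact ⟨S, S.isOfType_dihedral_iff.2 hN⟩
  -- All implications pass through `NormalizesFree`: (a) implies it, it implies (c), (c) implies
  -- (b), and (b) implies it. It gives back (a) because the count 2 is not zero.
  refine ⟨⟨fun h => (h2 (h1 h)).isOfListedShape, fun h => h4 (h3 h)⟩,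
    ⟨fun h => h2 (h1 h), fun h => h4 (h3 h.isOfListedShape)⟩, fun h => ?_⟩
  rw [HopfGaloisStructure.numberOfType_dihedral]
  exact (h1 h).ncard_regularDihedral hX hp2 htr
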